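/- Let $n\ge 1$ and $0<\gamma\le 1$, and let $|\cdot|$ denote the $\ell_\infty$ norm on $\mathbb{R}^n$. For $k\in\mathbb{Z}$ let $\mathcal{Q}_k$ be the set of standard dyadic cubes $\prod_{i=1}^n[j_i2^{-k},(j_i+1)2^{-k})$, $j\in\mathbb{Z}^n$. For a cube $Q$ and $\delta>1$ let $\delta Q$ be the cube with the same center and $\delta$ times the edge length. For $f\in L_2(\mathbb{R}^n)$ (complex valued) let $f_k=\sum_{Q\in\mathcal{Q}_k}\big(\frac1{|Q|}\int_Q f\big)1_Q$, $df_k=f_k-f_{k-1}$ and $\Gamma_k=\mathrm{supp}\,df_k=\{df_k\neq0\}$, which is a union of cubes of $\mathcal{Q}_k$. Put $$\Sigma_f=\bigcup_{k\in\mathbb{Z}}9\,\Gamma_k=\bigcup_{k\in\mathbb{Z}}\ \bigcup_{Q\in\mathcal{Q}_k,\,Q\subset\Gamma_k}9Q,\qquad \xi\,\Sigma_f=\bigcup_{k\in\mathbb{Z}}\ \bigcup_{Q\in\mathcal{Q}_k,\,Q\subset\Gamma_k}\xi(9Q)\quad(\xi>1).$$ A Calderón–Zygmund operator with Lipschitz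 parameter $\gamma$ and kernel constant $A$ is a bounded linear operator $T$ on $L_2(\mathbb{R}^n)$ for which there is a kernel $k:\{(x,y)\in\mathbb{R}^{n}\times\mathbb{R}^n: x\ne y\}\to\mathbb{C}$ such that $T\varphi(x)=\int k(x,y)\varphi(y)\,dy$ for every $\varphi\in C_c^\infty(\mathbb{R}^n)$ and almost every $x\notin\mathrm{supp}\,\varphi$, and such that for $x\neq y$ $$|k(x,y)|\le\frac{A}{|x-y|^n},\qquad |k(x,y)-k(x',y)|\le A\,\frac{|x-x'|^\gamma}{|x-y|^{n+\gamma}}\ \text{ if } |x-x'|\le\tfrac12|x-y|,\qquad |k(x,y)-k(x,y')|\le A\,\frac{|y-y'|^\gamma}{|x-y|^{n+\gamma}}\ \text{ if } |y-y'|\le\tfrac12|x-y|.$$ Then there is a constant $c_{n,\gamma}>0$, depending only on $n$ and $\gamma$, such that for every $f\in L_2(\mathbb{R}^n)$, every $\xi>4$, every $A$, and every Calderón–Zygmund operator $T$ with Lipschitz parameter $\gamma$, kernel constant $A$ and $\|T\|_{L_2\to L_2}\le1$, $$\Big(\int_{\mathbb{R}^n\setminus\xi\Sigma_f}|Tf(x)|^2\,dx\Big)^{1/2}\le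 c_{n,\gamma}\,\max(1,A)\,\xi^{-\gamma/4}\log\xi\,\Big(\int_{\mathbb{R}^n}|f(x)|^2\,dx\Big)^{1/2}.$$ In particular, if the constants in the size and smoothness conditions are at most $1$, the factor $\max(1,A)$ disappears. -/

import Mathlib

open MeasureTheory
open scoped ContDiff

namespace PseudoLoc

/-- The space `ℝⁿ`. Its norm is the `ℓ_∞` norm and `volume` is the Lebesgue measure. -/
abbrev Space (n : ℕ) : Type := Fin n → ℝ

/-- The space `L₂(ℝⁿ)` of complex valued functions. -/
abbrev L2 (n : ℕ) : Type := Lp ℂ 2 (volume : Measure (Space n))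

/-- The size (edge length) `2⁻ᵏ` of the dyadic cubes of generation `k`. -/
noncomputable def size (k : ℤ) : ℝ := (2 : ℝ) ^ (-k)

/-- The dyadic cube `∏ᵢ [jᵢ 2⁻ᵏ, (jᵢ + 1) 2⁻ᵏ)` of generation `k`. -/
def dyadicCube {n : ℕ} (k : ℤ) (j : Fin n → ℤ) : Set (Space n) :=
  {x | ∀ i, x i ∈ Set.Ico ((j i : ℝ) * size k) (((j i : ℝ) + 1) * size k)}

/-- The `δ`-concentric father `δ Q` of the dyadic cube `Q = dyadicCube k j`: the cube with the same
center as `Q` and with size `δ` times the size of `Q`. -/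
def concentricFather {n : ℕ} (δ : ℝ) (k : ℤ) (j : Fin n → ℤ) : Set (Space n) :=
  {x | ∀ i, x i ∈ Set.Ico (((j i : ℝ) + 1 / 2) * size k - δ * size k / 2)
    (((j i : ℝ) + 1 / 2) * size k + δ * size k / 2)}

/-- The index of the only dyadic cube of generation `k` that contains `x`. -/
noncomputable def dyadicIndex {n : ℕ} (k : ℤ) (x : Space n) : Fin n → ℤ :=
  fun i => ⌊x i / size k⌋

theorem size_pos (k : ℤ) : 0 < size k := by
  unfold size
  positivity

theorem mem_dyadicCube_iff {n : ℕ} (k : ℤ) (j : Fin n → ℤ) (x : Space n) :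
    x ∈ dyadicCube k j ↔ dyadicIndex k x = j := by
  have h := size_pos k
  simp only [dyadicCube, dyadicIndex, funext_iff, Set.mem_ofPred_eq, Set.mem_Ico, Int.floor_eq_iff,
    le_div_iff₀ h, div_lt_iff₀ h]

/-- The dyadic conditional expectation `f_k = ∑_{Q ∈ 𝒬_k} f_Q 1_Q`, where `f_Q` is the average of `f`
over `Q`. -/
noncomputable def dyadicExp {n : ℕ} (k : ℤ) (f : Space n → ℂ) : Space n → ℂ :=
  fun x => ⨍ y in dyadicCube k (dyadicIndex k x), f y

/-- The dyadic martingale difference `df_k = f_k - f_{k-1}`. -/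
noncomputable def dyadicDiff {n : ℕ} (k : ℤ) (f : Space n → ℂ) : Space n → ℂ :=
  fun x => dyadicExp k f x - dyadicExp (k - 1) f x

/-- For a set `Γ` that is a union of dyadic cubes of generation `k`, this is the dilation `δ Γ`,
the union of the cubes `δ Q` over the dyadic cubes `Q ⊆ Γ` of generation `k`. -/
def dilation {n : ℕ} (δ : ℝ) (k : ℤ) (Γ : Set (Space n)) : Set (Space n) :=
  ⋃ (j : Fin n → ℤ) (_ : dyadicCube k j ⊆ Γ), concentricFather δ k j

/-- The set `ξ Σ_f`, where `Σ_f = ⋃_k 9 Γ_k` and `Γ_k = supp df_k`. As `Σ_f` is the union of the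
cubes `9 Q`, with `Q ⊆ Γ_k` a dyadic cube of generation `k`, its dilation `ξ Σ_f` is the union of the
corresponding concentric cubes `ξ (9 Q) = (9 ξ) Q`. In particular `Σ_f` itself is the case `ξ = 1`. -/
def dilatedSigma {n : ℕ} (ξ : ℝ) (f : Space n → ℂ) : Set (Space n) :=
  ⋃ k : ℤ, dilation (ξ * 9) k (Function.support (dyadicDiff k f))

/-- The size and the two `γ`-Lipschitz smoothness conditions, with constant `A`, for a kernel
defined off the diagonal (the values `k x x` are irrelevant). Distances are taken in `ℓ_∞`. -/
structure IsLipschitzKernel {n : ℕ} (γ A : ℝ) (k : Space n → Space n → ℂ) : Prop where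
  bound : ∀ x y, x ≠ y → ‖k x y‖ ≤ A / ‖x - y‖ ^ n
  smooth_left : ∀ x x' y, x ≠ y → ‖x - x'‖ ≤ 1 / 2 * ‖x - y‖ →
    ‖k x y - k x' y‖ ≤ A * (‖x - x'‖ ^ γ / ‖x - y‖ ^ ((n : ℝ) + γ))
  smooth_right : ∀ x y y', x ≠ y → ‖y - y'‖ ≤ 1 / 2 * ‖x - y‖ →
    ‖k x y - k x y'‖ ≤ A * (‖y - y'‖ ^ γ / ‖x - y‖ ^ ((n : ℝ) + γ))

/-- The bounded operator `T` on `L₂` is associated to the kernel `k`: for every smooth compactly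
supported `φ`, one has `T φ (x) = ∫ k(x, y) φ(y) dy` off the support of `φ`. -/
def IsAssociated {n : ℕ} (T : L2 n →L[ℂ] L2 n) (k : Space n → Space n → ℂ) : Prop :=
  ∀ (φ : Space n → ℂ) (hφ : ContDiff ℝ ∞ φ) (hc : HasCompactSupport φ),
    ∀ᵐ x : Space n, x ∉ tsupport φ →
      T ((hφ.continuous.memLp_of_hasCompactSupport hc).toLp φ) x = ∫ y, k x y * φ y

/-- `T` is an `L₂`-bounded Calderón-Zygmund operator with Lipschitz parameter `γ`, whose kernel
satisfies the size and smoothness conditions with constant `A`. -/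
def IsCZO {n : ℕ} (γ A : ℝ) (T : L2 n →L[ℂ] L2 n) : Prop :=
  ∃ k : Space n → Space n → ℂ, IsLipschitzKernel γ A k ∧ IsAssociated T k

end PseudoLoc

/-! Choose `t` with 2^(t+2) ≤ ξ < 2^(t+3) and regroup f as the sum over i of g_i = df_{i+t+1}. Each
g_i has mean zero on the cubes of generation i+t, which are 2^t times finer than those of generation
i. A point off ξΣ_f lies at distance at least 5·2^(-i) from every g_i, so near such a point T g_i is
given by the kernel truncated at distance about 2^(-i). Write τ_i for the image of g_i under that
truncated kernel, and E_i for the conditional expectation `dyadicExp i`. Off ξΣ_f one has T g_i =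
E_i τ_i + (τ_i - E_i τ_i). The goal is a bound 2^(-γt/4) for the sum over i of each part.

The oscillation part is almost orthogonal in i: cancellation of g_i and smoothness of the kernel in
y make τ_i small, while smoothness in x makes τ_j - E_i τ_j decay in i - j (`IsAtom.norm_tau_le`,
`IsAtom.norm_tau_sub_le`).

For the martingale part, the summands must stay small under the coarser projections E_j, j ≤ i, and
E_j T g_i need not be small, because T^*1 need not vanish. This is cured by subtracting a
paraproduct: with B a large union of cubes carrying all g_i and b = T^*1_B, put a_i = T g_i - b̄ g_i
(`twist`). Off ξΣ_f nothing changes, since g_i vanishes on the generation-i cube of the point. The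
integral of a_i over a cube Q reduces to interactions across the boundary of Q
(`setIntegral_twist`). Those at distance about 2^(-(i+t)) are controlled by the L₂ bound and the
small volume of a boundary layer; the others by kernel decay and Schur's test. Only one of the two
Schur bounds is small, which halves the exponent: the squared norm of E_j a_i gains
(2^(-(i+t))/2^(-j))^(γ/2), the norm itself a power γ/4 (`IsAtom.norm_dyadicProj_twist_le`).

Almost orthogonality (`sq_norm_sum_le`) sums both parts in `setLIntegral_sq_sum_le`, and
orthogonality of martingale differences returns ‖f‖. General f is reached by truncating the
martingale and letting the truncation grow. The factor log ξ enters only through log ξ ≥ 1. -/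

namespace PseudoLoc

open scoped ENNReal NNReal

/-! ### Cauchy–Schwarz and Schur's test. -/

section Schur

variable {α β : Type*} [MeasurableSpace α] [MeasurableSpace β]

theorem sq_lintegral_mul_le (μ : Measure α) {f g : α → ℝ≥0∞} (hf : AEMeasurable f μ)
    (hg : AEMeasurable g μ) :
    (∫⁻ a, f a * g a ∂μ) ^ 2 ≤ (∫⁻ a, f a ^ 2 ∂μ) * ∫⁻ a, g a ^ 2 ∂μ := by
  have h := ENNReal.lintegral_mul_le_Lp_mul_Lq μ Real.HolderConjugate.two_two hf hg
  have h2 := pow_le_pow_left' h 2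
  simp only [Pi.mul_apply, mul_pow, ← ENNReal.rpow_mul_natCast] at h2
  norm_num at h2
  exact h2

theorem sq_lintegral_le (μ : Measure α) {f : α → ℝ≥0∞} (hf : AEMeasurable f μ) :
    (∫⁻ a, f a ∂μ) ^ 2 ≤ μ Set.univ * ∫⁻ a, f a ^ 2 ∂μ := by
  simpa using sq_lintegral_mul_le μ (f := fun _ => 1) aemeasurable_const hf

/-- Cauchy–Schwarz against the constant 1, for the measure with density `K`. -/
theorem sq_lintegral_mul_le_weight (μ : Measure α) {K f : α → ℝ≥0∞} (hK : Measurable K)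
    (hf : Measurable f) :
    (∫⁻ a, K a * f a ∂μ) ^ 2 ≤ (∫⁻ a, K a ∂μ) * ∫⁻ a, K a * f a ^ 2 ∂μ := by
  have h := sq_lintegral_le (μ.withDensity K) hf.aemeasurable
  rwa [lintegral_withDensity_eq_lintegral_mul _ hK hf,
    lintegral_withDensity_eq_lintegral_mul _ hK (hf.pow_const 2), withDensity_apply _ .univ,
    Measure.restrict_univ] at h

/-- Schur's test. -/
theorem lintegral_sq_kernel_le (μ : Measure α) (ν : Measure β) [SFinite μ] [SFinite ν]
    {K : α → β → ℝ≥0∞} (hK : Measurable (Function.uncurry K)) {f : β → ℝ≥0∞} (hf : Measurable f)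
    {a b : ℝ≥0∞} (ha : ∀ x, ∫⁻ y, K x y ∂ν ≤ a) (hb : ∀ y, ∫⁻ x, K x y ∂μ ≤ b) :
    ∫⁻ x, (∫⁻ y, K x y * f y ∂ν) ^ 2 ∂μ ≤ a * b * ∫⁻ y, f y ^ 2 ∂ν := by
  have hK2 : Measurable (fun p : α × β => K p.1 p.2 * f p.2 ^ 2) :=
    hK.mul ((hf.comp measurable_snd).pow_const 2)
  calc ∫⁻ x, (∫⁻ y, K x y * f y ∂ν) ^ 2 ∂μ
      ≤ ∫⁻ x, a * ∫⁻ y, K x y * f y ^ 2 ∂ν ∂μ := by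
        refine lintegral_mono fun x => ?_
        refine (sq_lintegral_mul_le_weight ν (hK.of_uncurry_left) hf).trans ?_
        gcongr
        exact ha x
    _ = a * ∫⁻ y, ∫⁻ x, K x y * f y ^ 2 ∂μ ∂ν := by
        rw [lintegral_const_mul _ hK2.lintegral_prod_right', lintegral_lintegral_swap hK2.aemeasurable]
    _ ≤ a * ∫⁻ y, b * f y ^ 2 ∂ν := by
        gcongr with y
        rw [lintegral_mul_const _ hK.of_uncurry_right]
        gcongr
        exact hb y
    _ = _ := by
        rw [lintegral_const_mul _ (hf.pow_const 2), mul_assoc]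

end Schur

/-! ### Dyadic cubes and conditional expectations. -/

section Dyadic

variable {n : ℕ}

theorem size_succ (k : ℤ) : size (k - 1) = 2 * size k := by
  unfold size
  rw [neg_sub, sub_eq_add_neg, zpow_add₀ two_ne_zero, zpow_one]

theorem size_add (j k : ℤ) : size (j + k) = size j * size k := by
  unfold size
  rw [neg_add, zpow_add₀ two_ne_zero]

theorem size_le_size {j k : ℤ} (h : j ≤ k) : size k ≤ size j := by
  unfold size
  exact zpow_le_zpow_right₀ one_le_two (by omega)

theorem measurable_dyadicIndex (k : ℤ) : Measurable (dyadicIndex k : Space n → Fin n → ℤ) := by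
  unfold dyadicIndex
  exact measurable_pi_lambda _ fun i => ((measurable_pi_apply i).div_const _).floor

theorem mem_dyadicCube_dyadicIndex (k : ℤ) (x : Space n) : x ∈ dyadicCube k (dyadicIndex k x) :=
  (mem_dyadicCube_iff _ _ _).2 rfl

theorem dyadicCube_eq_preimage (k : ℤ) (j : Fin n → ℤ) :
    dyadicCube k j = dyadicIndex k ⁻¹' {j} := by
  ext x; simp [mem_dyadicCube_iff]

theorem measurableSet_dyadicCube (k : ℤ) (j : Fin n → ℤ) : MeasurableSet (dyadicCube k j) := by
  rw [dyadicCube_eq_preimage]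
  exact measurable_dyadicIndex k (measurableSet_singleton j)

theorem dyadicIndex_congr_of_le {j k : ℤ} (h : j ≤ k) {x y : Space n}
    (hxy : dyadicIndex k x = dyadicIndex k y) : dyadicIndex j x = dyadicIndex j y := by
  induction j, h using Int.leInductionDown with
  | base => exact hxy
  | pred m _ ih =>
    funext i
    -- The index of the parent cube is the integer half of the child's, so it is determined by it.
    have key : ∀ z : Space n, dyadicIndex (m - 1) z i = dyadicIndex m z i / 2 := by
      intro z
      simp only [dyadicIndex, size_succ]
      have : z i / (2 * size m) = z i / size m / (2 : ℕ) := by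
        rw [div_div, mul_comm]; norm_num
      rw [this]
      exact_mod_cast Int.floor_div_natCast (z i / size m) 2
    rw [key, key, ih]

theorem volume_dyadicCube (k : ℤ) (j : Fin n → ℤ) :
    volume (dyadicCube k j) = ENNReal.ofReal (size k ^ n) := by
  have : dyadicCube k j
      = Set.pi Set.univ fun i => Set.Ico ((j i : ℝ) * size k) (((j i : ℝ) + 1) * size k) := by
    ext x; simp [dyadicCube]
  rw [this, Real.volume_pi_Ico]
  simp only [add_mul, add_sub_cancel_left, one_mul, Finset.prod_const, Finset.card_univ,
    Fintype.card_fin]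
  rw [ENNReal.ofReal_pow (size_pos k).le]

theorem norm_sub_le_size {k : ℤ} {x y : Space n} (h : dyadicIndex k x = dyadicIndex k y) :
    ‖x - y‖ ≤ size k := by
  refine (pi_norm_le_iff_of_nonneg (size_pos k).le).2 fun i => ?_
  have hx := mem_dyadicCube_dyadicIndex k x i
  have hy := mem_dyadicCube_dyadicIndex k y i
  rw [← h] at hy
  simp only [Set.mem_Ico] at hx hy
  rw [Real.norm_eq_abs, Pi.sub_apply, abs_le]
  constructor <;> linarith

/-- The kernel of the operator `dyadicExp k`. -/
noncomputable def avgKernel (k : ℤ) (x y : Space n) : ℝ :=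
  if dyadicIndex k x = dyadicIndex k y then (size k ^ n)⁻¹ else 0

theorem avgKernel_eq (k : ℤ) (x y : Space n) :
    avgKernel k x y = if dyadicIndex k x = dyadicIndex k y then (size k ^ n)⁻¹ else 0 := rfl

theorem avgKernel_of_mem {k : ℤ} {x y : Space n} (h : y ∈ dyadicCube k (dyadicIndex k x)) :
    avgKernel k x y = (size k ^ n)⁻¹ :=
  if_pos ((mem_dyadicCube_iff _ _ _).1 h).symm

theorem avgKernel_of_notMem {k : ℤ} {x y : Space n} (h : y ∉ dyadicCube k (dyadicIndex k x)) :
    avgKernel k x y = 0 :=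
  if_neg fun h' => h ((mem_dyadicCube_iff _ _ _).2 h'.symm)

theorem avgKernel_comm (k : ℤ) (x y : Space n) : avgKernel k x y = avgKernel k y x := by
  simp only [avgKernel_eq, eq_comm]

theorem avgKernel_nonneg (k : ℤ) (x y : Space n) : 0 ≤ avgKernel k x y := by
  rw [avgKernel_eq]
  have := size_pos k
  split_ifs <;> positivity

theorem measurable_avgKernel (k : ℤ) :
    Measurable (Function.uncurry (avgKernel k : Space n → Space n → ℝ)) := by
  have : (Function.uncurry (avgKernel k : Space n → Space n → ℝ)) =
      (fun q : (Fin n → ℤ) × (Fin n → ℤ) => if q.1 = q.2 then (size k ^ n)⁻¹ else 0) ∘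
        fun p : Space n × Space n => (dyadicIndex k p.1, dyadicIndex k p.2) := by
    ext p; simp [Function.uncurry, avgKernel_eq]
  rw [this]
  exact (measurable_of_countable _).comp
    (((measurable_dyadicIndex k).comp measurable_fst).prodMk
      ((measurable_dyadicIndex k).comp measurable_snd))

theorem lintegral_avgKernel (k : ℤ) (x : Space n) :
    ∫⁻ y, ENNReal.ofReal (avgKernel k x y) = 1 := by
  have : ∀ y, ENNReal.ofReal (avgKernel k x y) =
      (dyadicCube k (dyadicIndex k x)).indicator (fun _ => ENNReal.ofReal ((size k ^ n)⁻¹)) y := by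
    intro y
    by_cases hy : y ∈ dyadicCube k (dyadicIndex k x)
    · simp [avgKernel_of_mem hy, hy]
    · simp [avgKernel_of_notMem hy, hy]
  simp_rw [this]
  have := size_pos k
  rw [lintegral_indicator_const (measurableSet_dyadicCube _ _), volume_dyadicCube,
    ← ENNReal.ofReal_mul (by positivity), inv_mul_cancel₀ (by positivity), ENNReal.ofReal_one]

theorem dyadicExp_eq_integral (k : ℤ) (f : Space n → ℂ) (x : Space n) :
    dyadicExp k f x = ∫ y, (avgKernel k x y : ℂ) * f y := by
  have h : ∀ y, (avgKernel k x y : ℂ) * f y = (dyadicCube k (dyadicIndex k x)).indicator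
      (fun y => ((size k ^ n)⁻¹ : ℝ) • f y) y := by
    intro y
    by_cases hy : y ∈ dyadicCube k (dyadicIndex k x)
    · simp [avgKernel_of_mem hy, hy]
    · simp [avgKernel_of_notMem hy, hy]
  simp_rw [h]
  rw [integral_indicator (measurableSet_dyadicCube _ _), integral_smul, dyadicExp, setAverage_eq,
    measureReal_def, volume_dyadicCube, ENNReal.toReal_ofReal (by have := size_pos k; positivity)]

theorem dyadicExp_congr_index {k : ℤ} (f : Space n → ℂ) {x y : Space n}
    (h : dyadicIndex k x = dyadicIndex k y) : dyadicExp k f x = dyadicExp k f y := by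
  simp only [dyadicExp, h]

theorem dyadicExp_congr_ae (k : ℤ) {f g : Space n → ℂ} (h : f =ᵐ[volume] g) :
    dyadicExp k f = dyadicExp k g := by
  funext x
  rw [dyadicExp_eq_integral, dyadicExp_eq_integral]
  refine integral_congr_ae ?_
  filter_upwards [h] with y hy
  rw [hy]

theorem measurable_dyadicExp (k : ℤ) (f : Space n → ℂ) : Measurable (dyadicExp k f) := by
  have : dyadicExp k f = (fun j => ⨍ y in dyadicCube k j, f y) ∘ dyadicIndex k := rfl
  rw [this]
  exact (measurable_of_countable _).comp (measurable_dyadicIndex k)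

theorem enorm_dyadicExp_le (k : ℤ) (f : Space n → ℂ) (x : Space n) :
    ‖dyadicExp k f x‖ₑ ≤ ∫⁻ y, ENNReal.ofReal (avgKernel k x y) * ‖f y‖ₑ := by
  rw [dyadicExp_eq_integral]
  refine (enorm_integral_le_lintegral_enorm _).trans_eq ?_
  congr with y
  rw [enorm_mul, ← ofReal_norm (avgKernel k x y : ℂ), Complex.norm_real,
    Real.norm_of_nonneg (avgKernel_nonneg _ _ _)]

theorem measurable_ofReal_avgKernel (k : ℤ) :
    Measurable (Function.uncurry fun x y : Space n => ENNReal.ofReal (avgKernel k x y)) :=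
  (measurable_avgKernel k).ennreal_ofReal

theorem lintegral_avgKernel_mul_sq_le (k : ℤ) {h : Space n → ℝ≥0∞} (hh : AEMeasurable h) :
    ∫⁻ x, (∫⁻ y, ENNReal.ofReal (avgKernel k x y) * h y) ^ 2 ≤ ∫⁻ x, h x ^ 2 := by
  have e1 : ∀ x, ∫⁻ y, ENNReal.ofReal (avgKernel k x y) * h y
      = ∫⁻ y, ENNReal.ofReal (avgKernel k x y) * hh.mk h y := by
    intro x
    refine lintegral_congr_ae ?_
    filter_upwards [hh.ae_eq_mk] with y hy
    rw [hy]
  have e2 : ∫⁻ x, h x ^ 2 = ∫⁻ x, hh.mk h x ^ 2 := by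
    refine lintegral_congr_ae ?_
    filter_upwards [hh.ae_eq_mk] with y hy
    rw [hy]
  simp_rw [e1]
  rw [e2]
  have := lintegral_sq_kernel_le volume volume (measurable_ofReal_avgKernel (n := n) k)
    hh.measurable_mk (a := 1) (b := 1) (fun x => (lintegral_avgKernel k x).le)
    (fun y => by simp_rw [avgKernel_comm k _ y]; exact (lintegral_avgKernel k y).le)
  simpa using this

theorem lintegral_sq_dyadicExp_le (k : ℤ) {f : Space n → ℂ} (hf : AEStronglyMeasurable f) :
    ∫⁻ x, ‖dyadicExp k f x‖ₑ ^ 2 ≤ ∫⁻ x, ‖f x‖ₑ ^ 2 :=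
  (lintegral_mono fun x => pow_le_pow_left' (enorm_dyadicExp_le k f x) 2).trans
    (lintegral_avgKernel_mul_sq_le k hf.enorm)

theorem sq_eLpNorm_two {α E : Type*} [MeasurableSpace α] {μ : Measure α}
    [NormedAddCommGroup E] (f : α → E) : eLpNorm f 2 μ ^ 2 = ∫⁻ x, ‖f x‖ₑ ^ 2 ∂μ := by
  rw [eLpNorm_eq_lintegral_rpow_enorm_toReal two_ne_zero ENNReal.ofNat_ne_top,
    ← ENNReal.rpow_mul_natCast]
  norm_num

theorem memLp_two_iff {E : Type*} [NormedAddCommGroup E] {f : Space n → E}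
    (hf : AEStronglyMeasurable f) : MemLp f 2 ↔ ∫⁻ x, ‖f x‖ₑ ^ 2 < ⊤ := by
  rw [MemLp, ← sq_eLpNorm_two]
  simp [hf, ENNReal.pow_lt_top_iff]

theorem memLp_dyadicExp (k : ℤ) {f : Space n → ℂ} (hf : MemLp f 2) : MemLp (dyadicExp k f) 2 := by
  rw [memLp_two_iff (measurable_dyadicExp k f).aestronglyMeasurable]
  exact (lintegral_sq_dyadicExp_le k hf.1).trans_lt ((memLp_two_iff hf.1).1 hf)

theorem integrable_avgKernel_mul (k : ℤ) (x : Space n) {f : Space n → ℂ}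
    (hf : IntegrableOn f (dyadicCube k (dyadicIndex k x))) :
    Integrable fun y => (avgKernel k x y : ℂ) * f y := by
  have h : (fun y => (avgKernel k x y : ℂ) * f y) = (dyadicCube k (dyadicIndex k x)).indicator
      (fun y => ((size k ^ n)⁻¹ : ℝ) • f y) := by
    funext y
    by_cases hy : y ∈ dyadicCube k (dyadicIndex k x)
    · simp [avgKernel_of_mem hy, hy]
    · simp [avgKernel_of_notMem hy, hy]
  rw [h, integrable_indicator_iff (measurableSet_dyadicCube _ _)]
  exact hf.smul ((size k ^ n)⁻¹ : ℝ)

theorem integrableOn_dyadicCube_of_memLp {f : Space n → ℂ} (hf : MemLp f 2) (k : ℤ)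
    (j : Fin n → ℤ) : IntegrableOn f (dyadicCube k j) := by
  have : IsFiniteMeasure (volume.restrict (dyadicCube k j)) :=
    ⟨by simp [volume_dyadicCube]⟩
  exact (hf.restrict _).integrable one_le_two

theorem dyadicExp_sub (k : ℤ) {f g : Space n → ℂ}
    (hf : ∀ j, IntegrableOn f (dyadicCube k j)) (hg : ∀ j, IntegrableOn g (dyadicCube k j)) :
    dyadicExp k (fun x => f x - g x) = fun x => dyadicExp k f x - dyadicExp k g x := by
  funext x
  simp only [dyadicExp_eq_integral, mul_sub]
  exact integral_sub (integrable_avgKernel_mul k x (hf _)) (integrable_avgKernel_mul k x (hg _))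

/-- Only the values of `u` on the cube of `x` enter the average, so `u x` comes out as a constant;
no integrability is needed. -/
theorem dyadicExp_mul_of_const (k : ℤ) {u f : Space n → ℂ} {x : Space n}
    (hu : ∀ y, dyadicIndex k y = dyadicIndex k x → u y = u x) :
    dyadicExp k (fun y => u y * f y) x = u x * dyadicExp k f x := by
  simp only [dyadicExp_eq_integral]
  rw [← integral_const_mul]
  congr with y
  rw [avgKernel_eq]
  split_ifs with h
  · rw [hu y h.symm]; ring
  · simp

theorem integral_avgKernel (k : ℤ) (x : Space n) : ∫ y, avgKernel k x y = 1 := by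
  rw [integral_eq_lintegral_of_nonneg_ae (Filter.Eventually.of_forall (avgKernel_nonneg k x))
    (measurable_avgKernel k).of_uncurry_left.aestronglyMeasurable, lintegral_avgKernel,
    ENNReal.toReal_one]

theorem dyadicExp_of_const (k : ℤ) {u : Space n → ℂ} {x : Space n}
    (hu : ∀ y, dyadicIndex k y = dyadicIndex k x → u y = u x) : dyadicExp k u x = u x := by
  have h := dyadicExp_mul_of_const k (f := fun _ => 1) hu
  simp only [mul_one] at h
  rw [h, dyadicExp_eq_integral]
  simp only [mul_one]
  rw [integral_complex_ofReal, integral_avgKernel]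
  simp

theorem integrable_prod_avgKernel (k : ℤ) {f : Space n → ℂ} (hf : Integrable f) :
    Integrable (fun p : Space n × Space n => (avgKernel k p.1 p.2 : ℂ) * f p.2)
      (volume.prod volume) := by
  have hm : AEStronglyMeasurable
      (fun p : Space n × Space n => (avgKernel k p.1 p.2 : ℂ) * f p.2) (volume.prod volume) :=
    (Complex.measurable_ofReal.comp (measurable_avgKernel k)).aestronglyMeasurable.mul
      hf.1.comp_snd
  refine ⟨hm, ?_⟩
  rw [HasFiniteIntegral, lintegral_prod_symm _ hm.enorm]
  have : ∀ y : Space n, ∫⁻ x : Space n, ‖(avgKernel k x y : ℂ) * f y‖ₑ = ‖f y‖ₑ := by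
    intro y
    have h1 : ∀ x : Space n, ‖(avgKernel k x y : ℂ) * f y‖ₑ
        = ENNReal.ofReal (avgKernel k y x) * ‖f y‖ₑ := by
      intro x
      rw [enorm_mul, ← ofReal_norm (avgKernel k x y : ℂ), Complex.norm_real,
        Real.norm_of_nonneg (avgKernel_nonneg _ _ _), avgKernel_comm]
    simp_rw [h1]
    rw [lintegral_mul_const' _ _ enorm_ne_top, lintegral_avgKernel, one_mul]
  simp_rw [this]
  exact hf.2

theorem integral_dyadicExp (k : ℤ) {f : Space n → ℂ} (hf : Integrable f) :
    ∫ x, dyadicExp k f x = ∫ x, f x := by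
  simp only [dyadicExp_eq_integral]
  rw [integral_integral_swap (integrable_prod_avgKernel k hf)]
  congr with y
  rw [integral_mul_const]
  simp_rw [avgKernel_comm k _ y]
  rw [integral_complex_ofReal, integral_avgKernel]
  simp

/-- Tower property. The kernel of the coarse expectation is constant on the finer cubes, so it
passes inside `dyadicExp k`, which preserves integrals. -/
theorem dyadicExp_dyadicExp_of_le {j k : ℤ} (hjk : j ≤ k) {f : Space n → ℂ}
    (hf : ∀ i, IntegrableOn f (dyadicCube j i)) :
    dyadicExp j (dyadicExp k f) = dyadicExp j f := by
  funext x
  rw [dyadicExp_eq_integral j f, ← integral_dyadicExp k (integrable_avgKernel_mul j x (hf _)),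
    dyadicExp_eq_integral]
  congr with y
  refine (dyadicExp_mul_of_const k (u := fun y => (avgKernel j x y : ℂ)) fun z hz => ?_).symm
  rw [avgKernel_eq, avgKernel_eq, dyadicIndex_congr_of_le hjk hz]

theorem dyadicExp_dyadicExp_of_ge {j k : ℤ} (hjk : j ≤ k) (f : Space n → ℂ) :
    dyadicExp k (dyadicExp j f) = dyadicExp j f := by
  funext x
  exact dyadicExp_of_const k fun y hy => dyadicExp_congr_index f (dyadicIndex_congr_of_le hjk hy)

end Dyadic

/-! ### The radial majorant of the kernel differences. -/

section Radial

variable {n : ℕ}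

/-- The kernel `δ ^ β / (δ + |z|) ^ (n + β)`. -/
noncomputable def radial (β δ : ℝ) (z : Space n) : ℝ :=
  δ ^ β / (δ + ‖z‖) ^ ((n : ℝ) + β)

theorem radial_nonneg {β δ : ℝ} (hδ : 0 ≤ δ) (z : Space n) : 0 ≤ radial β δ z := by
  unfold radial
  positivity

theorem measurable_radial (β δ : ℝ) : Measurable (radial β δ : Space n → ℝ) := by
  unfold radial
  fun_prop

theorem measurable_radial_sub (β δ : ℝ) :
    Measurable (Function.uncurry fun x y : Space n => ENNReal.ofReal (radial β δ (x - y))) :=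
  ((measurable_radial β δ).comp (measurable_fst.sub measurable_snd)).ennreal_ofReal

theorem radial_neg (β δ : ℝ) (z : Space n) : radial β δ (-z) = radial β δ z := by
  simp [radial]

/-- The integral of `radial β δ`, which does not depend on `δ`. -/
noncomputable def radialMass (n : ℕ) (β : ℝ) : ℝ≥0∞ :=
  ∫⁻ z : Space n, ENNReal.ofReal ((1 + ‖z‖) ^ (-((n : ℝ) + β)))

theorem radialMass_lt_top {β : ℝ} (hβ : 0 < β) : radialMass n β < ⊤ := by
  refine finite_integral_one_add_norm (E := Space n) ?_
  simp [hβ]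

/-- The family is an L₁-normalised dilation. This makes all the Schur bounds uniform in the scale.
-/
theorem lintegral_radial {β δ : ℝ} (hδ : 0 < δ) :
    ∫⁻ z : Space n, ENNReal.ofReal (radial β δ z) = radialMass n β := by
  have h1 : ∀ z : Space n, ENNReal.ofReal (radial β δ z) = ENNReal.ofReal (|(δ⁻¹) ^ n|) *
      ENNReal.ofReal ((1 + ‖δ⁻¹ • z‖) ^ (-((n : ℝ) + β))) := by
    intro z
    rw [← ENNReal.ofReal_mul (abs_nonneg _)]
    congr 1
    have h2 : 1 + ‖δ⁻¹ • z‖ = (δ + ‖z‖) / δ := by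
      rw [norm_smul, Real.norm_of_nonneg (inv_nonneg.2 hδ.le)]
      field_simp
    have h3 : 0 < δ + ‖z‖ := by positivity
    rw [h2, abs_of_nonneg (by positivity), Real.rpow_neg (by positivity),
      Real.div_rpow h3.le hδ.le, radial, Real.rpow_add hδ, Real.rpow_natCast, inv_div, inv_pow]
    field_simp
  simp_rw [h1]
  have hf : Measurable fun z : Space n => ENNReal.ofReal ((1 + ‖z‖) ^ (-((n : ℝ) + β))) := by
    fun_prop
  rw [lintegral_const_mul' _ _ ENNReal.ofReal_ne_top, radialMass]
  have h4 := Measure.map_addHaar_smul (volume : Measure (Space n)) (inv_ne_zero hδ.ne')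
  have h5 := lintegral_map (μ := (volume : Measure (Space n))) hf (measurable_const_smul δ⁻¹)
  rw [h4, lintegral_smul_measure, smul_eq_mul] at h5
  rw [← h5, ← mul_assoc, ← ENNReal.ofReal_mul (abs_nonneg _)]
  simp only [Module.finrank_fintype_fun_eq_card, Fintype.card_fin]
  rw [← abs_mul, mul_inv_cancel₀ (by positivity)]
  simp

theorem lintegral_radial_sub_left {β δ : ℝ} (hδ : 0 < δ) (x : Space n) :
    ∫⁻ y : Space n, ENNReal.ofReal (radial β δ (x - y)) = radialMass n β := by
  rw [lintegral_sub_left_eq_self (μ := volume) (fun z => ENNReal.ofReal (radial β δ z)) x,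
    lintegral_radial hδ]

theorem lintegral_radial_sub_right {β δ : ℝ} (hδ : 0 < δ) (y : Space n) :
    ∫⁻ x : Space n, ENNReal.ofReal (radial β δ (x - y)) = radialMass n β := by
  simp_rw [← radial_neg β δ (_ - y), neg_sub]
  exact lintegral_radial_sub_left hδ y

theorem lintegral_sq_radial_le {β δ : ℝ} (hδ : 0 < δ) {f : Space n → ℝ≥0∞} (hf : Measurable f) :
    ∫⁻ x, (∫⁻ y, ENNReal.ofReal (radial β δ (x - y)) * f y) ^ 2
      ≤ radialMass n β ^ 2 * ∫⁻ y, f y ^ 2 := by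
  rw [sq (radialMass n β)]
  exact lintegral_sq_kernel_le volume volume (measurable_radial_sub β δ) hf
    (fun x => (lintegral_radial_sub_left hδ x).le) (fun y => (lintegral_radial_sub_right hδ y).le)

end Radial

/-! ### Smooth truncation of the kernel. -/

section Kernel

variable {n : ℕ} {γ A : ℝ} {k : Space n → Space n → ℂ}

theorem IsLipschitzKernel.nonneg (hn : 1 ≤ n) (hk : IsLipschitzKernel γ A k) : 0 ≤ A := by
  have : Nonempty (Fin n) := ⟨⟨0, hn⟩⟩
  have h := hk.bound (fun _ => 1) 0 (by
    intro h
    simpa using congrFun h ⟨0, hn⟩)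
  have h2 : ‖(fun _ => 1 : Space n) - 0‖ = 1 := by simp
  rw [h2] at h
  simp only [one_pow, div_one] at h
  exact (norm_nonneg _).trans h

theorem IsLipschitzKernel.swap (hk : IsLipschitzKernel γ A k) :
    IsLipschitzKernel γ A fun x y => k y x where
  bound x y h := by rw [norm_sub_rev]; exact hk.bound y x h.symm
  smooth_left x x' y h h' := by
    rw [norm_sub_rev x y] at h' ⊢; exact hk.smooth_right y x x' h.symm h'
  smooth_right x y y' h h' := by
    rw [norm_sub_rev x y] at h' ⊢; exact hk.smooth_left y y' x h.symm h'

/-- A Lipschitz cutoff that vanishes for `t ≤ 3` and equals `1` for `t ≥ 4`. -/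
noncomputable def cutoff (t : ℝ) : ℝ := max 0 (min 1 (t - 3))

theorem cutoff_nonneg (t : ℝ) : 0 ≤ cutoff t := le_max_left _ _

theorem cutoff_le_one (t : ℝ) : cutoff t ≤ 1 := max_le zero_le_one (min_le_left _ _)

theorem cutoff_of_le {t : ℝ} (h : t ≤ 3) : cutoff t = 0 :=
  max_eq_left ((min_le_right _ _).trans (by linarith))

theorem cutoff_of_ge {t : ℝ} (h : 4 ≤ t) : cutoff t = 1 := by
  rw [cutoff, min_eq_left (by linarith), max_eq_right zero_le_one]

theorem abs_cutoff_sub_le (s t : ℝ) : |cutoff s - cutoff t| ≤ |s - t| := by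
  unfold cutoff
  refine (abs_max_sub_max_le_max _ _ _ _).trans ?_
  simp only [sub_self, abs_zero]
  refine max_le (abs_nonneg _) ((abs_min_sub_min_le_max _ _ _ _).trans ?_)
  simp

/-- The kernel `k`, truncated at distance about `R` from the diagonal. -/
noncomputable def trunc (k : Space n → Space n → ℂ) (R : ℝ) (x y : Space n) : ℂ :=
  (cutoff (‖x - y‖ / R) : ℂ) * k x y

theorem trunc_of_le {R : ℝ} (hR : 0 < R) {x y : Space n} (h : ‖x - y‖ ≤ 3 * R) :
    trunc k R x y = 0 := by
  rw [trunc, cutoff_of_le ((div_le_iff₀ hR).2 h)]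
  simp

theorem trunc_of_ge {R : ℝ} (hR : 0 < R) {x y : Space n} (h : 4 * R ≤ ‖x - y‖) :
    trunc k R x y = k x y := by
  rw [trunc, cutoff_of_ge ((le_div_iff₀ hR).2 h)]
  simp

theorem norm_trunc_le (hk : IsLipschitzKernel γ A k) (hA : 0 ≤ A) {R : ℝ} (hR : 0 < R)
    (x y : Space n) : ‖trunc k R x y‖ ≤ A / R ^ n := by
  rcases le_total ‖x - y‖ (3 * R) with h | h
  · rw [trunc_of_le hR h, norm_zero]
    positivity
  · rw [trunc, norm_mul, Complex.norm_real, Real.norm_of_nonneg (cutoff_nonneg _)]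
    have hxy : x ≠ y := by
      rintro rfl
      simp only [sub_self, norm_zero] at h
      linarith
    refine (mul_le_of_le_one_left (norm_nonneg _) (cutoff_le_one _)).trans
      ((hk.bound x y hxy).trans ?_)
    gcongr
    linarith

/-- If |x - y| ≤ 2R both truncations vanish. Otherwise the difference splits into cutoff times
kernel increment and cutoff increment times kernel. The cutoff increment lives in |x - y| ≤ 5R,
where R + |x - y| ≤ 6R, so that the size bound A/R^n is comparable to `radial`; this is the origin
of the 6. The condition γ ≤ 1 turns the Lipschitz bound of the cutoff into a γ-Hölder one. -/
theorem norm_trunc_sub_le (hk : IsLipschitzKernel γ A k) (hA : 0 ≤ A) (hγ0 : 0 < γ) (hγ1 : γ ≤ 1)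
    {R : ℝ} (hR : 0 < R) {x x' : Space n} (y : Space n) (h : ‖x - x'‖ ≤ R) :
    ‖trunc k R x y - trunc k R x' y‖
      ≤ 2 * 6 ^ ((n : ℝ) + γ) * A * (‖x - x'‖ / R) ^ γ * radial γ R (x - y) := by
  have hrad := radial_nonneg (β := γ) hR.le (x - y)
  have htri : |‖x - y‖ - ‖x' - y‖| ≤ ‖x - x'‖ := by
    have := abs_norm_sub_norm_le (x - y) (x' - y)
    rwa [sub_sub_sub_cancel_right] at this
  obtain ⟨ht1, ht2⟩ := abs_le.1 htri
  rcases le_or_gt ‖x - y‖ (2 * R) with h2 | h2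
  · rw [trunc_of_le hR (by linarith), trunc_of_le hR (by linarith), sub_zero, norm_zero]
    positivity
  have hxy : x ≠ y := by
    rintro rfl
    simp only [sub_self, norm_zero] at h2
    linarith
  have ht' : R < ‖x' - y‖ := by linarith
  have hxy' : x' ≠ y := by
    rintro rfl
    simp only [sub_self, norm_zero] at ht'
    linarith
  have e : trunc k R x y - trunc k R x' y = (cutoff (‖x - y‖ / R) : ℂ) * (k x y - k x' y)
      + ((cutoff (‖x - y‖ / R) - cutoff (‖x' - y‖ / R) : ℝ) : ℂ) * k x' y := by
    simp only [trunc]; push_cast; ring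
  have hr0 : 0 ≤ ‖x - x'‖ / R := by positivity
  have hr1 : ‖x - x'‖ / R ≤ 1 := (div_le_one hR).2 h
  have b1 : ‖(cutoff (‖x - y‖ / R) : ℂ) * (k x y - k x' y)‖
      ≤ 6 ^ ((n : ℝ) + γ) * A * (‖x - x'‖ / R) ^ γ * radial γ R (x - y) := by
    rw [norm_mul, Complex.norm_real, Real.norm_of_nonneg (cutoff_nonneg _)]
    refine (mul_le_of_le_one_left (norm_nonneg _) (cutoff_le_one _)).trans
      ((hk.smooth_left x x' y hxy (by linarith)).trans ?_)
    have e2 : 6 ^ ((n : ℝ) + γ) * A * (‖x - x'‖ / R) ^ γ * radial γ R (x - y)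
        = A * (‖x - x'‖ ^ γ / ((R + ‖x - y‖) / 6) ^ ((n : ℝ) + γ)) := by
      have hR' : 0 < R ^ γ := by positivity
      rw [radial, Real.div_rpow (norm_nonneg _) hR.le, Real.div_rpow (by positivity) (by norm_num)]
      field_simp
    rw [e2]
    gcongr
    linarith
  have b2 : ‖((cutoff (‖x - y‖ / R) - cutoff (‖x' - y‖ / R) : ℝ) : ℂ) * k x' y‖
      ≤ 6 ^ ((n : ℝ) + γ) * A * (‖x - x'‖ / R) ^ γ * radial γ R (x - y) := by
    rcases le_or_gt ‖x - y‖ (5 * R) with h5 | h5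
    · rw [norm_mul, Complex.norm_real, Real.norm_eq_abs]
      have c1 : |cutoff (‖x - y‖ / R) - cutoff (‖x' - y‖ / R)| ≤ (‖x - x'‖ / R) ^ γ := by
        refine (abs_cutoff_sub_le _ _).trans ?_
        rw [← sub_div, abs_div, abs_of_pos hR]
        refine le_trans (b := ‖x - x'‖ / R) (by gcongr) ?_
        exact Real.self_le_rpow_of_le_one hr0 hr1 hγ1
      have c2 : ‖k x' y‖ ≤ A / R ^ n := by
        refine (hk.bound x' y hxy').trans ?_
        gcongr
      have c3 : A / R ^ n ≤ 6 ^ ((n : ℝ) + γ) * A * radial γ R (x - y) := by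
        have : A / R ^ n = 6 ^ ((n : ℝ) + γ) * A * (R ^ γ / (6 * R) ^ ((n : ℝ) + γ)) := by
          rw [Real.mul_rpow (by norm_num) hR.le, Real.rpow_add hR, Real.rpow_natCast]
          have : 0 < (6 : ℝ) ^ ((n : ℝ) + γ) := by positivity
          have hR' : 0 < R ^ γ := by positivity
          field_simp
        rw [this, radial]
        gcongr
        linarith
      calc _ ≤ (‖x - x'‖ / R) ^ γ * (6 ^ ((n : ℝ) + γ) * A * radial γ R (x - y)) := by
            gcongr
            exact c2.trans c3
        _ = _ := by ring
    · rw [cutoff_of_ge ((le_div_iff₀ hR).2 (by linarith)),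
        cutoff_of_ge ((le_div_iff₀ hR).2 (by linarith))]
      simp only [sub_self, Complex.ofReal_zero, zero_mul, norm_zero]
      positivity
  rw [e]
  refine (norm_add_le _ _).trans ((add_le_add b1 b2).trans_eq ?_)
  ring

theorem trunc_swap (k : Space n → Space n → ℂ) (R : ℝ) (x y : Space n) :
    trunc (fun x y => k y x) R y x = trunc k R x y := by
  simp only [trunc, norm_sub_rev]

theorem norm_trunc_sub_le_right (hk : IsLipschitzKernel γ A k) (hA : 0 ≤ A) (hγ0 : 0 < γ)
    (hγ1 : γ ≤ 1) {R : ℝ} (hR : 0 < R) (x : Space n) {y y' : Space n} (h : ‖y - y'‖ ≤ R) :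
    ‖trunc k R x y - trunc k R x y'‖
      ≤ 2 * 6 ^ ((n : ℝ) + γ) * A * (‖y - y'‖ / R) ^ γ * radial γ R (x - y) := by
  have := norm_trunc_sub_le hk.swap hA hγ0 hγ1 hR x h
  rwa [trunc_swap k R x y, trunc_swap k R x y', ← neg_sub x y, radial_neg] at this

theorem radial_le {δ : ℝ} (hγ0 : 0 < γ) (hδ : 0 < δ) (z : Space n) : radial γ δ z ≤ (δ ^ n)⁻¹ := by
  have : (δ ^ n)⁻¹ = δ ^ γ / δ ^ ((n : ℝ) + γ) := by
    rw [Real.rpow_add hδ, Real.rpow_natCast]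
    have : 0 < δ ^ γ := by positivity
    field_simp
  rw [this, radial]
  gcongr
  linarith [norm_nonneg z]

theorem continuous_trunc_left (hk : IsLipschitzKernel γ A k) (hA : 0 ≤ A) (hγ0 : 0 < γ)
    (hγ1 : γ ≤ 1) {R : ℝ} (hR : 0 < R) (y : Space n) : Continuous fun x => trunc k R x y := by
  rw [continuous_iff_continuousAt]
  intro x
  rw [ContinuousAt, tendsto_iff_norm_sub_tendsto_zero]
  have h0 : Filter.Tendsto
      (fun x' : Space n => 2 * 6 ^ ((n : ℝ) + γ) * A * (‖x' - x‖ / R) ^ γ * (R ^ n)⁻¹)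
      (nhds x) (nhds 0) := by
    have : Continuous
        fun x' : Space n => 2 * 6 ^ ((n : ℝ) + γ) * A * (‖x' - x‖ / R) ^ γ * (R ^ n)⁻¹ := by
      have : Continuous fun x' : Space n => (‖x' - x‖ / R) ^ γ :=
        (by fun_prop : Continuous fun x' : Space n => ‖x' - x‖ / R).rpow_const
          fun _ => Or.inr hγ0.le
      fun_prop
    refine (this.tendsto x).trans_eq ?_
    simp [Real.zero_rpow hγ0.ne']
  refine squeeze_zero' (Filter.Eventually.of_forall fun _ => norm_nonneg _) ?_ h0
  filter_upwards [Metric.closedBall_mem_nhds x hR] with x' hx'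
  rw [Metric.mem_closedBall, dist_eq_norm] at hx'
  refine (norm_trunc_sub_le hk hA hγ0 hγ1 hR y hx').trans ?_
  gcongr
  exact radial_le hγ0 hR _

theorem continuous_trunc_right (hk : IsLipschitzKernel γ A k) (hA : 0 ≤ A) (hγ0 : 0 < γ)
    (hγ1 : γ ≤ 1) {R : ℝ} (hR : 0 < R) (x : Space n) : Continuous fun y => trunc k R x y := by
  have := continuous_trunc_left hk.swap hA hγ0 hγ1 hR x
  simpa only [trunc_swap] using this

/-- Measurability of `k` is not part of `IsLipschitzKernel`; the truncation is continuous in each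
variable separately, which suffices for joint measurability. -/
theorem measurable_trunc (hk : IsLipschitzKernel γ A k) (hA : 0 ≤ A) (hγ0 : 0 < γ)
    (hγ1 : γ ≤ 1) {R : ℝ} (hR : 0 < R) :
    Measurable (Function.uncurry (trunc k R)) :=
  measurable_uncurry_of_continuous_of_measurable
    (fun y => continuous_trunc_left hk hA hγ0 hγ1 hR y)
    (fun x => (continuous_trunc_right hk hA hγ0 hγ1 hR x).measurable)

end Kernel

/-! ### The kernel representation for L₂ functions of bounded support. -/

section Representation

variable {n : ℕ} {γ A : ℝ} {k : Space n → Space n → ℂ}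

theorem exists_contDiff_cutoff {s : Set (Space n)} (hs : IsCompact s) {r : ℝ} (hr : 0 < r) :
    ∃ χ : Space n → ℝ, ContDiff ℝ ∞ χ ∧ (∀ x ∈ s, χ x = 1) ∧
      (∀ x, χ x ≠ 0 → x ∈ Metric.cthickening r s) ∧ ∀ x, χ x ∈ Set.Icc (0 : ℝ) 1 := by
  obtain ⟨f, h1, h0, hf⟩ := exists_contMDiffMap_one_nhds_of_subset_interior
    (n := ⊤) (modelWithCornersSelf ℝ (Space n)) (s := s) (t := Metric.cthickening r s) hs.isClosed
    ((Metric.self_subset_thickening hr s).trans (interior_maximal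
      (Metric.thickening_subset_cthickening r s) Metric.isOpen_thickening))
  refine ⟨f, f.contMDiff.contDiff, fun x hx => h1.self_of_nhdsSet x hx, fun x hx => ?_, hf⟩
  by_contra h
  exact hx (h0 x h)

/-- Extends `IsAssociated` beyond smooth functions by density: the left side converges almost
everywhere along a subsequence because `T` is bounded, the right side by Cauchy–Schwarz because the
truncated kernel is bounded on a compact set. -/
theorem ae_eq_integral_trunc (hk : IsLipschitzKernel γ A k) (hA : 0 ≤ A) (hγ0 : 0 < γ)
    (hγ1 : γ ≤ 1) {T : L2 n →L[ℂ] L2 n} (hT : IsAssociated T k) {g : Space n → ℂ}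
    (hg : MemLp g 2) {C : ℝ} (hC : ∀ x, g x ≠ 0 → ‖x‖ ≤ C) {R : ℝ} (hR : 0 < R) :
    ∀ᵐ x, (∀ y, g y ≠ 0 → 4 * R ≤ ‖x - y‖) →
      T (hg.toLp g) x = ∫ y, trunc k R x y * g y := by
  set s : Set (Space n) := closure (Function.support g) with hs_def
  have hbd : Bornology.IsBounded (Function.support g) :=
    isBounded_iff_forall_norm_le.2 ⟨C, fun x hx => hC x hx⟩
  have hs : IsCompact s := hbd.isCompact_closure
  set t : Set (Space n) := Metric.cthickening R s with ht_def
  have ht : IsCompact t := hs.cthickening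
  obtain ⟨χ, hχ, hχ1, hχ0, hχ2⟩ := exists_contDiff_cutoff hs hR
  have hfar : ∀ x : Space n, (∀ y, g y ≠ 0 → 4 * R ≤ ‖x - y‖) → ∀ y ∈ t, 2 * R ≤ ‖x - y‖ := by
    intro x hx y hy
    have hy2 : y ∈ Metric.thickening (2 * R) (Function.support g) := by
      rw [← Metric.thickening_closure]
      exact Metric.cthickening_subset_thickening' (by positivity) (by linarith) _ hy
    obtain ⟨z, hz, hyz⟩ := Metric.mem_thickening_iff.1 hy2
    have h1 := hx z hz
    rw [dist_eq_norm] at hyz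
    have := norm_sub_le_norm_sub_add_norm_sub x y z
    linarith
  choose φ hφc hφs hφ using fun m : ℕ => hg.exist_eLpNorm_sub_le ENNReal.ofNat_ne_top one_le_two
    (Nat.one_div_pos_of_nat (n := m) (α := ℝ))
  -- Multiplying by `χ` keeps all the approximants supported near `g` and does not increase the
  -- error, since χ g = g.
  set ψ : ℕ → Space n → ℂ := fun m x => (χ x : ℂ) * φ m x with hψ_def
  have hψs : ∀ m, ContDiff ℝ ∞ (ψ m) := fun m =>
    (Complex.ofRealCLM.contDiff.comp hχ).mul (hφs m)
  have hψc : ∀ m, HasCompactSupport (ψ m) := fun m => (hφc m).mul_left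
  have hψt : ∀ m x, ψ m x ≠ 0 → x ∈ t := by
    intro m x hx
    refine hχ0 x fun h => hx ?_
    simp [hψ_def, h]
  have hψt' : ∀ m, tsupport (ψ m) ⊆ t := fun m =>
    closure_minimal (fun x hx => hψt m x hx) ht.isClosed
  have hgt : ∀ x, g x ≠ 0 → x ∈ t := fun x hx =>
    Metric.self_subset_cthickening s (subset_closure hx)
  have hψL : ∀ m, MemLp (ψ m) 2 := fun m =>
    (hψs m).continuous.memLp_of_hasCompactSupport (hψc m)
  have hdiff : ∀ m, eLpNorm (ψ m - g) 2 volume ≤ ENNReal.ofReal (1 / ((m : ℝ) + 1)) := by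
    intro m
    rw [eLpNorm_sub_comm]
    refine (eLpNorm_mono fun x => ?_).trans (hφ m)
    have : (g - ψ m) x = (χ x : ℂ) * (g - φ m) x := by
      simp only [Pi.sub_apply, hψ_def, mul_sub]
      congr 1
      by_cases hx : g x = 0
      · simp [hx]
      · rw [hχ1 x (subset_closure hx)]
        simp
    rw [this, norm_mul, Complex.norm_real, Real.norm_of_nonneg (hχ2 x).1]
    exact mul_le_of_le_one_left (norm_nonneg _) (hχ2 x).2
  have hlim0 : Filter.Tendsto (fun m : ℕ => ENNReal.ofReal (1 / ((m : ℝ) + 1))) Filter.atTop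
      (nhds 0) := by
    have := ENNReal.tendsto_ofReal (tendsto_one_div_add_atTop_nhds_zero_nat (𝕜 := ℝ))
    simpa using this
  have hlim : Filter.Tendsto (fun m => eLpNorm (ψ m - g) 2 volume) Filter.atTop (nhds 0) :=
    tendsto_of_tendsto_of_tendsto_of_le_of_le tendsto_const_nhds hlim0 (fun _ => zero_le) hdiff
  have hLp : Filter.Tendsto (fun m => (hψL m).toLp (ψ m)) Filter.atTop (nhds (hg.toLp g)) :=
    (Lp.tendsto_Lp_iff_tendsto_eLpNorm'' _ hψL _ hg).2 hlim
  have hTLp := (T.continuous.tendsto _).comp hLp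
  obtain ⟨ns, hns, hae⟩ := (tendstoInMeasure_of_tendsto_Lp hTLp).exists_seq_tendsto_ae
  have hassoc : ∀ᵐ x, ∀ m, x ∉ tsupport (ψ m) →
      T ((hψL m).toLp (ψ m)) x = ∫ y, k x y * ψ m y :=
    ae_all_iff.2 fun m => hT (ψ m) (hψs m) (hψc m)
  filter_upwards [hae, hassoc] with x hx1 hx2 hxF
  -- The approximants come as close to `x` as 2R, so the truncation radius is halved for them; where
  -- g ≠ 0 both truncations equal `k`.
  have hxt : ∀ y ∈ t, 4 * (R / 2) ≤ ‖x - y‖ := fun y hy => by linarith [hfar x hxF y hy]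
  have hxnt : x ∉ t := fun h => by
    have := hxt x h
    simp only [sub_self, norm_zero] at this
    linarith
  have e1 : ∀ m, T ((hψL m).toLp (ψ m)) x = ∫ y, trunc k (R / 2) x y * ψ m y := by
    intro m
    rw [hx2 m fun h => hxnt (hψt' m h)]
    congr with y
    by_cases hy : ψ m y = 0
    · simp [hy]
    · rw [trunc_of_ge (by positivity) (hxt y (hψt m y hy))]
  have e2 : ∫ y, trunc k R x y * g y = ∫ y, trunc k (R / 2) x y * g y := by
    congr with y
    by_cases hy : g y = 0
    · simp [hy]
    · rw [trunc_of_ge (by positivity) (hxt y (hgt y hy)), trunc_of_ge hR (hxF y hy)]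
  rw [e2]
  refine tendsto_nhds_unique hx1 ?_
  simp only [Function.comp_def, e1]
  have hκ : Continuous fun y => trunc k (R / 2) x y :=
    continuous_trunc_right hk hA hγ0 hγ1 (by positivity) x
  have hκt : MemLp (t.indicator fun y => trunc k (R / 2) x y) 2 := by
    refine memLp_indicator_iff_restrict ht.measurableSet |>.2 ?_
    have : IsFiniteMeasure (volume.restrict t) := ⟨by simpa using ht.measure_lt_top⟩
    exact MemLp.of_bound hκ.aestronglyMeasurable (A / (R / 2) ^ n)
      (Filter.Eventually.of_forall fun y => norm_trunc_le hk hA (by positivity) x y)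
  have hind : ∀ h : Space n → ℂ, (∀ y, h y ≠ 0 → y ∈ t) →
      ∀ y, trunc k (R / 2) x y * h y = t.indicator (fun y => trunc k (R / 2) x y) y * h y := by
    intro h hh y
    by_cases hy : h y = 0
    · simp [hy]
    · rw [Set.indicator_of_mem (hh y hy)]
  simp_rw [hind g hgt]
  simp_rw [fun m => hind (ψ m) (hψt m)]
  set κ := t.indicator fun y => trunc k (R / 2) x y with hκ_def
  have hint : ∀ {h : Space n → ℂ}, MemLp h 2 → Integrable fun y => κ y * h y :=
    fun hh => hκt.integrable_mul hh
  refine Filter.Tendsto.comp (g := fun m => ∫ y, κ y * ψ m y) ?_ hns.tendsto_atTop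
  refine tendsto_integral_of_L1 _ (hint hg).1 (Filter.Eventually.of_forall fun m => hint (hψL m)) ?_
  have hbound : ∀ m, ∫⁻ y, ‖κ y * ψ m y - κ y * g y‖ₑ ≤
      eLpNorm κ 2 volume * eLpNorm (ψ m - g) 2 volume := by
    intro m
    simp_rw [← mul_sub, enorm_mul]
    have := sq_lintegral_mul_le volume hκt.1.enorm ((hψL m).sub hg).1.enorm
    rw [← sq_eLpNorm_two, ← sq_eLpNorm_two, ← mul_pow] at this
    exact (ENNReal.pow_le_pow_left_iff two_ne_zero).1 this
  refine tendsto_of_tendsto_of_tendsto_of_le_of_le tendsto_const_nhds ?_ (fun _ => zero_le) hbound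
  have := ENNReal.Tendsto.const_mul hlim (Or.inr hκt.2.ne)
  simpa using this

end Representation

/-! ### Functions with dyadic cancellation and their images. -/

section Atom

variable {n : ℕ} {γ A : ℝ} {k : Space n → Space n → ℂ}

/-- Bounded functions with bounded support, with vanishing mean over every dyadic cube of
generation `m`. -/
structure IsAtom (m : ℤ) (g : Space n → ℂ) : Prop where
  measurable : Measurable g
  bounded : ∃ C, ∀ x, ‖g x‖ ≤ C
  supp : ∃ C, ∀ x, g x ≠ 0 → ‖x‖ ≤ C
  dyadicExp_eq_zero : ∀ x, dyadicExp m g x = 0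

theorem memLp_of_bounded {g : Space n → ℂ} (hm : Measurable g) (hb : ∃ C, ∀ x, ‖g x‖ ≤ C)
    (hs : ∃ C, ∀ x, g x ≠ 0 → ‖x‖ ≤ C) (p : ℝ≥0∞) : MemLp g p := by
  obtain ⟨C, hC⟩ := hb
  obtain ⟨D, hD⟩ := hs
  have : (Metric.closedBall (0 : Space n) D).indicator g = g := by
    rw [Set.indicator_eq_self]
    intro x hx
    simpa using hD x hx
  rw [← this, memLp_indicator_iff_restrict measurableSet_closedBall]
  have : IsFiniteMeasure (volume.restrict (Metric.closedBall (0 : Space n) D)) :=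
    ⟨by simpa using measure_closedBall_lt_top⟩
  exact MemLp.of_bound hm.aestronglyMeasurable C (Filter.Eventually.of_forall hC)

theorem IsAtom.memLp {m : ℤ} {g : Space n → ℂ} (hg : IsAtom m g) (p : ℝ≥0∞) : MemLp g p :=
  memLp_of_bounded hg.measurable hg.bounded hg.supp p

theorem IsAtom.integrable {m : ℤ} {g : Space n → ℂ} (hg : IsAtom m g) : Integrable g :=
  memLp_one_iff_integrable.1 (hg.memLp 1)

theorem measurableSet_of_dyadic {m : ℤ} {N : Set (Space n)}
    (hN : ∀ x y, dyadicIndex m x = dyadicIndex m y → x ∈ N → y ∈ N) : MeasurableSet N := by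
  have : N = dyadicIndex m ⁻¹' (dyadicIndex m '' N) := by
    refine Set.Subset.antisymm (Set.subset_preimage_image _ _) ?_
    rintro y ⟨x, hx, hxy⟩
    exact hN x y hxy hx
  rw [this]
  exact measurable_dyadicIndex m (Set.to_countable _).measurableSet

theorem IsAtom.indicator {m : ℤ} {g : Space n → ℂ} (hg : IsAtom m g) {N : Set (Space n)}
    (hN : ∀ x y, dyadicIndex m x = dyadicIndex m y → x ∈ N → y ∈ N) :
    IsAtom m (N.indicator g) where
  measurable := hg.measurable.indicator (measurableSet_of_dyadic hN)
  bounded := by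
    obtain ⟨C, hC⟩ := hg.bounded
    exact ⟨C, fun x => (norm_indicator_le_norm_self g x).trans (hC x)⟩
  supp := by
    obtain ⟨C, hC⟩ := hg.supp
    refine ⟨C, fun x hx => hC x fun h => hx ?_⟩
    rw [Set.indicator_apply_eq_zero]
    exact fun _ => h
  dyadicExp_eq_zero x := by
    have h : N.indicator g = fun y => N.indicator (fun _ => (1 : ℂ)) y * g y := by
      funext y
      by_cases hy : y ∈ N <;> simp [hy]
    rw [h, dyadicExp_mul_of_const, hg.dyadicExp_eq_zero, mul_zero]
    intro y hy
    by_cases hx : x ∈ N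
    · rw [Set.indicator_of_mem hx, Set.indicator_of_mem (hN x y hy.symm hx)]
    · rw [Set.indicator_of_notMem hx, Set.indicator_of_notMem fun h => hx (hN y x hy h)]

/-- The corner of the dyadic cube with a given index. -/
noncomputable def corner (m : ℤ) (j : Fin n → ℤ) : Space n := fun i => (j i : ℝ) * size m

theorem dyadicIndex_corner (m : ℤ) (j : Fin n → ℤ) : dyadicIndex m (corner m j) = j := by
  funext i
  simp [dyadicIndex, corner, (size_pos m).ne']

/-- Cancellation allows subtracting from κ, on each cube of generation `m`, its value at the corner;
only the oscillation of κ on these cubes remains. -/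
theorem IsAtom.enorm_integral_mul_le {m : ℤ} {g : Space n → ℂ} (hg : IsAtom m g)
    {κ : Space n → ℂ} (hκ : Measurable κ) {M : ℝ} (hM : ∀ y, ‖κ y‖ ≤ M) {W : Space n → ℝ≥0∞}
    (hW : ∀ y y', g y ≠ 0 → dyadicIndex m y = dyadicIndex m y' → ‖κ y - κ y'‖ₑ ≤ W y) :
    ‖∫ y, κ y * g y‖ₑ ≤ ∫⁻ y, W y * ‖g y‖ₑ := by
  set κ' : Space n → ℂ := fun y => κ (corner m (dyadicIndex m y)) with hκ'_def
  have hκ' : Measurable κ' :=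
    (measurable_of_countable fun j => κ (corner m j)).comp (measurable_dyadicIndex m)
  have hi : Integrable fun y => κ y * g y :=
    hg.integrable.bdd_mul hκ.aestronglyMeasurable (Filter.Eventually.of_forall hM)
  have hi' : Integrable fun y => κ' y * g y :=
    hg.integrable.bdd_mul hκ'.aestronglyMeasurable (Filter.Eventually.of_forall fun y => hM _)
  have h0 : ∫ y, κ' y * g y = 0 := by
    rw [← integral_dyadicExp m hi']
    have : dyadicExp m (fun y => κ' y * g y) = 0 := by
      funext x
      rw [dyadicExp_mul_of_const, hg.dyadicExp_eq_zero, mul_zero, Pi.zero_apply]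
      intro y hy
      simp only [hκ'_def, hy]
    rw [this]
    simp
  have h1 : ∫ y, κ y * g y = ∫ y, (κ y - κ' y) * g y := by
    simp_rw [sub_mul]
    rw [integral_sub hi hi', h0, sub_zero]
  rw [h1]
  refine (enorm_integral_le_lintegral_enorm _).trans (lintegral_mono fun y => ?_)
  rw [enorm_mul]
  by_cases hy : g y = 0
  · simp [hy]
  · gcongr
    exact hW y _ hy (dyadicIndex_corner m _).symm

theorem enorm_le_ofReal {z : ℂ} {r : ℝ} (h : ‖z‖ ≤ r) : ‖z‖ₑ ≤ ENNReal.ofReal r := by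
  rw [← ofReal_norm]
  exact ENNReal.ofReal_le_ofReal h

theorem lintegral_ofReal_radial_mul {β δ c : ℝ} (hc : 0 ≤ c) (x : Space n) (g : Space n → ℂ) :
    ∫⁻ y, ENNReal.ofReal (c * radial β δ (x - y)) * ‖g y‖ₑ
      = ENNReal.ofReal c * ∫⁻ y, ENNReal.ofReal (radial β δ (x - y)) * ‖g y‖ₑ := by
  simp_rw [ENNReal.ofReal_mul hc, mul_assoc]
  rw [lintegral_const_mul' _ _ ENNReal.ofReal_ne_top]

/-- Off-diagonal decay of `T g` for a function `g` with dyadic cancellation. -/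
theorem IsAtom.ae_enorm_apply_le (hk : IsLipschitzKernel γ A k) (hA : 0 ≤ A) (hγ0 : 0 < γ)
    (hγ1 : γ ≤ 1) {T : L2 n →L[ℂ] L2 n} (hT : IsAssociated T k) {m : ℤ} {g : Space n → ℂ}
    (hg : IsAtom m g) :
    ∀ᵐ x, (∀ y, g y ≠ 0 → 2 * size m ≤ ‖x - y‖) →
      ‖T ((hg.memLp 2).toLp g) x‖ₑ ≤ ENNReal.ofReal (2 ^ ((n : ℝ) + γ) * A) *
        ∫⁻ y, ENNReal.ofReal (radial γ (size m) (x - y)) * ‖g y‖ₑ := by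
  have hδ := size_pos m
  obtain ⟨C, hC⟩ := hg.supp
  -- With R = size m / 4 the truncation is inactive beyond distance size m. Since |x - y| ≥ 2 size
  -- m, this covers the whole cube of `y`.
  filter_upwards [ae_eq_integral_trunc hk hA hγ0 hγ1 hT (hg.memLp 2) hC
    (R := size m / 4) (by positivity)] with x hx hxg
  rw [hx fun y hy => by linarith [hxg y hy], ← lintegral_ofReal_radial_mul (by positivity)]
  refine hg.enorm_integral_mul_le
    (continuous_trunc_right hk hA hγ0 hγ1 (by positivity) x).measurable
    (fun y => norm_trunc_le hk hA (by positivity) x y) fun y y' hy hyy' => enorm_le_ofReal ?_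
  have h1 := hxg y hy
  have h2 := norm_sub_le_size hyy'
  have h3 : size m ≤ ‖x - y'‖ := by
    have := norm_sub_le_norm_sub_add_norm_sub x y' y
    rw [norm_sub_rev y' y] at this
    linarith
  rw [trunc_of_ge (by positivity) (by linarith), trunc_of_ge (by positivity) (by linarith)]
  have hxy : x ≠ y := by
    rintro rfl
    simp only [sub_self, norm_zero] at h1
    linarith
  refine (hk.smooth_right x y y' hxy (by linarith)).trans ?_
  have e : 2 ^ ((n : ℝ) + γ) * A * radial γ (size m) (x - y)
      = A * (size m ^ γ / ((size m + ‖x - y‖) / 2) ^ ((n : ℝ) + γ)) := by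
    rw [radial, Real.div_rpow (by positivity) (by norm_num)]
    field_simp
  rw [e]
  gcongr
  linarith

/-- The integral operator with the truncated kernel. -/
noncomputable def tau (k : Space n → Space n → ℂ) (R : ℝ) (g : Space n → ℂ) (x : Space n) : ℂ :=
  ∫ y, trunc k R x y * g y

theorem measurable_tau (hk : IsLipschitzKernel γ A k) (hA : 0 ≤ A) (hγ0 : 0 < γ)
    (hγ1 : γ ≤ 1) {R : ℝ} (hR : 0 < R) {g : Space n → ℂ} (hg : Measurable g) :
    Measurable (tau k R g) := by
  have : StronglyMeasurable fun p : Space n × Space n => trunc k R p.1 p.2 * g p.2 :=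
    ((measurable_trunc hk hA hγ0 hγ1 hR).mul (hg.comp measurable_snd)).stronglyMeasurable
  exact this.integral_prod_right'.measurable

/-- The gain comes from the cancellation of `g` and the regularity of the kernel in its second
variable. -/
theorem IsAtom.enorm_tau_le (hk : IsLipschitzKernel γ A k) (hA : 0 ≤ A) (hγ0 : 0 < γ)
    (hγ1 : γ ≤ 1) {m : ℤ} {g : Space n → ℂ} (hg : IsAtom m g) {R : ℝ} (hR : size m ≤ R)
    (x : Space n) :
    ‖tau k R g x‖ₑ ≤ ENNReal.ofReal (2 * 6 ^ ((n : ℝ) + γ) * A * (size m / R) ^ γ) *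
      ∫⁻ y, ENNReal.ofReal (radial γ R (x - y)) * ‖g y‖ₑ := by
  have hδ := size_pos m
  have hR0 : 0 < R := hδ.trans_le hR
  rw [← lintegral_ofReal_radial_mul (by positivity)]
  refine hg.enorm_integral_mul_le (continuous_trunc_right hk hA hγ0 hγ1 hR0 x).measurable
    (fun y => norm_trunc_le hk hA hR0 x y) fun y y' _ hyy' => enorm_le_ofReal ?_
  have h2 := norm_sub_le_size hyy'
  refine (norm_trunc_sub_le_right hk hA hγ0 hγ1 hR0 x (h2.trans hR)).trans ?_
  have := radial_nonneg (β := γ) hR0.le (x - y)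
  gcongr

/-- Here the gain comes from regularity in the first variable, and no cancellation of `g` is
involved. -/
theorem enorm_tau_sub_le (hk : IsLipschitzKernel γ A k) (hA : 0 ≤ A) (hγ0 : 0 < γ)
    (hγ1 : γ ≤ 1) {g : Space n → ℂ} (hg : Integrable g) {R : ℝ} (hR : 0 < R)
    {x x' : Space n} {σ : ℝ} (hσ : σ ≤ R) (hxx' : ‖x - x'‖ ≤ σ) :
    ‖tau k R g x - tau k R g x'‖ₑ ≤ ENNReal.ofReal (2 * 6 ^ ((n : ℝ) + γ) * A * (σ / R) ^ γ) *
      ∫⁻ y, ENNReal.ofReal (radial γ R (x - y)) * ‖g y‖ₑ := by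
  have hσ0 : 0 ≤ σ := (norm_nonneg _).trans hxx'
  have hi : ∀ z, Integrable fun y => trunc k R z y * g y := fun z =>
    hg.bdd_mul (continuous_trunc_right hk hA hγ0 hγ1 hR z).aestronglyMeasurable
      (Filter.Eventually.of_forall fun y => norm_trunc_le hk hA hR z y)
  rw [tau, tau, ← integral_sub (hi x) (hi x'), ← lintegral_ofReal_radial_mul (by positivity)]
  refine (enorm_integral_le_lintegral_enorm _).trans (lintegral_mono fun y => ?_)
  rw [← sub_mul, enorm_mul]
  gcongr
  refine enorm_le_ofReal ((norm_trunc_sub_le hk hA hγ0 hγ1 hR y (hxx'.trans hσ)).trans ?_)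
  have := radial_nonneg (β := γ) hR.le (x - y)
  gcongr

theorem lintegral_sq_le_of_enorm_le {u : Space n → ℂ} {g : Space n → ℂ} (hg : Measurable g)
    {β δ c : ℝ} (hδ : 0 < δ)
    (h : ∀ x, ‖u x‖ₑ ≤ ENNReal.ofReal c * ∫⁻ y, ENNReal.ofReal (radial β δ (x - y)) * ‖g y‖ₑ) :
    ∫⁻ x, ‖u x‖ₑ ^ 2 ≤ (ENNReal.ofReal c * radialMass n β) ^ 2 * ∫⁻ x, ‖g x‖ₑ ^ 2 := by
  calc ∫⁻ x, ‖u x‖ₑ ^ 2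
      ≤ ∫⁻ x, ENNReal.ofReal c ^ 2 *
          (∫⁻ y, ENNReal.ofReal (radial β δ (x - y)) * ‖g y‖ₑ) ^ 2 := by
        refine lintegral_mono fun x => ?_
        rw [← mul_pow]
        exact pow_le_pow_left' (h x) 2
    _ ≤ _ := by
        rw [lintegral_const_mul' _ _ (ENNReal.pow_ne_top ENNReal.ofReal_ne_top), mul_pow, mul_assoc]
        gcongr
        exact lintegral_sq_radial_le hδ hg.enorm

theorem IsAtom.lintegral_sq_tau_le (hk : IsLipschitzKernel γ A k) (hA : 0 ≤ A) (hγ0 : 0 < γ)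
    (hγ1 : γ ≤ 1) {m : ℤ} {g : Space n → ℂ} (hg : IsAtom m g) {R : ℝ} (hR : size m ≤ R) :
    ∫⁻ x, ‖tau k R g x‖ₑ ^ 2 ≤
      (ENNReal.ofReal (2 * 6 ^ ((n : ℝ) + γ) * A * (size m / R) ^ γ) * radialMass n γ) ^ 2 *
        ∫⁻ x, ‖g x‖ₑ ^ 2 :=
  lintegral_sq_le_of_enorm_le hg.measurable ((size_pos m).trans_le hR)
    fun x => hg.enorm_tau_le hk hA hγ0 hγ1 hR x

theorem IsAtom.memLp_tau (hk : IsLipschitzKernel γ A k) (hA : 0 ≤ A) (hγ0 : 0 < γ)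
    (hγ1 : γ ≤ 1) {m : ℤ} {g : Space n → ℂ} (hg : IsAtom m g) {R : ℝ} (hR : size m ≤ R) :
    MemLp (tau k R g) 2 := by
  rw [memLp_two_iff (measurable_tau hk hA hγ0 hγ1 ((size_pos m).trans_le hR)
    hg.measurable).aestronglyMeasurable]
  refine (hg.lintegral_sq_tau_le hk hA hγ0 hγ1 hR).trans_lt (ENNReal.mul_lt_top ?_ ?_)
  · exact ENNReal.pow_lt_top (ENNReal.mul_lt_top ENNReal.ofReal_lt_top (radialMass_lt_top hγ0))
  · exact (memLp_two_iff hg.measurable.aestronglyMeasurable).1 (hg.memLp 2)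

theorem enorm_sub_dyadicExp_le (j : ℤ) {u : Space n → ℂ} {x : Space n} {c : ℝ≥0∞}
    (hu : IntegrableOn u (dyadicCube j (dyadicIndex j x)))
    (h : ∀ y, dyadicIndex j y = dyadicIndex j x → ‖u x - u y‖ₑ ≤ c) :
    ‖u x - dyadicExp j u x‖ₑ ≤ c := by
  have hc : Integrable fun y => (avgKernel j x y : ℂ) * u x := by
    refine integrable_avgKernel_mul j x (f := fun _ => u x) ?_
    exact integrableOn_const (by simp [volume_dyadicCube])
  have e : u x - dyadicExp j u x = ∫ y, (avgKernel j x y : ℂ) * (u x - u y) := by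
    simp_rw [mul_sub]
    rw [integral_sub hc (integrable_avgKernel_mul j x hu), ← dyadicExp_eq_integral j u,
      ← dyadicExp_eq_integral j fun _ => u x, dyadicExp_of_const j (x := x) (u := fun _ => u x) fun _ _ => rfl]
  rw [e]
  calc _ ≤ ∫⁻ y, ‖(avgKernel j x y : ℂ) * (u x - u y)‖ₑ := enorm_integral_le_lintegral_enorm _
    _ ≤ ∫⁻ y, ENNReal.ofReal (avgKernel j x y) * c := by
        refine lintegral_mono fun y => ?_
        rw [enorm_mul, ← ofReal_norm (avgKernel j x y : ℂ), Complex.norm_real,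
          Real.norm_of_nonneg (avgKernel_nonneg _ _ _)]
        by_cases hy : dyadicIndex j y = dyadicIndex j x
        · gcongr
          exact h y hy
        · rw [avgKernel_eq, if_neg fun h => hy h.symm]
          simp
    _ = c := by
        rw [lintegral_mul_const _ (measurable_ofReal_avgKernel j).of_uncurry_left,
          lintegral_avgKernel, one_mul]

/-- The high frequency part of `tau k R g` is small. -/
theorem IsAtom.lintegral_sq_tau_sub_le (hk : IsLipschitzKernel γ A k) (hA : 0 ≤ A) (hγ0 : 0 < γ)
    (hγ1 : γ ≤ 1) {m : ℤ} {g : Space n → ℂ} (hg : IsAtom m g) {R : ℝ} (hR : size m ≤ R)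
    {j : ℤ} (hj : size j ≤ R) :
    ∫⁻ x, ‖tau k R g x - dyadicExp j (tau k R g) x‖ₑ ^ 2 ≤
      (ENNReal.ofReal (2 * 6 ^ ((n : ℝ) + γ) * A * (size j / R) ^ γ) * radialMass n γ) ^ 2 *
        ∫⁻ x, ‖g x‖ₑ ^ 2 := by
  have hR0 : 0 < R := (size_pos m).trans_le hR
  refine lintegral_sq_le_of_enorm_le hg.measurable hR0 fun x => ?_
  refine enorm_sub_dyadicExp_le j 
    (integrableOn_dyadicCube_of_memLp (hg.memLp_tau hk hA hγ0 hγ1 hR) j _) fun y hy => ?_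
  exact enorm_tau_sub_le hk hA hγ0 hγ1 hg.integrable hR0 hj (norm_sub_le_size hy.symm)

end Atom

/-! ### Boundary layers of cubes and the kernel across them. -/

section Layer

variable {n : ℕ}

/-- The points at distance at most `r` from the boundary of the cube `dyadicCube j q`. -/
def layer (j : ℤ) (q : Fin n → ℤ) (r : ℝ) : Set (Space n) :=
  {x | (∀ i, x i ∈ Set.Icc ((q i : ℝ) * size j - r) (((q i : ℝ) + 1) * size j + r)) ∧
    ∃ i, x i ∈ Set.Icc ((q i : ℝ) * size j - r) ((q i : ℝ) * size j + r) ∨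
      x i ∈ Set.Icc (((q i : ℝ) + 1) * size j - r) (((q i : ℝ) + 1) * size j + r)}

theorem measurableSet_layer (j : ℤ) (q : Fin n → ℤ) (r : ℝ) : MeasurableSet (layer j q r) := by
  have h : ∀ (i : Fin n) (a b : ℝ), MeasurableSet {x : Space n | x i ∈ Set.Icc a b} :=
    fun i a b => measurable_pi_apply i measurableSet_Icc
  have e : layer j q r = (⋂ i, {x : Space n | x i ∈
        Set.Icc ((q i : ℝ) * size j - r) (((q i : ℝ) + 1) * size j + r)}) ∩
      ⋃ i, ({x : Space n | x i ∈ Set.Icc ((q i : ℝ) * size j - r) ((q i : ℝ) * size j + r)} ∪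
        {x : Space n | x i ∈
          Set.Icc (((q i : ℝ) + 1) * size j - r) (((q i : ℝ) + 1) * size j + r)}) := by
    ext x
    simp [layer]
  rw [e]
  exact (MeasurableSet.iInter fun i => h _ _ _).inter
    (MeasurableSet.iUnion fun i => (h _ _ _).union (h _ _ _))

theorem mem_layer_of_mem_of_notMem {j : ℤ} {q : Fin n → ℤ} {r : ℝ} {x y : Space n}
    (hx : x ∈ dyadicCube j q) (hy : y ∉ dyadicCube j q) (h : ‖x - y‖ ≤ r) :
    x ∈ layer j q r ∧ y ∈ layer j q r := by
  have hc : ∀ i, |x i - y i| ≤ r := fun i => by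
    simpa using (norm_le_pi_norm (x - y) i).trans h
  have hr : 0 ≤ r := (norm_nonneg _).trans h
  have hx' : ∀ i, (q i : ℝ) * size j ≤ x i ∧ x i < ((q i : ℝ) + 1) * size j := fun i => hx i
  have hy' : ∃ i, y i < (q i : ℝ) * size j ∨ ((q i : ℝ) + 1) * size j ≤ y i := by
    by_contra hcon
    push Not at hcon
    exact hy fun i => ⟨(hcon i).1, (hcon i).2⟩
  obtain ⟨i, hi⟩ := hy'
  refine ⟨⟨fun i => ?_, i, ?_⟩, ⟨fun i => ?_, i, ?_⟩⟩
  · have := hx' i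
    constructor <;> linarith
  · have h1 := hx' i
    have h2 := abs_le.1 (hc i)
    rcases hi with hi | hi
    · left; constructor <;> linarith
    · right; constructor <;> linarith
  · have h1 := hx' i
    have h2 := abs_le.1 (hc i)
    constructor <;> linarith
  · have h1 := hx' i
    have h2 := abs_le.1 (hc i)
    rcases hi with hi | hi
    · left; constructor <;> linarith
    · right; constructor <;> linarith

/-- The slab is a box with one edge 2r and the others ℓ + 2r ≤ 5ℓ. -/
theorem volume_slab_le {ℓ r : ℝ} (hℓ : 0 < ℓ) (hr0 : 0 ≤ r) (hr : r ≤ 2 * ℓ) (i : Fin n)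
    (a : Fin n → ℝ) (c : ℝ) :
    volume {x : Space n | (∀ i, x i ∈ Set.Icc (a i - r) (a i + ℓ + r)) ∧
      x i ∈ Set.Icc (c - r) (c + r)} ≤ ENNReal.ofReal ((5 * ℓ) ^ n * (2 * r / (5 * ℓ))) := by
  have hsub : {x : Space n | (∀ i, x i ∈ Set.Icc (a i - r) (a i + ℓ + r)) ∧
      x i ∈ Set.Icc (c - r) (c + r)} ⊆ Set.pi Set.univ fun i' =>
        if i' = i then Set.Icc (c - r) (c + r) else Set.Icc (a i' - r) (a i' + ℓ + r) := by
    rintro x ⟨h1, h2⟩ i' _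
    dsimp only
    split_ifs with h
    · rw [h]; exact h2
    · exact h1 i'
  refine (measure_mono hsub).trans ?_
  rw [volume_pi_pi]
  have hle : ∀ i', volume (if i' = i then Set.Icc (c - r) (c + r)
      else Set.Icc (a i' - r) (a i' + ℓ + r)) ≤
        ENNReal.ofReal ((5 * ℓ) * if i' = i then 2 * r / (5 * ℓ) else 1) := by
    intro i'
    split_ifs
    · rw [Real.volume_Icc]
      refine ENNReal.ofReal_le_ofReal (le_of_eq ?_)
      field_simp
      ring
    · rw [Real.volume_Icc]
      exact ENNReal.ofReal_le_ofReal (by linarith)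
  refine (Finset.prod_le_prod' fun i' _ => hle i').trans_eq ?_
  rw [← ENNReal.ofReal_prod_of_nonneg]
  · rw [Finset.prod_mul_distrib]
    simp
  · intro i' _
    split_ifs <;> positivity

theorem volume_layer_le (j : ℤ) (q : Fin n → ℤ) {r : ℝ} (hr0 : 0 ≤ r) (hr : r ≤ 2 * size j) :
    volume (layer j q r) ≤ ENNReal.ofReal (n * 5 ^ n * size j ^ n * (r / size j)) := by
  have hℓ := size_pos j
  have hsub : layer j q r ⊆ ⋃ i : Fin n,
      ({x : Space n | (∀ i, x i ∈ Set.Icc ((q i : ℝ) * size j - r)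
          ((q i : ℝ) * size j + size j + r)) ∧
        x i ∈ Set.Icc ((q i : ℝ) * size j - r) ((q i : ℝ) * size j + r)} ∪
      {x : Space n | (∀ i, x i ∈ Set.Icc ((q i : ℝ) * size j - r)
          ((q i : ℝ) * size j + size j + r)) ∧
        x i ∈ Set.Icc (((q i : ℝ) + 1) * size j - r) (((q i : ℝ) + 1) * size j + r)}) := by
    rintro x ⟨h1, i, h2⟩
    have h1' : ∀ i, x i ∈ Set.Icc ((q i : ℝ) * size j - r) ((q i : ℝ) * size j + size j + r) := by
      intro i
      have := h1 i
      rwa [add_mul, one_mul] at this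
    refine Set.mem_iUnion.2 ⟨i, ?_⟩
    rcases h2 with h2 | h2
    · exact Or.inl ⟨h1', h2⟩
    · exact Or.inr ⟨h1', h2⟩
  refine (measure_mono hsub).trans ((measure_iUnion_fintype_le _ _).trans ?_)
  have hi : ∀ i ∈ Finset.univ, volume
      ({x : Space n | (∀ i, x i ∈ Set.Icc ((q i : ℝ) * size j - r)
          ((q i : ℝ) * size j + size j + r)) ∧
        x i ∈ Set.Icc ((q i : ℝ) * size j - r) ((q i : ℝ) * size j + r)} ∪
      {x : Space n | (∀ i, x i ∈ Set.Icc ((q i : ℝ) * size j - r)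
          ((q i : ℝ) * size j + size j + r)) ∧
        x i ∈ Set.Icc (((q i : ℝ) + 1) * size j - r) (((q i : ℝ) + 1) * size j + r)}) ≤
      ENNReal.ofReal (2 * ((5 * size j) ^ n * (2 * r / (5 * size j)))) := by
    intro i _
    refine (measure_union_le _ _).trans ?_
    rw [two_mul, ENNReal.ofReal_add (by positivity) (by positivity)]
    exact add_le_add (volume_slab_le hℓ hr0 hr i _ _) (volume_slab_le hℓ hr0 hr i _ _)
  refine (Finset.sum_le_sum hi).trans ?_
  rw [Finset.sum_const, Finset.card_univ, Fintype.card_fin, nsmul_eq_mul,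
    ← ENNReal.ofReal_natCast, ← ENNReal.ofReal_mul (by positivity)]
  refine ENNReal.ofReal_le_ofReal ?_
  have e : (n : ℝ) * (2 * ((5 * size j) ^ n * (2 * r / (5 * size j)))) =
      (n * 5 ^ n * size j ^ n * (r / size j)) * (4 / 5) := by
    rw [mul_pow]
    field_simp
    ring
  rw [e]
  exact mul_le_of_le_one_right (by positivity) (by norm_num)

/-- A point that leaves the cube under a shift by `w` lies within |w| of the boundary, which gives a
bound linear in |w|; for |w| larger than the edge the whole cube is used. The weaker power β covers
both cases and, unlike the linear weight, stays integrable against `radial γ δ` when β < γ. -/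
theorem volume_exit_le (hn : 1 ≤ n) {β : ℝ} (hβ0 : 0 ≤ β) (hβ1 : β ≤ 1) (j : ℤ) (q : Fin n → ℤ)
    (w : Space n) :
    volume {z | z ∈ dyadicCube j q ∧ z - w ∉ dyadicCube j q} ≤
      ENNReal.ofReal (n * 5 ^ n * size j ^ n * (‖w‖ / size j) ^ β) := by
  have hℓ := size_pos j
  rcases le_or_gt ‖w‖ (size j) with h | h
  · refine (measure_mono fun z hz => (mem_layer_of_mem_of_notMem hz.1 hz.2
      (r := ‖w‖) (by simp)).1).trans ((volume_layer_le j q (norm_nonneg w) (by linarith)).trans ?_)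
    refine ENNReal.ofReal_le_ofReal ?_
    gcongr
    exact Real.self_le_rpow_of_le_one (by positivity) ((div_le_one hℓ).2 h) hβ1
  · refine (measure_mono fun z hz => hz.1).trans ?_
    rw [volume_dyadicCube]
    refine ENNReal.ofReal_le_ofReal ?_
    have h1 : (1 : ℝ) ≤ n := by exact_mod_cast hn
    have h2 : (1 : ℝ) ≤ 5 ^ n := one_le_pow₀ (by norm_num)
    have h3 : 1 ≤ (‖w‖ / size j) ^ β := Real.one_le_rpow ((one_le_div hℓ).2 h.le) hβ0
    have h4 : (1 : ℝ) ≤ n * 5 ^ n := one_le_mul_of_one_le_of_one_le h1 h2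
    have h5 : 0 ≤ size j ^ n := by positivity
    calc size j ^ n = 1 * size j ^ n * 1 := by ring
      _ ≤ _ := by gcongr

/-- Half of the decay exponent pays for the weight, as |w| ≤ δ + |w|; the other half keeps the
kernel integrable. -/
theorem radial_mul_rpow_le {γ δ ℓ : ℝ} (hγ : 0 < γ) (hδ : 0 < δ) (hℓ : 0 < ℓ) (w : Space n) :
    radial γ δ w * (‖w‖ / ℓ) ^ (γ / 2) ≤ (δ / ℓ) ^ (γ / 2) * radial (γ / 2) δ w := by
  have h0 : 0 < δ + ‖w‖ := by positivity
  have e : (δ / ℓ) ^ (γ / 2) * radial (γ / 2) δ w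
      = radial γ δ w * ((δ + ‖w‖) / ℓ) ^ (γ / 2) := by
    have e1 : (δ + ‖w‖) ^ ((n : ℝ) + γ)
        = (δ + ‖w‖) ^ ((n : ℝ) + γ / 2) * (δ + ‖w‖) ^ (γ / 2) := by
      rw [← Real.rpow_add h0]; ring_nf
    have e2 : δ ^ γ = δ ^ (γ / 2) * δ ^ (γ / 2) := by
      rw [← Real.rpow_add hδ]; ring_nf
    rw [radial, radial, Real.div_rpow hδ.le hℓ.le, Real.div_rpow h0.le hℓ.le, e1, e2]
    field_simp
  rw [e]
  have := radial_nonneg (β := γ) hδ.le w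
  gcongr
  linarith

/-- The kernel `radial γ δ (z - y)`, restricted to the pairs of points that are separated by the
dyadic cubes of generation `j`. -/
noncomputable def sepKernel (γ δ : ℝ) (j : ℤ) (z y : Space n) : ℝ≥0∞ :=
  if dyadicIndex j z = dyadicIndex j y then 0 else ENNReal.ofReal (radial γ δ (z - y))

theorem sepKernel_comm (γ δ : ℝ) (j : ℤ) (z y : Space n) :
    sepKernel γ δ j z y = sepKernel γ δ j y z := by
  simp only [sepKernel, eq_comm (a := dyadicIndex j z), ← radial_neg γ δ (z - y), neg_sub]

theorem measurableSet_eq_dyadicIndex (j : ℤ) :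
    MeasurableSet {p : Space n × Space n | dyadicIndex j p.1 = dyadicIndex j p.2} :=
  measurableSet_eq_fun ((measurable_dyadicIndex j).comp measurable_fst)
    ((measurable_dyadicIndex j).comp measurable_snd)

theorem measurable_sepKernel (γ δ : ℝ) (j : ℤ) :
    Measurable (Function.uncurry (sepKernel γ δ j : Space n → Space n → ℝ≥0∞)) :=
  Measurable.ite (measurableSet_eq_dyadicIndex j) measurable_const (measurable_radial_sub γ δ)

theorem sepKernel_le (γ δ : ℝ) (j : ℤ) (z y : Space n) :
    sepKernel γ δ j z y ≤ ENNReal.ofReal (radial γ δ (z - y)) := by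
  unfold sepKernel
  split_ifs
  · exact zero_le
  · exact le_rfl

/-- The mass of `sepKernel`. -/
noncomputable def sepMass (γ δ : ℝ) (j : ℤ) (z : Space n) : ℝ≥0∞ := ∫⁻ y, sepKernel γ δ j z y

theorem measurable_sepMass (γ δ : ℝ) (j : ℤ) :
    Measurable (sepMass γ δ j : Space n → ℝ≥0∞) :=
  (measurable_sepKernel γ δ j).lintegral_prod_right'

theorem sepMass_le {γ δ : ℝ} (hδ : 0 < δ) (j : ℤ) (z : Space n) :
    sepMass γ δ j z ≤ radialMass n γ :=
  (lintegral_mono fun y => sepKernel_le γ δ j z y).trans_eq (lintegral_radial_sub_left hδ z)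

theorem lintegral_avgKernel_mul (j : ℤ) (x : Space n) (φ : Space n → ℝ≥0∞) :
    ∫⁻ z, ENNReal.ofReal (avgKernel j x z) * φ z
      = ENNReal.ofReal ((size j ^ n)⁻¹) * ∫⁻ z in dyadicCube j (dyadicIndex j x), φ z := by
  rw [← lintegral_indicator (measurableSet_dyadicCube _ _),
    ← lintegral_const_mul' _ _ ENNReal.ofReal_ne_top]
  congr with z
  by_cases hz : z ∈ dyadicCube j (dyadicIndex j x)
  · rw [avgKernel_of_mem hz, Set.indicator_of_mem hz]
  · rw [avgKernel_of_notMem hz, Set.indicator_of_notMem hz]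
    simp

/-- After substituting y = z - w and exchanging integrals, the inner integral measures the points of
the cube that leave it under a shift by `w`, so `volume_exit_le` with β = γ/2 applies. -/
theorem lintegral_avgKernel_sepMass_le (hn : 1 ≤ n) {γ δ : ℝ} (hγ0 : 0 < γ) (hγ1 : γ ≤ 1)
    (hδ : 0 < δ) (j : ℤ) (x : Space n) :
    ∫⁻ z, ENNReal.ofReal (avgKernel j x z) * sepMass γ δ j z ≤
      ENNReal.ofReal (n * 5 ^ n * (δ / size j) ^ (γ / 2)) * radialMass n (γ / 2) := by
  classical
  have hℓ := size_pos j
  set Q := dyadicCube j (dyadicIndex j x) with hQ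
  have hQm : MeasurableSet Q := measurableSet_dyadicCube _ _
  have e1 : ∀ z ∈ Q, sepMass γ δ j z
      = ∫⁻ w, (if z - w ∈ Q then 0 else ENNReal.ofReal (radial γ δ w)) := by
    intro z hz
    rw [sepMass, ← lintegral_sub_left_eq_self (μ := volume) _ z]
    congr with w
    rw [sepKernel, sub_sub_cancel, hQ, mem_dyadicCube_iff, ← (mem_dyadicCube_iff _ _ _).1 hz]
    simp only [eq_comm]
  rw [lintegral_avgKernel_mul, setLIntegral_congr_fun hQm e1]
  have hm : Measurable (Function.uncurry fun (z w : Space n) =>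
      if z - w ∈ Q then (0 : ℝ≥0∞) else ENNReal.ofReal (radial γ δ w)) :=
    Measurable.ite (measurable_fst.sub measurable_snd hQm) measurable_const
      ((measurable_radial γ δ).comp measurable_snd).ennreal_ofReal
  rw [lintegral_lintegral_swap hm.aemeasurable]
  have e2 : ∀ w : Space n, ∫⁻ z in Q, (if z - w ∈ Q then (0 : ℝ≥0∞)
      else ENNReal.ofReal (radial γ δ w)) ≤ ENNReal.ofReal (n * 5 ^ n * size j ^ n) *
        (ENNReal.ofReal ((δ / size j) ^ (γ / 2)) * ENNReal.ofReal (radial (γ / 2) δ w)) := by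
    intro w
    have e3 : ∀ z, (if z - w ∈ Q then (0 : ℝ≥0∞) else ENNReal.ofReal (radial γ δ w))
        = {z | z - w ∉ Q}.indicator (fun _ => ENNReal.ofReal (radial γ δ w)) z := by
      intro z
      by_cases hz : z - w ∈ Q <;> simp [hz]
    have hm3 : MeasurableSet {z : Space n | z - w ∉ Q} :=
      (measurable_id.sub_const w hQm).compl
    simp_rw [e3]
    rw [lintegral_indicator_const hm3, Measure.restrict_apply hm3]
    have h4 := volume_exit_le hn (β := γ / 2) (by positivity) (by linarith) j (dyadicIndex j x) w
    have h5 : volume ({z : Space n | z - w ∉ Q} ∩ Q) ≤ _ :=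
      (measure_mono (t := {z | z ∈ Q ∧ z - w ∉ Q}) fun z hz => ⟨hz.2, hz.1⟩).trans h4
    refine (mul_le_mul_right h5 _).trans ?_
    rw [← ENNReal.ofReal_mul (radial_nonneg hδ.le w), ← ENNReal.ofReal_mul (by positivity),
      ← ENNReal.ofReal_mul (by positivity)]
    refine ENNReal.ofReal_le_ofReal ?_
    have := radial_mul_rpow_le hγ0 hδ hℓ w
    calc _ = (n * 5 ^ n * size j ^ n) * (radial γ δ w * (‖w‖ / size j) ^ (γ / 2)) := by ring
      _ ≤ _ := by gcongr
  refine (mul_le_mul_right (lintegral_mono e2) _).trans ?_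
  rw [lintegral_const_mul' _ _ ENNReal.ofReal_ne_top, lintegral_const_mul' _ _ ENNReal.ofReal_ne_top,
    lintegral_radial hδ, ← mul_assoc, ← mul_assoc, ← ENNReal.ofReal_mul (by positivity),
    ← ENNReal.ofReal_mul (by positivity)]
  refine le_of_eq ?_
  congr 2
  field_simp

variable {γ δ : ℝ}

/-- Schur's test for the composed kernel. Row sums carry the gain (δ / size j)^(γ/2), column sums
are only bounded by `radialMass n γ`, so the gain in norm is a power γ/4. -/
theorem lintegral_sq_avg_sep_le (hn : 1 ≤ n) (hγ0 : 0 < γ) (hγ1 : γ ≤ 1)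
    (hδ : 0 < δ) (j : ℤ) {h : Space n → ℝ≥0∞} (hh : Measurable h) :
    ∫⁻ x, (∫⁻ z, ENNReal.ofReal (avgKernel j x z) * ∫⁻ y, sepKernel γ δ j z y * h y) ^ 2 ≤
      ENNReal.ofReal (n * 5 ^ n * (δ / size j) ^ (γ / 2)) * radialMass n (γ / 2) *
        radialMass n γ * ∫⁻ y, h y ^ 2 := by
  have hm3 : Measurable fun p : (Space n × Space n) × Space n =>
      ENNReal.ofReal (avgKernel j p.1.1 p.2) * sepKernel γ δ j p.2 p.1.2 :=
    ((measurable_ofReal_avgKernel j).comp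
      ((measurable_fst.comp measurable_fst).prodMk measurable_snd)).mul
      ((measurable_sepKernel γ δ j).comp
        (measurable_snd.prodMk (measurable_snd.comp measurable_fst)))
  have hK : Measurable (Function.uncurry fun x y : Space n =>
      ∫⁻ z, ENNReal.ofReal (avgKernel j x z) * sepKernel γ δ j z y) :=
    hm3.lintegral_prod_right'
  have hzy : ∀ x : Space n, Measurable (Function.uncurry fun z y : Space n =>
      ENNReal.ofReal (avgKernel j x z) * sepKernel γ δ j z y) := fun x =>
    (((measurable_ofReal_avgKernel j).of_uncurry_left (x := x)).comp measurable_fst).mul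
      (measurable_sepKernel γ δ j)
  have hxz : ∀ y : Space n, Measurable (Function.uncurry fun x z : Space n =>
      ENNReal.ofReal (avgKernel j x z) * sepKernel γ δ j z y) := fun y =>
    (measurable_ofReal_avgKernel j).mul
      (((measurable_sepKernel γ δ j).of_uncurry_right (y := y)).comp measurable_snd)
  have key := lintegral_sq_kernel_le volume volume hK hh
    (a := ENNReal.ofReal (n * 5 ^ n * (δ / size j) ^ (γ / 2)) * radialMass n (γ / 2))
    (b := radialMass n γ) (fun x => ?_) (fun y => ?_)
  · refine le_trans (le_of_eq ?_) key
    congr with x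
    congr 1
    have : ∀ z, ENNReal.ofReal (avgKernel j x z) * ∫⁻ y, sepKernel γ δ j z y * h y
        = ∫⁻ y, ENNReal.ofReal (avgKernel j x z) * sepKernel γ δ j z y * h y := by
      intro z
      simp_rw [mul_assoc]
      rw [lintegral_const_mul' _ _ ENNReal.ofReal_ne_top]
    simp_rw [this]
    have hm : Measurable (Function.uncurry fun z y : Space n =>
        ENNReal.ofReal (avgKernel j x z) * sepKernel γ δ j z y * h y) :=
      (hzy x).mul (hh.comp measurable_snd)
    rw [lintegral_lintegral_swap hm.aemeasurable]
    congr with y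
    rw [lintegral_mul_const _ (hzy x).of_uncurry_right]
  · have hs := (hzy x).comp measurable_swap
    rw [lintegral_lintegral_swap (f := fun y z => ENNReal.ofReal (avgKernel j x z) *
      sepKernel γ δ j z y) hs.aemeasurable]
    simp_rw [lintegral_const_mul' _ _ ENNReal.ofReal_ne_top]
    exact lintegral_avgKernel_sepMass_le hn hγ0 hγ1 hδ j x
  · rw [lintegral_lintegral_swap (hxz y).aemeasurable]
    have : ∀ z, ∫⁻ x, ENNReal.ofReal (avgKernel j x z) * sepKernel γ δ j z y
        = sepKernel γ δ j y z := by
      intro z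
      rw [lintegral_mul_const _ (measurable_ofReal_avgKernel j).of_uncurry_right]
      simp_rw [avgKernel_comm j _ z]
      rw [lintegral_avgKernel, one_mul, sepKernel_comm]
    simp_rw [this]
    exact sepMass_le hδ j y

/-- Counterpart of `lintegral_sq_avg_sep_le` with the source inside the cube and the kernel mass
outside. -/
theorem lintegral_sq_avg_sepMass_le (hn : 1 ≤ n) (hγ0 : 0 < γ) (hγ1 : γ ≤ 1)
    (hδ : 0 < δ) (j : ℤ) {h : Space n → ℝ≥0∞} (hh : Measurable h) :
    ∫⁻ x, (∫⁻ y, ENNReal.ofReal (avgKernel j x y) * (sepMass γ δ j y * h y)) ^ 2 ≤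
      ENNReal.ofReal (n * 5 ^ n * (δ / size j) ^ (γ / 2)) * radialMass n (γ / 2) *
        radialMass n γ * ∫⁻ y, h y ^ 2 := by
  have hK : Measurable (Function.uncurry fun x y : Space n =>
      ENNReal.ofReal (avgKernel j x y) * sepMass γ δ j y) :=
    (measurable_ofReal_avgKernel j).mul ((measurable_sepMass γ δ j).comp measurable_snd)
  simp_rw [← mul_assoc (ENNReal.ofReal (avgKernel j _ _))]
  refine lintegral_sq_kernel_le volume volume hK hh
    (fun x => lintegral_avgKernel_sepMass_le hn hγ0 hγ1 hδ j x) (fun y => ?_)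
  rw [lintegral_mul_const _ (measurable_ofReal_avgKernel j).of_uncurry_right]
  simp_rw [avgKernel_comm j _ y]
  rw [lintegral_avgKernel, one_mul]
  exact sepMass_le hδ j y

end Layer

/-! ### Interactions across the boundary of a cube and the twisted image. -/

section Twisted

variable {n : ℕ} {γ A : ℝ} {k : Space n → Space n → ℂ}

theorem lintegral_sq_apply_le {T : L2 n →L[ℂ] L2 n} (hT1 : ‖T‖ ≤ 1) {g : Space n → ℂ}
    (hg : MemLp g 2) : ∫⁻ x, ‖T (hg.toLp g) x‖ₑ ^ 2 ≤ ∫⁻ x, ‖g x‖ₑ ^ 2 := by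
  rw [← sq_eLpNorm_two, ← sq_eLpNorm_two]
  refine pow_le_pow_left' ?_ 2
  rw [← Lp.enorm_def, ← Lp.enorm_toLp (f := g) (hf := hg), ← ofReal_norm, ← ofReal_norm]
  refine ENNReal.ofReal_le_ofReal ((T.le_opNorm _).trans ?_)
  exact mul_le_of_le_one_left (norm_nonneg _) hT1

/-- An atom may be cut only along whole cubes of generation `m`, or cancellation is lost; rounding a
layer to such cubes widens it by their edge. -/
theorem mem_layer_of_mem_layer {j m : ℤ} {q : Fin n → ℤ} {r : ℝ} {y y' : Space n}
    (h : dyadicIndex m y = dyadicIndex m y') (hy : y ∈ layer j q r) :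
    y' ∈ layer j q (r + size m) := by
  have hc : ∀ i, |y i - y' i| ≤ size m := fun i => by
    simpa using (norm_le_pi_norm (y - y') i).trans (norm_sub_le_size h)
  obtain ⟨h1, i, h2⟩ := hy
  refine ⟨fun i => ?_, i, ?_⟩
  · have h3 := h1 i
    have h4 := abs_le.1 (hc i)
    rw [Set.mem_Icc] at h3 ⊢
    constructor <;> linarith
  · have h4 := abs_le.1 (hc i)
    simp only [Set.mem_Icc] at h2 ⊢
    rcases h2 with h2 | h2
    · left; constructor <;> linarith
    · right; constructor <;> linarith

/-- The integral of `T g` over a set separated from `g` by the boundary of a dyadic cube. -/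
theorem IsAtom.lintegral_apply_le (hk : IsLipschitzKernel γ A k) (hA : 0 ≤ A) (hγ0 : 0 < γ)
    (hγ1 : γ ≤ 1) {T : L2 n →L[ℂ] L2 n} (hT : IsAssociated T k) (hT1 : ‖T‖ ≤ 1) {j m : ℤ}
    {g : Space n → ℂ} (hg : IsAtom m g) (q : Fin n → ℤ) {H : Set (Space n)}
    (hH : MeasurableSet H)
    (hsep : ∀ x ∈ H, ∀ y, g y ≠ 0 → (x ∈ dyadicCube j q ↔ y ∉ dyadicCube j q)) :
    ∃ a : ℝ≥0∞, a ^ 2 ≤ volume (layer j q (2 * size m)) *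
        ∫⁻ y in layer j q (3 * size m), ‖g y‖ₑ ^ 2 ∧
      ∫⁻ x in H, ‖T ((hg.memLp 2).toLp g) x‖ₑ ≤ a + ENNReal.ofReal (2 ^ ((n : ℝ) + γ) * A) *
        ∫⁻ x in H, ∫⁻ y, ENNReal.ofReal (radial γ (size m) (x - y)) * ‖g y‖ₑ := by
  set S := layer j q (2 * size m) with hS
  set c := ENNReal.ofReal (2 ^ ((n : ℝ) + γ) * A) with hc
  have hSm : MeasurableSet S := measurableSet_layer _ _ _
  have hnear : ∀ x ∈ H, ∀ y, g y ≠ 0 → ‖x - y‖ ≤ 2 * size m → x ∈ S ∧ y ∈ S := by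
    intro x hx y hy hxy
    by_cases hxq : x ∈ dyadicCube j q
    · exact mem_layer_of_mem_of_notMem hxq ((hsep x hx y hy).1 hxq) hxy
    · have hyq : y ∈ dyadicCube j q := by
        by_contra h
        exact hxq ((hsep x hx y hy).2 h)
      rw [norm_sub_rev] at hxy
      exact (mem_layer_of_mem_of_notMem hyq hxq hxy).symm
  -- The layer S rounded up to cubes of generation `m`. The part of `g` off N is at distance at
  -- least 2 size m from H, so pointwise decay holds for it on all of H; for the part on N it holds
  -- on H \ S.
  set N : Set (Space n) := {y | ∃ y', dyadicIndex m y' = dyadicIndex m y ∧ y' ∈ S} with hN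
  have hNd : ∀ x y, dyadicIndex m x = dyadicIndex m y → x ∈ N → y ∈ N := by
    rintro x y hxy ⟨y', h1, h2⟩
    exact ⟨y', h1.trans hxy, h2⟩
  have hNd' : ∀ x y, dyadicIndex m x = dyadicIndex m y → x ∈ Nᶜ → y ∈ Nᶜ :=
    fun x y hxy hx hy => hx (hNd y x hxy.symm hy)
  have hNm : MeasurableSet N := measurableSet_of_dyadic hNd
  have hg1 := hg.indicator hNd
  have hg2 := hg.indicator hNd'
  have hsum : (hg.memLp 2).toLp g = (hg1.memLp 2).toLp _ + (hg2.memLp 2).toLp _ := by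
    rw [← MemLp.toLp_add]
    congr 1
    rw [Set.indicator_self_add_compl]
  have hTsum : ∀ᵐ x, T ((hg.memLp 2).toLp g) x
      = T ((hg1.memLp 2).toLp _) x + T ((hg2.memLp 2).toLp _) x := by
    rw [hsum, map_add]
    exact Lp.coeFn_add _ _
  have hf1 := hg1.ae_enorm_apply_le hk hA hγ0 hγ1 hT
  have hf2 := hg2.ae_enorm_apply_le hk hA hγ0 hγ1 hT
  have hpt : ∀ᵐ x, x ∈ H → ‖T ((hg.memLp 2).toLp g) x‖ₑ ≤
      S.indicator (fun x => ‖T ((hg1.memLp 2).toLp _) x‖ₑ) x +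
      c * ∫⁻ y, ENNReal.ofReal (radial γ (size m) (x - y)) * ‖g y‖ₑ := by
    filter_upwards [hTsum, hf1, hf2] with x h0 h1 h2 hxH
    have k2 := h2 fun y hy => by
      by_contra hlt
      push Not at hlt
      obtain ⟨hyN, hgy⟩ := Set.indicator_apply_ne_zero.1 hy
      exact hyN ⟨y, rfl, (hnear x hxH y hgy hlt.le).2⟩
    rw [h0]
    refine (enorm_add_le _ _).trans ?_
    have hsplit : ∫⁻ y, ENNReal.ofReal (radial γ (size m) (x - y)) * ‖g y‖ₑ
        = (∫⁻ y, ENNReal.ofReal (radial γ (size m) (x - y)) * ‖N.indicator g y‖ₑ)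
          + ∫⁻ y, ENNReal.ofReal (radial γ (size m) (x - y)) * ‖Nᶜ.indicator g y‖ₑ := by
      rw [← lintegral_add_left]
      · congr with y
        rw [← mul_add]
        by_cases hy : y ∈ N <;> simp [hy]
      · exact ((measurable_radial_sub γ (size m)).of_uncurry_left (x := x)).mul
          hg1.measurable.enorm
    by_cases hxS : x ∈ S
    · rw [Set.indicator_of_mem hxS]
      refine add_le_add le_rfl (k2.trans ?_)
      rw [hsplit]
      gcongr
      exact le_add_self
    · rw [Set.indicator_of_notMem hxS, zero_add, hsplit, mul_add]
      refine add_le_add (h1 fun y hy => ?_) k2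
      by_contra hlt
      push Not at hlt
      obtain ⟨hyN, hgy⟩ := Set.indicator_apply_ne_zero.1 hy
      exact hxS (hnear x hxH y hgy hlt.le).1
  -- What remains is the image of the part on N integrated over S, handled by Cauchy–Schwarz and ‖T‖
  -- ≤ 1.
  refine ⟨∫⁻ x in S, ‖T ((hg1.memLp 2).toLp _) x‖ₑ, ?_, ?_⟩
  · have hTm : AEMeasurable (fun x => ‖T ((hg1.memLp 2).toLp _) x‖ₑ) (volume.restrict S) :=
      (Lp.aestronglyMeasurable _).enorm.restrict
    refine (sq_lintegral_le _ hTm).trans ?_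
    rw [Measure.restrict_apply .univ, Set.univ_inter]
    refine mul_le_mul' le_rfl ?_
    refine (setLIntegral_le_lintegral _ _).trans ((lintegral_sq_apply_le hT1 _).trans ?_)
    rw [← lintegral_indicator (measurableSet_layer _ _ _)]
    refine lintegral_mono fun y => ?_
    by_cases hy : y ∈ N
    · have hy3 : y ∈ layer j q (3 * size m) := by
        obtain ⟨y', h1, h2⟩ := hy
        have := mem_layer_of_mem_layer h1 h2
        rwa [show 2 * size m + size m = 3 * size m by ring] at this
      simp [hy, hy3]
    · simp [hy]
  · calc ∫⁻ x in H, ‖T ((hg.memLp 2).toLp g) x‖ₑ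
        ≤ ∫⁻ x in H, (S.indicator (fun x => ‖T ((hg1.memLp 2).toLp _) x‖ₑ) x +
            c * ∫⁻ y, ENNReal.ofReal (radial γ (size m) (x - y)) * ‖g y‖ₑ) :=
          lintegral_mono_ae ((ae_restrict_iff' hH).2 hpt)
      _ = (∫⁻ x in H, S.indicator (fun x => ‖T ((hg1.memLp 2).toLp _) x‖ₑ) x) +
            c * ∫⁻ x in H, ∫⁻ y, ENNReal.ofReal (radial γ (size m) (x - y)) * ‖g y‖ₑ := by
          rw [lintegral_add_left', lintegral_const_mul' _ _ ENNReal.ofReal_ne_top]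
          exact ((Lp.aestronglyMeasurable _).enorm.indicator hSm).restrict
      _ ≤ _ := by
          refine add_le_add ?_ le_rfl
          refine (setLIntegral_le_lintegral _ _).trans_eq ?_
          rw [lintegral_indicator hSm]

/-- The function `T g - b̄ g`, where `b` is `T^* 1_B`. -/
noncomputable def twist (T : L2 n →L[ℂ] L2 n) {B : Set (Space n)} (hB : MeasurableSet B)
    (hB' : volume B ≠ ⊤) {g : Space n → ℂ} (hg : MemLp g 2) (z : Space n) : ℂ :=
  T (hg.toLp g) z -
    (starRingEnd ℂ) (ContinuousLinearMap.adjoint T (indicatorConstLp 2 hB hB' (1 : ℂ)) z) * g z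

theorem integrable_star_mul {b : L2 n} {g : Space n → ℂ} (hg : MemLp g 2) :
    Integrable fun z => (starRingEnd ℂ) (b z) * g z :=
  (Lp.memLp b).star.integrable_mul hg

theorem integral_adjoint_mul (T : L2 n →L[ℂ] L2 n) {B : Set (Space n)} (hB : MeasurableSet B)
    (hB' : volume B ≠ ⊤) {g : Space n → ℂ} (hg : MemLp g 2) :
    ∫ z, (starRingEnd ℂ)
      (ContinuousLinearMap.adjoint T (indicatorConstLp 2 hB hB' (1 : ℂ)) z) * g z
      = ∫ z in B, T (hg.toLp g) z := by
  rw [← L2.inner_indicatorConstLp_one hB hB', ← ContinuousLinearMap.adjoint_inner_left,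
    L2.inner_def]
  refine integral_congr_ae ?_
  filter_upwards [hg.coeFn_toLp] with z hz
  rw [hz, RCLike.inner_apply, mul_comm]

theorem integrableOn_lp (u : L2 n) {s : Set (Space n)} (hs : volume s ≠ ⊤) :
    IntegrableOn u s := by
  have : IsFiniteMeasure (volume.restrict s) := ⟨by simpa using hs.lt_top⟩
  exact ((Lp.memLp u).restrict s).integrable one_le_two

/-- By duality the integral of b̄ g over Q is the integral of T(1_Q g) over B. The self-interaction
of Q cancels, and only the two flows across its boundary survive. -/
theorem setIntegral_twist (T : L2 n →L[ℂ] L2 n) {B : Set (Space n)} (hB : MeasurableSet B)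
    (hB' : volume B ≠ ⊤) {Q : Set (Space n)} (hQ : MeasurableSet Q) (hQ' : volume Q ≠ ⊤)
    (hQB : Q ⊆ B ∨ Disjoint Q B) {g : Space n → ℂ} (hg : MemLp g 2) (hgB : ∀ y, g y ≠ 0 → y ∈ B) :
    ∫ z in Q, twist T hB hB' hg z = (∫ z in Q, T ((hg.indicator hQ.compl).toLp (Qᶜ.indicator g)) z) -
      ∫ z in B \ Q, T ((hg.indicator hQ).toLp (Q.indicator g)) z := by
  set g1 := (hg.indicator hQ.compl).toLp (Qᶜ.indicator g)
  set g2 := (hg.indicator hQ).toLp (Q.indicator g) with hg2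
  have hsum : hg.toLp g = g1 + g2 := by
    rw [← MemLp.toLp_add]
    congr 1
    rw [Set.indicator_compl_add_self]
  have e1 : ∫ z in Q, twist T hB hB' hg z = (∫ z in Q, T (hg.toLp g) z) - ∫ z in Q,
      (starRingEnd ℂ)
        (ContinuousLinearMap.adjoint T (indicatorConstLp 2 hB hB' (1 : ℂ)) z) * g z :=
    integral_sub (integrableOn_lp _ hQ') (integrable_star_mul hg).integrableOn
  have e2 : ∫ z in Q, T (hg.toLp g) z = (∫ z in Q, T g1 z) + ∫ z in Q, T g2 z := by
    rw [← integral_add (integrableOn_lp _ hQ') (integrableOn_lp _ hQ'), hsum, map_add]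
    exact integral_congr_ae (ae_restrict_of_ae (Lp.coeFn_add _ _))
  have e3 : ∫ z in Q, (starRingEnd ℂ)
      (ContinuousLinearMap.adjoint T (indicatorConstLp 2 hB hB' (1 : ℂ)) z) * g z
        = ∫ z in B, T g2 z := by
    rw [hg2, ← integral_adjoint_mul T hB hB' (hg.indicator hQ), ← integral_indicator hQ]
    congr with z
    by_cases hz : z ∈ Q <;> simp [hz]
  have e4 : ∫ z in B, T g2 z = (∫ z in Q, T g2 z) + ∫ z in B \ Q, T g2 z := by
    rw [← integral_inter_add_sdiff hQ (integrableOn_lp _ hB')]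
    congr 1
    rcases hQB with h | h
    · rw [Set.inter_eq_self_of_subset_right h]
    -- If Q misses B then 1_Q g = 0, as `g` lives in B.
    · have hzero : g2 = 0 := by
        rw [hg2, ← MemLp.toLp_zero (MemLp.zero (ε := ℂ) (p := 2))]
        congr 1
        funext y
        by_cases hy : y ∈ Q
        · rw [Set.indicator_of_mem hy]
          by_contra hy0
          exact h.le_bot ⟨hy, hgB y hy0⟩
        · rw [Set.indicator_of_notMem hy]; rfl
      have hT0 : (T g2 : Space n → ℂ) =ᵐ[volume] 0 := by
        rw [hzero, map_zero]
        exact Lp.coeFn_zero _ _ _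
      rw [integral_congr_ae (ae_restrict_of_ae hT0), integral_congr_ae (ae_restrict_of_ae hT0)]
      simp
  rw [e1, e2, e3, e4]
  ring

end Twisted

/-! ### Coarse averages of the twisted image. -/

section TwistedBound

variable {n : ℕ} {γ A : ℝ} {k : Space n → Space n → ℂ}

theorem norm_sub_le_of_mem_layer {j : ℤ} {r : ℝ} {x y : Space n} (hr : 0 ≤ r)
    (hy : y ∈ layer j (dyadicIndex j x) r) : ‖y - x‖ ≤ size j + r := by
  have hℓ := size_pos j
  refine (pi_norm_le_iff_of_nonneg (by positivity)).2 fun i => ?_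
  have h1 := mem_dyadicCube_dyadicIndex j x i
  have h2 := hy.1 i
  simp only [Set.mem_Ico, Set.mem_Icc] at h1 h2
  rw [Real.norm_eq_abs, Pi.sub_apply, abs_le]
  constructor <;> linarith

theorem volume_closedBall_le (x : Space n) {r : ℝ} (hr : 0 ≤ r) :
    volume (Metric.closedBall x r) = ENNReal.ofReal ((2 * r) ^ n) := by
  rw [Real.volume_pi_closedBall _ hr, Fintype.card_fin]

theorem lintegral_setLIntegral_closedBall {r : ℝ} (hr : 0 ≤ r) {h : Space n → ℝ≥0∞}
    (hh : Measurable h) :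
    ∫⁻ x, ∫⁻ y in Metric.closedBall x r, h y = ENNReal.ofReal ((2 * r) ^ n) * ∫⁻ y, h y := by
  classical
  have hS : MeasurableSet {p : Space n × Space n | dist p.2 p.1 ≤ r} :=
    measurableSet_le (measurable_snd.dist measurable_fst) measurable_const
  have e1 : ∀ x, ∫⁻ y in Metric.closedBall x r, h y
      = ∫⁻ y, {p : Space n × Space n | dist p.2 p.1 ≤ r}.indicator (fun p => h p.2) (x, y) := by
    intro x
    rw [← lintegral_indicator measurableSet_closedBall]
    rfl
  have hm : Measurable (Function.uncurry fun x y : Space n =>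
      {p : Space n × Space n | dist p.2 p.1 ≤ r}.indicator (fun p => h p.2) (x, y)) :=
    (hh.comp measurable_snd).indicator hS
  simp_rw [e1]
  rw [lintegral_lintegral_swap hm.aemeasurable, ← lintegral_const_mul _ hh]
  congr with y
  have e2 : ∀ x, {p : Space n × Space n | dist p.2 p.1 ≤ r}.indicator (fun p => h p.2) (x, y)
      = (Metric.closedBall y r).indicator (fun _ => h y) x := by
    intro x
    by_cases hx : dist y x ≤ r
    · rw [Set.indicator_of_mem (by exact hx), Set.indicator_of_mem (by rwa [Metric.mem_closedBall'])]
    · rw [Set.indicator_of_notMem (by exact hx),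
        Set.indicator_of_notMem (by rwa [Metric.mem_closedBall'])]
  simp_rw [e2]
  rw [lintegral_indicator_const measurableSet_closedBall, volume_closedBall_le _ hr, mul_comm]

theorem add_sq_le_four_mul (a b c d : ℝ≥0∞) :
    (a + b + (c + d)) ^ 2 ≤ 4 * (a ^ 2 + b ^ 2 + (c ^ 2 + d ^ 2)) := by
  have two : ∀ a b : ℝ≥0∞, (a + b) ^ 2 ≤ 2 * (a ^ 2 + b ^ 2) := by
    intro a b
    have := ENNReal.rpow_add_le_mul_rpow_add_rpow a b (p := 2) one_le_two
    norm_num at this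
    exact this
  calc (a + b + (c + d)) ^ 2 ≤ 2 * ((a + b) ^ 2 + (c + d) ^ 2) := two _ _
    _ ≤ 2 * (2 * (a ^ 2 + b ^ 2) + 2 * (c ^ 2 + d ^ 2)) := by
        gcongr
        · exact two a b
        · exact two c d
    _ = _ := by ring

theorem lintegral_four_mul_add {F₀ F₁ F₂ : Space n → ℝ≥0∞} (h₁ : Measurable F₁)
    (h₂ : Measurable F₂) {r c : ℝ≥0∞} (hr : r ≠ ⊤) (hc : c ≠ ⊤) :
    ∫⁻ x, 4 * (2 * (r * F₀ x) + c * (F₁ x + F₂ x))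
      = 4 * (2 * (r * ∫⁻ x, F₀ x) + c * ((∫⁻ x, F₁ x) + ∫⁻ x, F₂ x)) := by
  have h : Measurable fun x => c * (F₁ x + F₂ x) := (h₁.add h₂).const_mul c
  rw [lintegral_const_mul' _ _ (by simp), lintegral_add_right _ h,
    lintegral_const_mul' _ _ (by simp), lintegral_const_mul' _ _ hr,
    lintegral_const_mul' _ _ hc, lintegral_add_left h₁]

/-- The constant in the estimate of the martingale projections of `twist`. -/
noncomputable def twistConst (n : ℕ) (γ : ℝ) : ℝ≥0∞ :=
  8 * ENNReal.ofReal (2 * n * 40 ^ n) + 8 * (ENNReal.ofReal (2 ^ ((n : ℝ) + γ)) ^ 2 *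
    (ENNReal.ofReal (n * 5 ^ n) * radialMass n (γ / 2) * radialMass n γ))

theorem twistConst_lt_top (n : ℕ) {γ : ℝ} (hγ : 0 < γ) : twistConst n γ < ⊤ := by
  have h1 := radialMass_lt_top (n := n) hγ
  have h2 := radialMass_lt_top (n := n) (half_pos hγ)
  unfold twistConst
  refine ENNReal.add_lt_top.2 ⟨ENNReal.mul_lt_top (by simp) ENNReal.ofReal_lt_top,
    ENNReal.mul_lt_top (by simp) (ENNReal.mul_lt_top (ENNReal.pow_lt_top ENNReal.ofReal_lt_top)
      (ENNReal.mul_lt_top (ENNReal.mul_lt_top ENNReal.ofReal_lt_top h2) h1))⟩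

/-- Each of the two flows of `setIntegral_twist` is estimated by `IsAtom.lintegral_apply_le`, giving
two boundary-layer terms and two separated-kernel terms, in a form that can be integrated in `x`. -/
theorem IsAtom.sq_enorm_dyadicExp_twist_le (hk : IsLipschitzKernel γ A k) (hA : 0 ≤ A)
    (hγ0 : 0 < γ) (hγ1 : γ ≤ 1) {T : L2 n →L[ℂ] L2 n} (hT : IsAssociated T k) (hT1 : ‖T‖ ≤ 1)
    {j m : ℤ} (hjm : j ≤ m) {g : Space n → ℂ} (hg : IsAtom m g) {B : Set (Space n)}
    (hB : MeasurableSet B) (hB' : volume B ≠ ⊤)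
    (hBj : ∀ x y, dyadicIndex j x = dyadicIndex j y → x ∈ B → y ∈ B)
    (hgB : ∀ y, g y ≠ 0 → y ∈ B) (x : Space n) :
    ‖dyadicExp j (twist T hB hB' (hg.memLp 2)) x‖ₑ ^ 2 ≤
      4 * (2 * (ENNReal.ofReal (2 * n * 5 ^ n * (size m / size j) / size j ^ n) *
          ∫⁻ y in Metric.closedBall x (4 * size j), ‖g y‖ₑ ^ 2) +
        ENNReal.ofReal (2 ^ ((n : ℝ) + γ) * A) ^ 2 *
          ((∫⁻ z, ENNReal.ofReal (avgKernel j x z) *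
              ∫⁻ y, sepKernel γ (size m) j z y * ‖g y‖ₑ) ^ 2 +
            (∫⁻ y, ENNReal.ofReal (avgKernel j x y) *
              (sepMass γ (size m) j y * ‖g y‖ₑ)) ^ 2)) := by
  have hℓ := size_pos j
  have hδ := size_pos m
  have hδℓ := size_le_size hjm
  set q := dyadicIndex j x with hq
  set Q := dyadicCube j q with hQ
  set c := ENNReal.ofReal (2 ^ ((n : ℝ) + γ) * A)
  set v := ENNReal.ofReal ((size j ^ n)⁻¹) with hv
  have hQm : MeasurableSet Q := measurableSet_dyadicCube _ _
  have hQ' : volume Q ≠ ⊤ := by rw [hQ, volume_dyadicCube]; exact ENNReal.ofReal_ne_top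
  have hQj : ∀ y, y ∈ Q ↔ dyadicIndex j y = q := fun y => mem_dyadicCube_iff _ _ _
  have hQB : Q ⊆ B ∨ Disjoint Q B := by
    by_cases hx : x ∈ B
    · exact Or.inl fun y hy => hBj x y ((hQj y).1 hy).symm hx
    · exact Or.inr (Set.disjoint_left.2 fun y hy hyB => hx (hBj y x ((hQj y).1 hy) hyB))
  have hQd : ∀ y y', dyadicIndex m y = dyadicIndex m y' → y ∈ Q → y' ∈ Q := by
    intro y y' h hy
    rw [hQj] at hy ⊢
    rw [← dyadicIndex_congr_of_le hjm h, hy]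
  have hg1 := hg.indicator (N := Qᶜ) fun y y' h hy hy' => hy (hQd y' y h.symm hy')
  have hg2 := hg.indicator hQd
  obtain ⟨a1, ha1, hb1⟩ := hg1.lintegral_apply_le hk hA hγ0 hγ1 hT hT1 q (H := Q) hQm
    fun z hz y hy => ⟨fun _ => (Set.indicator_apply_ne_zero.1 hy).1, fun _ => hz⟩
  obtain ⟨a2, ha2, hb2⟩ := hg2.lintegral_apply_le hk hA hγ0 hγ1 hT hT1 q (H := B \ Q)
    (hB.diff hQm) fun z hz y hy => ⟨fun h => absurd h hz.2,
      fun h => absurd (Set.indicator_apply_ne_zero.1 hy).1 h⟩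
  set I1 := ∫⁻ z, ENNReal.ofReal (avgKernel j x z) *
    ∫⁻ y, sepKernel γ (size m) j z y * ‖g y‖ₑ with hI1
  set I2 := ∫⁻ y, ENNReal.ofReal (avgKernel j x y) * (sepMass γ (size m) j y * ‖g y‖ₑ) with hI2
  have hJ1 : v * ∫⁻ z in Q, ∫⁻ y, ENNReal.ofReal (radial γ (size m) (z - y)) *
      ‖Qᶜ.indicator g y‖ₑ = I1 := by
    rw [hI1, lintegral_avgKernel_mul]
    congr 1
    refine setLIntegral_congr_fun hQm fun z hz => lintegral_congr fun y => ?_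
    by_cases hy : y ∈ Q
    · rw [sepKernel, if_pos (((hQj z).1 hz).trans ((hQj y).1 hy).symm)]
      simp [hy]
    · rw [sepKernel, if_neg fun h => hy ((hQj y).2 (h.symm.trans ((hQj z).1 hz)))]
      simp [hy]
  -- Integrating first over z outside Q leaves at most `sepMass` at each source y in Q.
  have hJ2 : v * ∫⁻ z in B \ Q, ∫⁻ y, ENNReal.ofReal (radial γ (size m) (z - y)) *
      ‖Q.indicator g y‖ₑ ≤ I2 := by
    rw [hI2, lintegral_avgKernel_mul]
    refine mul_le_mul' le_rfl ?_
    have hm : Measurable (Function.uncurry fun z y : Space n =>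
        ENNReal.ofReal (radial γ (size m) (z - y)) * ‖Q.indicator g y‖ₑ) :=
      (measurable_radial_sub γ (size m)).mul (hg2.measurable.enorm.comp measurable_snd)
    rw [lintegral_lintegral_swap hm.aemeasurable, ← lintegral_indicator hQm]
    refine lintegral_mono fun y => ?_
    dsimp only
    rw [lintegral_mul_const _ (measurable_radial_sub γ (size m)).of_uncurry_right]
    by_cases hy : y ∈ Q
    · rw [Set.indicator_of_mem hy, Set.indicator_of_mem hy]
      refine mul_le_mul' ?_ le_rfl
      rw [sepMass, ← lintegral_indicator (hB.diff hQm)]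
      refine lintegral_mono fun z => ?_
      by_cases hz : z ∈ B \ Q
      · rw [Set.indicator_of_mem hz, sepKernel_comm, sepKernel,
          if_neg fun h => hz.2 ((hQj z).2 (h.trans ((hQj y).1 hy)))]
      · rw [Set.indicator_of_notMem hz]
        exact zero_le
    · rw [Set.indicator_of_notMem hy, Set.indicator_of_notMem hy]
      simp
  -- The layer of width 3 size m around the cube of `x` lies within size j + 3 size m ≤ 4 size j of
  -- `x`; the factor size m / size j is the relative volume of the layer.
  have hnear : ∀ {a : ℝ≥0∞} {g' : Space n → ℂ}, (∀ y, ‖g' y‖ₑ ≤ ‖g y‖ₑ) →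
      a ^ 2 ≤ volume (layer j q (2 * size m)) * ∫⁻ y in layer j q (3 * size m), ‖g' y‖ₑ ^ 2 →
      (v * a) ^ 2 ≤ ENNReal.ofReal (2 * n * 5 ^ n * (size m / size j) / size j ^ n) *
        ∫⁻ y in Metric.closedBall x (4 * size j), ‖g y‖ₑ ^ 2 := by
    intro a g' hg' ha
    calc (v * a) ^ 2 ≤ v ^ 2 * (volume (layer j q (2 * size m)) *
          ∫⁻ y in layer j q (3 * size m), ‖g' y‖ₑ ^ 2) := by
          rw [mul_pow]
          exact mul_le_mul' le_rfl ha
      _ ≤ v ^ 2 * (ENNReal.ofReal (n * 5 ^ n * size j ^ n * (2 * size m / size j)) *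
          ∫⁻ y in Metric.closedBall x (4 * size j), ‖g y‖ₑ ^ 2) := by
          refine mul_le_mul' le_rfl (mul_le_mul'
            (volume_layer_le j q (by positivity) (by linarith)) ?_)
          refine (lintegral_mono fun y => pow_le_pow_left' (hg' y) 2).trans
            (lintegral_mono_set fun y hy => ?_)
          rw [Metric.mem_closedBall, dist_eq_norm]
          refine (norm_sub_le_of_mem_layer (by positivity) hy).trans ?_
          linarith
      _ = _ := by
          rw [← mul_assoc, hv, ← ENNReal.ofReal_pow (by positivity),
            ← ENNReal.ofReal_mul (by positivity)]
          congr 2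
          field_simp
  have hexp : ‖dyadicExp j (twist T hB hB' (hg.memLp 2)) x‖ₑ
      ≤ v * a1 + v * a2 + (c * I1 + c * I2) := by
    have e1 : dyadicExp j (twist T hB hB' (hg.memLp 2)) x
        = ((size j ^ n)⁻¹ : ℝ) • ∫ z in Q, twist T hB hB' (hg.memLp 2) z := by
      rw [dyadicExp, setAverage_eq, measureReal_def, volume_dyadicCube,
        ENNReal.toReal_ofReal (by positivity)]
    have e2 : ‖((size j ^ n)⁻¹ : ℝ)‖ₑ = v := by
      rw [← ofReal_norm, Real.norm_of_nonneg (by positivity)]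
    rw [e1, enorm_smul, e2, setIntegral_twist T hB hB' hQm hQ' hQB (hg.memLp 2) hgB]
    have hring : ∀ J1 J2 : ℝ≥0∞, v * ((a1 + c * J1) + (a2 + c * J2))
        = v * a1 + v * a2 + (c * (v * J1) + c * (v * J2)) := fun J1 J2 => by ring
    refine (mul_le_mul' le_rfl (enorm_sub_le.trans (add_le_add
      ((enorm_integral_le_lintegral_enorm _).trans hb1)
      ((enorm_integral_le_lintegral_enorm _).trans hb2)))).trans ?_
    rw [hring]
    exact add_le_add le_rfl (add_le_add (mul_le_mul' le_rfl hJ1.le) (mul_le_mul' le_rfl hJ2))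
  refine (pow_le_pow_left' hexp 2).trans ((add_sq_le_four_mul _ _ _ _).trans ?_)
  refine mul_le_mul' le_rfl (add_le_add ?_ ?_)
  · rw [two_mul]
    exact add_le_add (hnear (fun y => enorm_indicator_le_enorm_self _ _) ha1)
      (hnear (fun y => enorm_indicator_le_enorm_self _ _) ha2)
  · rw [mul_pow, mul_pow, mul_add]

/-- The martingale projections of `twist T g` are small if `g` has cancellation at a finer scale. -/
theorem IsAtom.lintegral_sq_dyadicExp_twist_le (hn : 1 ≤ n) (hk : IsLipschitzKernel γ A k)
    (hγ0 : 0 < γ) (hγ1 : γ ≤ 1) {T : L2 n →L[ℂ] L2 n} (hT : IsAssociated T k) (hT1 : ‖T‖ ≤ 1)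
    {j m : ℤ} (hjm : j ≤ m) {g : Space n → ℂ} (hg : IsAtom m g) {B : Set (Space n)}
    (hB : MeasurableSet B) (hB' : volume B ≠ ⊤)
    (hBj : ∀ x y, dyadicIndex j x = dyadicIndex j y → x ∈ B → y ∈ B)
    (hgB : ∀ y, g y ≠ 0 → y ∈ B) :
    ∫⁻ x, ‖dyadicExp j (twist T hB hB' (hg.memLp 2)) x‖ₑ ^ 2 ≤
      twistConst n γ * ENNReal.ofReal ((size m / size j) ^ (γ / 2) * max 1 A ^ 2) *
        ∫⁻ x, ‖g x‖ₑ ^ 2 := by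
  have hA := hk.nonneg hn
  have hℓ := size_pos j
  have hδ := size_pos m
  have hδℓ := size_le_size hjm
  set G := ∫⁻ x, ‖g x‖ₑ ^ 2 with hG
  set c := ENNReal.ofReal (2 ^ ((n : ℝ) + γ) * A) with hc
  set θ := (size m / size j) ^ (γ / 2) with hθ
  have hθ0 : 0 ≤ θ := by positivity
  have hM : 1 ≤ max 1 A := le_max_left _ _
  set M := ENNReal.ofReal (θ * max 1 A ^ 2) with hMdef
  have hgm := hg.measurable.enorm
  have hm0 : Measurable fun p : (Space n × Space n) =>
      ∫⁻ y, sepKernel γ (size m) j p.2 y * ‖g y‖ₑ := by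
    have : Measurable (Function.uncurry fun z y : Space n =>
      sepKernel γ (size m) j z y * ‖g y‖ₑ) :=
      (measurable_sepKernel γ (size m) j).mul (hgm.comp measurable_snd)
    exact (this.lintegral_prod_right').comp measurable_snd
  have hm1 : Measurable fun x : Space n => (∫⁻ z, ENNReal.ofReal (avgKernel j x z) *
              ∫⁻ y, sepKernel γ (size m) j z y * ‖g y‖ₑ) ^ 2 := by
    have : Measurable (Function.uncurry fun x z : Space n => ENNReal.ofReal (avgKernel j x z) *
              ∫⁻ y, sepKernel γ (size m) j z y * ‖g y‖ₑ) :=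
      (measurable_ofReal_avgKernel j).mul hm0
    exact this.lintegral_prod_right'.pow_const 2
  have hm2 : Measurable fun x : Space n => (∫⁻ y, ENNReal.ofReal (avgKernel j x y) *
              (sepMass γ (size m) j y * ‖g y‖ₑ)) ^ 2 := by
    have : Measurable (Function.uncurry fun x y : Space n => ENNReal.ofReal (avgKernel j x y) *
              (sepMass γ (size m) j y * ‖g y‖ₑ)) :=
      (measurable_ofReal_avgKernel j).mul
        (((measurable_sepMass γ (size m) j).mul hgm).comp measurable_snd)
    exact this.lintegral_prod_right'.pow_const 2
  refine (lintegral_mono fun x => hg.sq_enorm_dyadicExp_twist_le hk hA hγ0 hγ1 hT hT1 hjm hB hB'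
    hBj hgB x).trans ?_
  refine (lintegral_four_mul_add hm1 hm2 ENNReal.ofReal_ne_top
    (ENNReal.pow_ne_top ENNReal.ofReal_ne_top)).le.trans ?_
  rw [lintegral_setLIntegral_closedBall (by positivity) (hgm.pow_const 2)]
  have k1 := lintegral_sq_avg_sep_le hn hγ0 hγ1 hδ j hgm
  have k2 := lintegral_sq_avg_sepMass_le hn hγ0 hγ1 hδ j hgm
  set m1 := radialMass n (γ / 2)
  set m2 := radialMass n γ
  -- The ball of radius 4 size j has volume (8 size j)^n, and 40 = 5·8. The linear gain is weakened
  -- to the power γ/2 of the kernel terms.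
  have b1 : ENNReal.ofReal (2 * n * 5 ^ n * (size m / size j) / size j ^ n) *
      (ENNReal.ofReal ((2 * (4 * size j)) ^ n) * G) ≤ ENNReal.ofReal (2 * n * 40 ^ n) * M * G := by
    rw [← mul_assoc, ← ENNReal.ofReal_mul (by positivity), hMdef,
      ← ENNReal.ofReal_mul (by positivity)]
    refine mul_le_mul' (ENNReal.ofReal_le_ofReal ?_) le_rfl
    have e : 2 * n * 5 ^ n * (size m / size j) / size j ^ n * (2 * (4 * size j)) ^ n
        = 2 * n * 40 ^ n * (size m / size j) := by
      rw [show (2 * (4 * size j)) ^ n = 8 ^ n * size j ^ n by rw [← mul_pow]; ring_nf,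
        show (40 : ℝ) ^ n = 5 ^ n * 8 ^ n by rw [← mul_pow]; norm_num]
      field_simp
    rw [e]
    have h1 : size m / size j ≤ θ :=
      Real.self_le_rpow_of_le_one (by positivity) ((div_le_one hℓ).2 hδℓ) (by linarith)
    have h2 : θ ≤ θ * max 1 A ^ 2 := le_mul_of_one_le_right hθ0 (one_le_pow₀ hM)
    gcongr
    exact h1.trans h2
  have b2 : c ^ 2 * (ENNReal.ofReal (n * 5 ^ n * θ) * m1 * m2 * G +
      ENNReal.ofReal (n * 5 ^ n * θ) * m1 * m2 * G) ≤
      2 * (ENNReal.ofReal (2 ^ ((n : ℝ) + γ)) ^ 2 * (ENNReal.ofReal (n * 5 ^ n) * m1 * m2)) *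
        M * G := by
    have h1 : c ≤ ENNReal.ofReal (2 ^ ((n : ℝ) + γ)) * ENNReal.ofReal (max 1 A) := by
      rw [hc, ← ENNReal.ofReal_mul (by positivity)]
      refine ENNReal.ofReal_le_ofReal ?_
      gcongr
      exact le_max_right _ _
    have h2 : M = ENNReal.ofReal θ * ENNReal.ofReal (max 1 A) ^ 2 := by
      rw [hMdef, ENNReal.ofReal_mul hθ0, ENNReal.ofReal_pow (by positivity)]
    have h3 : ENNReal.ofReal (n * 5 ^ n * θ) = ENNReal.ofReal (n * 5 ^ n) * ENNReal.ofReal θ :=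
      ENNReal.ofReal_mul (by positivity)
    calc _ ≤ (ENNReal.ofReal (2 ^ ((n : ℝ) + γ)) * ENNReal.ofReal (max 1 A)) ^ 2 *
          (ENNReal.ofReal (n * 5 ^ n * θ) * m1 * m2 * G +
            ENNReal.ofReal (n * 5 ^ n * θ) * m1 * m2 * G) := by gcongr
      _ = _ := by
          rw [h2, h3]
          ring
  calc _ ≤ 4 * (2 * (ENNReal.ofReal (2 * n * 40 ^ n) * M * G) +
        2 * (ENNReal.ofReal (2 ^ ((n : ℝ) + γ)) ^ 2 * (ENNReal.ofReal (n * 5 ^ n) * m1 * m2)) *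
        M * G) := by
        refine mul_le_mul' le_rfl (add_le_add (mul_le_mul' le_rfl b1) (le_trans ?_ b2))
        exact mul_le_mul' le_rfl (add_le_add k1 k2)
    _ = _ := by
        rw [twistConst]
        ring

end TwistedBound

/-! ### Almost orthogonality. -/

section AlmostOrthogonal

theorem sum_pow_natAbs_le (s : Finset ℤ) (k : ℤ) {θ : ℝ} (hθ0 : 0 ≤ θ) (hθ1 : θ < 1) :
    ∑ j ∈ s, θ ^ (k - j).natAbs ≤ 2 / (1 - θ) := by
  have hgeo : ∀ t : Finset ℕ, ∑ d ∈ t, θ ^ d ≤ (1 - θ)⁻¹ := fun t => by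
    rw [← tsum_geometric_of_lt_one hθ0 hθ1]
    exact (summable_geometric_of_lt_one hθ0 hθ1).sum_le_tsum t fun d _ => pow_nonneg hθ0 d
  have h1 : ∑ j ∈ s with j ≤ k, θ ^ (k - j).natAbs ≤ (1 - θ)⁻¹ := by
    rw [← Finset.sum_image (f := fun d => θ ^ d) (g := fun j : ℤ => (k - j).natAbs)]
    · exact hgeo _
    · intro a ha b hb hab
      simp only [Finset.coe_filter, Set.mem_ofPred_eq] at ha hb
      dsimp only at hab
      omega
  have h2 : ∑ j ∈ s with ¬ j ≤ k, θ ^ (k - j).natAbs ≤ (1 - θ)⁻¹ := by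
    rw [← Finset.sum_image (f := fun d => θ ^ d) (g := fun j : ℤ => (k - j).natAbs)]
    · exact hgeo _
    · intro a ha b hb hab
      simp only [Finset.coe_filter, Set.mem_ofPred_eq] at ha hb
      dsimp only at hab
      omega
  rw [← Finset.sum_filter_add_sum_filter_not s (fun j => j ≤ k), div_eq_mul_inv, two_mul]
  exact add_le_add h1 h2

/-- Almost orthogonality: vectors whose inner products decay exponentially off the diagonal. -/
theorem sq_norm_sum_le {E : Type*} [NormedAddCommGroup E] [InnerProductSpace ℂ E] (s : Finset ℤ)
    (v : ℤ → E) (a : ℤ → ℝ) {D θ : ℝ} (hD : 0 ≤ D) (hθ0 : 0 ≤ θ) (hθ1 : θ < 1)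
    (h : ∀ k ∈ s, ∀ j ∈ s, j ≤ k → ‖inner ℂ (v k) (v j)‖ ≤ D * θ ^ (k - j).natAbs * (a k * a j)) :
    ‖∑ k ∈ s, v k‖ ^ 2 ≤ D * (2 / (1 - θ)) * ∑ k ∈ s, a k ^ 2 := by
  have h' : ∀ k ∈ s, ∀ j ∈ s,
      ‖inner ℂ (v k) (v j)‖ ≤ D * θ ^ (k - j).natAbs * (a k * a j) := by
    intro k hk j hj
    rcases le_total j k with hjk | hjk
    · exact h k hk j hj hjk
    · rw [norm_inner_symm, mul_comm (a k), ← Int.natAbs_neg, neg_sub]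
      exact h j hj k hk hjk
  have e : ‖∑ k ∈ s, v k‖ ^ 2 = ‖inner ℂ (∑ k ∈ s, v k) (∑ k ∈ s, v k)‖ := by
    rw [inner_self_eq_norm_sq_to_K]
    simp
  rw [e, sum_inner]
  simp_rw [inner_sum]
  calc ‖∑ k ∈ s, ∑ j ∈ s, inner ℂ (v k) (v j)‖
      ≤ ∑ k ∈ s, ∑ j ∈ s, ‖inner ℂ (v k) (v j)‖ :=
        (norm_sum_le _ _).trans (Finset.sum_le_sum fun k _ => norm_sum_le _ _)
    -- The inequality 2ab ≤ a² + b² splits each product; by symmetry both halves reduce to the same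
    -- geometric row sum.
    _ ≤ ∑ k ∈ s, ∑ j ∈ s, (D * θ ^ (k - j).natAbs * (a k ^ 2 / 2)
          + D * θ ^ (j - k).natAbs * (a j ^ 2 / 2)) := by
        refine Finset.sum_le_sum fun k hk => Finset.sum_le_sum fun j hj => (h' k hk j hj).trans ?_
        rw [show (j - k).natAbs = (k - j).natAbs by omega, ← mul_add]
        have := two_mul_le_add_sq (a k) (a j)
        gcongr
        linarith
    _ = ∑ k ∈ s, ∑ j ∈ s, D * θ ^ (k - j).natAbs * a k ^ 2 := by
        simp_rw [Finset.sum_add_distrib]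
        rw [Finset.sum_comm (f := fun k j => D * θ ^ (j - k).natAbs * (a j ^ 2 / 2)),
          ← Finset.sum_add_distrib]
        refine Finset.sum_congr rfl fun k _ => ?_
        rw [← Finset.sum_add_distrib]
        refine Finset.sum_congr rfl fun j _ => ?_
        ring
    _ = ∑ k ∈ s, D * (∑ j ∈ s, θ ^ (k - j).natAbs) * a k ^ 2 := by
        refine Finset.sum_congr rfl fun k _ => ?_
        rw [Finset.mul_sum, Finset.sum_mul]
    _ ≤ ∑ k ∈ s, D * (2 / (1 - θ)) * a k ^ 2 := by
        refine Finset.sum_le_sum fun k _ => ?_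
        have := sum_pow_natAbs_le s k hθ0 hθ1
        gcongr
    _ = _ := by rw [Finset.mul_sum]

end AlmostOrthogonal

/-! ### Conditional expectations as orthogonal projections of L₂. -/

section Projection

variable {n : ℕ}

/-- The conditional expectation `dyadicExp j`, as a map of `L₂`. -/
noncomputable def dyadicProj (j : ℤ) (f : L2 n) : L2 n :=
  (memLp_dyadicExp j (Lp.memLp f)).toLp (dyadicExp j f)

theorem dyadicProj_ae (j : ℤ) (f : L2 n) : dyadicProj j f =ᵐ[volume] dyadicExp j f :=
  MemLp.coeFn_toLp _

theorem dyadicProj_toLp (j : ℤ) {f : Space n → ℂ} (hf : MemLp f 2) :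
    dyadicProj j (hf.toLp f) = (memLp_dyadicExp j hf).toLp (dyadicExp j f) := by
  unfold dyadicProj
  congr 1
  exact dyadicExp_congr_ae j hf.coeFn_toLp

theorem dyadicProj_dyadicProj_of_le {j k : ℤ} (h : j ≤ k) (f : L2 n) :
    dyadicProj j (dyadicProj k f) = dyadicProj j f := by
  conv_lhs => rw [dyadicProj.eq_def k f]
  rw [dyadicProj_toLp, dyadicProj]
  congr 1
  exact dyadicExp_dyadicExp_of_le h fun i => integrableOn_dyadicCube_of_memLp (Lp.memLp f) j i

theorem dyadicProj_dyadicProj_of_ge {j k : ℤ} (h : j ≤ k) (f : L2 n) :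
    dyadicProj k (dyadicProj j f) = dyadicProj j f := by
  conv_lhs => rw [dyadicProj.eq_def j f]
  rw [dyadicProj_toLp, dyadicProj]
  congr 1
  exact dyadicExp_dyadicExp_of_ge h f

theorem inner_dyadicProj (j : ℤ) (f g : L2 n) :
    inner ℂ (dyadicProj j f) g = inner ℂ (dyadicProj j f) (dyadicProj j g) := by
  have hE := memLp_dyadicExp j (Lp.memLp f)
  have hi : Integrable fun x => (starRingEnd ℂ) (dyadicExp j f x) * g x :=
    hE.star.integrable_mul (Lp.memLp g)
  have h1 : inner ℂ (dyadicProj j f) g = ∫ x, (starRingEnd ℂ) (dyadicExp j f x) * g x := by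
    rw [L2.inner_def]
    refine integral_congr_ae ?_
    filter_upwards [dyadicProj_ae j f] with x hx
    rw [hx, RCLike.inner_apply, mul_comm]
  have h2 : inner ℂ (dyadicProj j f) (dyadicProj j g)
      = ∫ x, (starRingEnd ℂ) (dyadicExp j f x) * dyadicExp j g x := by
    rw [L2.inner_def]
    refine integral_congr_ae ?_
    filter_upwards [dyadicProj_ae j f, dyadicProj_ae j g] with x hx hy
    rw [hx, hy, RCLike.inner_apply, mul_comm]
  rw [h1, h2, ← integral_dyadicExp j hi]
  congr with x
  exact dyadicExp_mul_of_const j (u := fun x => (starRingEnd ℂ) (dyadicExp j f x))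
    fun y hy => by rw [dyadicExp_congr_index _ hy]

theorem dyadicProj_inner (j : ℤ) (f g : L2 n) :
    inner ℂ (dyadicProj j f) g = inner ℂ f (dyadicProj j g) := by
  rw [inner_dyadicProj, ← inner_conj_symm f, inner_dyadicProj j g f, inner_conj_symm]

/-- Both factors may be projected to the coarser scale `j`; this is where the decay of coarse
averages enters. -/
theorem inner_dyadicProj_dyadicProj {j k : ℤ} (h : j ≤ k) (f g : L2 n) :
    inner ℂ (dyadicProj k f) (dyadicProj j g) = inner ℂ (dyadicProj j f) (dyadicProj j g) := by
  rw [← dyadicProj_inner, dyadicProj_dyadicProj_of_le h, inner_dyadicProj]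

theorem inner_sub_dyadicProj {j k : ℤ} (h : j ≤ k) (f g : L2 n) :
    inner ℂ (f - dyadicProj k f) (dyadicProj j g) = 0 := by
  rw [inner_sub_left, dyadicProj_inner k, dyadicProj_dyadicProj_of_ge h, sub_self]

/-- Dually, both oscillations may be taken at the finer scale `k`. -/
theorem inner_sub_sub_dyadicProj {j k : ℤ} (h : j ≤ k) (f g : L2 n) :
    inner ℂ (f - dyadicProj k f) (g - dyadicProj j g)
      = inner ℂ (f - dyadicProj k f) (g - dyadicProj k g) := by
  rw [inner_sub_right, inner_sub_right, inner_sub_dyadicProj h, inner_sub_dyadicProj le_rfl]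

theorem norm_sub_dyadicProj_le (j : ℤ) (f : L2 n) : ‖f - dyadicProj j f‖ ≤ ‖f‖ := by
  have h : ‖f - dyadicProj j f‖ ^ 2 ≤ ‖f - dyadicProj j f‖ * ‖f‖ := by
    have e : ((‖f - dyadicProj j f‖ : ℂ)) ^ 2 = inner ℂ (f - dyadicProj j f) f := by
      rw [← sub_zero (inner ℂ (f - dyadicProj j f) f), ← inner_sub_dyadicProj (le_refl j) f f,
        ← inner_sub_right]
      exact (inner_self_eq_norm_sq_to_K (𝕜 := ℂ) (f - dyadicProj j f)).symm
    calc ‖f - dyadicProj j f‖ ^ 2 = ‖((‖f - dyadicProj j f‖ : ℂ)) ^ 2‖ := by simp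
      _ ≤ _ := by rw [e]; exact norm_inner_le_norm _ _
  rcases eq_or_lt_of_le (norm_nonneg (f - dyadicProj j f)) with h0 | h0
  · rw [← h0]; exact norm_nonneg f
  · rw [sq] at h
    exact le_of_mul_le_mul_left h h0

theorem norm_toLp_le {F g : Space n → ℂ} (hF : MemLp F 2) (hg : MemLp g 2) {D : ℝ} (hD : 0 ≤ D)
    (h : ∫⁻ x, ‖F x‖ₑ ^ 2 ≤ ENNReal.ofReal (D ^ 2) * ∫⁻ x, ‖g x‖ₑ ^ 2) :
    ‖hF.toLp F‖ ≤ D * ‖hg.toLp g‖ := by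
  rw [← sq_eLpNorm_two, ← sq_eLpNorm_two, ENNReal.ofReal_pow hD, ← mul_pow] at h
  have h2 := (ENNReal.pow_le_pow_left_iff two_ne_zero).1 h
  rw [Lp.norm_toLp, Lp.norm_toLp, ← ENNReal.toReal_ofReal hD, ← ENNReal.toReal_mul]
  exact ENNReal.toReal_mono (ENNReal.mul_ne_top ENNReal.ofReal_ne_top hg.2.ne) h2

theorem size_div_size {j m : ℤ} (h : j ≤ m) : size m / size j = (1 / 2) ^ (m - j).natAbs := by
  have e : m = j + ((m - j).natAbs : ℤ) := by omega
  have h0 := size_pos j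
  have h1 : size ((m - j).natAbs : ℤ) = (1 / 2) ^ (m - j).natAbs := by
    rw [size, zpow_neg, zpow_natCast, one_div, inv_pow]
  conv_lhs => rw [e, size_add, h1]
  field_simp

theorem size_div_size_rpow {j m : ℤ} (h : j ≤ m) (β : ℝ) :
    (size m / size j) ^ β = (((1 : ℝ) / 2) ^ β) ^ (m - j).natAbs := by
  rw [size_div_size h, ← Real.rpow_natCast, ← Real.rpow_natCast, ← Real.rpow_mul (by norm_num),
    ← Real.rpow_mul (by norm_num), mul_comm]

end Projection

/-! ### The localized estimate for finite sums of atoms. -/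

section FiniteSum

variable {n : ℕ} {γ A : ℝ} {k : Space n → Space n → ℂ}

theorem IsAtom.memLp_twist (T : L2 n →L[ℂ] L2 n) {B : Set (Space n)} (hB : MeasurableSet B)
    (hB' : volume B ≠ ⊤) {m : ℤ} {g : Space n → ℂ} (hg : IsAtom m g) :
    MemLp (twist T hB hB' (hg.memLp 2)) 2 :=
  (Lp.memLp _).sub (MemLp.mul' (p := 2) (q := ⊤) (r := 2) (hg.memLp ⊤) (Lp.memLp _).star)

/-- The decay rate `2 ^ (-γ / 4)`. -/
noncomputable def decay (γ : ℝ) : ℝ := (1 / 2) ^ (γ / 4)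

theorem decay_pos (γ : ℝ) : 0 < decay γ := by unfold decay; positivity

theorem decay_lt_one (hγ : 0 < γ) : decay γ < 1 :=
  Real.rpow_lt_one (by norm_num) (by norm_num) (by positivity)

/-- Square root of `IsAtom.lintegral_sq_dyadicExp_twist_le`; the power γ/2 there becomes γ/4 and
fixes the rate `decay γ`. -/
theorem IsAtom.norm_dyadicProj_twist_le (hn : 1 ≤ n) (hk : IsLipschitzKernel γ A k)
    (hγ0 : 0 < γ) (hγ1 : γ ≤ 1) {T : L2 n →L[ℂ] L2 n} (hT : IsAssociated T k) (hT1 : ‖T‖ ≤ 1)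
    {j m : ℤ} (hjm : j ≤ m) {g : Space n → ℂ} (hg : IsAtom m g) {B : Set (Space n)}
    (hB : MeasurableSet B) (hB' : volume B ≠ ⊤)
    (hBj : ∀ x y, dyadicIndex j x = dyadicIndex j y → x ∈ B → y ∈ B)
    (hgB : ∀ y, g y ≠ 0 → y ∈ B) :
    ‖dyadicProj j ((hg.memLp_twist T hB hB').toLp _)‖ ≤
      √(twistConst n γ).toReal * max 1 A * decay γ ^ (m - j).natAbs *
        ‖(hg.memLp 2).toLp g‖ := by
  rw [dyadicProj_toLp]
  have hM : 0 ≤ max 1 A := zero_le_one.trans (le_max_left _ _)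
  have hd := decay_pos γ
  refine norm_toLp_le _ _ (by positivity) ((hg.lintegral_sq_dyadicExp_twist_le hn hk hγ0 hγ1 hT hT1
    hjm hB hB' hBj hgB).trans_eq ?_)
  have e : ((1 : ℝ) / 2) ^ (γ / 2) = decay γ ^ 2 := by
    rw [decay, ← Real.rpow_natCast, ← Real.rpow_mul (by norm_num)]
    congr 1
    push_cast
    ring
  congr 1
  rw [mul_pow, mul_pow, Real.sq_sqrt ENNReal.toReal_nonneg, mul_assoc,
    ENNReal.ofReal_mul ENNReal.toReal_nonneg,
    ENNReal.ofReal_toReal (twistConst_lt_top n hγ0).ne, mul_comm (max 1 A ^ 2), ← pow_mul,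
    mul_comm _ 2, pow_mul, size_div_size_rpow hjm, e]

/-- The estimates of `tau` gain 2^(-γ) per generation, the fourth power of `decay γ`. They are
weakened to the rate of the twisted part. -/
theorem rpow_le_decay_pow (hγ : 0 < γ) (p d : ℕ) (hp : p ≤ 4) :
    (((1 : ℝ) / 2) ^ γ) ^ d ≤ decay γ ^ (p * d) := by
  rw [pow_mul]
  refine pow_le_pow_left₀ (by positivity) ?_ d
  rw [decay, ← Real.rpow_natCast, ← Real.rpow_mul (by norm_num)]
  refine Real.rpow_le_rpow_of_exponent_ge (by norm_num) (by norm_num) ?_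
  have : (p : ℝ) ≤ 4 := by exact_mod_cast hp
  nlinarith

/-- The constant in the estimates of `tau`. -/
noncomputable def tauConst (n : ℕ) (γ : ℝ) : ℝ :=
  2 * 6 ^ ((n : ℝ) + γ) * (radialMass n γ).toReal

theorem tauConst_nonneg (n : ℕ) (γ : ℝ) : 0 ≤ tauConst n γ := by
  have : 0 ≤ (radialMass n γ).toReal := ENNReal.toReal_nonneg
  unfold tauConst
  positivity

theorem sq_ofReal_mul_radialMass (hγ0 : 0 < γ) (hA : 0 ≤ A) {t : ℝ} (ht : 0 ≤ t) :
    (ENNReal.ofReal (2 * 6 ^ ((n : ℝ) + γ) * A * t) * radialMass n γ) ^ 2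
      = ENNReal.ofReal ((tauConst n γ * A * t) ^ 2) := by
  have h0 : 0 ≤ (radialMass n γ).toReal := ENNReal.toReal_nonneg
  rw [← ENNReal.ofReal_toReal (radialMass_lt_top (n := n) hγ0).ne,
    ← ENNReal.ofReal_mul (by positivity), ← ENNReal.ofReal_pow (by positivity), tauConst]
  congr 2
  ring

theorem IsAtom.norm_tau_le (hk : IsLipschitzKernel γ A k) (hA : 0 ≤ A) (hγ0 : 0 < γ)
    (hγ1 : γ ≤ 1) {m j : ℤ} {g : Space n → ℂ} (hg : IsAtom m g) (hj : j ≤ m) :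
    ‖(hg.memLp_tau hk hA hγ0 hγ1 (size_le_size hj)).toLp _‖ ≤
      tauConst n γ * A * decay γ ^ (2 * (m - j).natAbs) * ‖(hg.memLp 2).toLp g‖ := by
  have h0 := tauConst_nonneg n γ
  have hm := size_pos m
  have hj0 := size_pos j
  refine (norm_toLp_le _ (hg.memLp 2) (D := tauConst n γ * A * (size m / size j) ^ γ)
    (by positivity) ?_).trans ?_
  · rw [← sq_ofReal_mul_radialMass hγ0 hA (by positivity)]
    exact hg.lintegral_sq_tau_le hk hA hγ0 hγ1 (size_le_size hj)
  · rw [size_div_size_rpow hj]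
    gcongr
    exact rpow_le_decay_pow hγ0 2 _ (by norm_num)

theorem IsAtom.norm_tau_sub_le (hk : IsLipschitzKernel γ A k) (hA : 0 ≤ A) (hγ0 : 0 < γ)
    (hγ1 : γ ≤ 1) {m j : ℤ} {g : Space n → ℂ} (hg : IsAtom m g) (hj : j ≤ m) {i : ℤ}
    (hi : j ≤ i) :
    ‖(hg.memLp_tau hk hA hγ0 hγ1 (size_le_size hj)).toLp _ -
      dyadicProj i ((hg.memLp_tau hk hA hγ0 hγ1 (size_le_size hj)).toLp _)‖ ≤
      tauConst n γ * A * decay γ ^ (i - j).natAbs * ‖(hg.memLp 2).toLp g‖ := by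
  have h0 := tauConst_nonneg n γ
  have hi0 := size_pos i
  have hj0 := size_pos j
  rw [dyadicProj_toLp, ← MemLp.toLp_sub]
  refine (norm_toLp_le _ (hg.memLp 2) (D := tauConst n γ * A * (size i / size j) ^ γ)
    (by positivity) ?_).trans ?_
  · rw [← sq_ofReal_mul_radialMass hγ0 hA (by positivity)]
    exact hg.lintegral_sq_tau_sub_le hk hA hγ0 hγ1 (size_le_size hj) (size_le_size hi)
  · rw [size_div_size_rpow hi]
    have := rpow_le_decay_pow hγ0 1 (i - j).natAbs (by norm_num)
    rw [one_mul] at this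
    gcongr

/-- Far from the support of `g`, `T g` splits into a martingale part and an oscillation part. -/
theorem IsAtom.ae_apply_eq (hk : IsLipschitzKernel γ A k) (hA : 0 ≤ A) (hγ0 : 0 < γ)
    (hγ1 : γ ≤ 1) {T : L2 n →L[ℂ] L2 n} (hT : IsAssociated T k) {j m : ℤ} (hj : j ≤ m)
    {g : Space n → ℂ} (hg : IsAtom m g) {B : Set (Space n)}
    (hB : MeasurableSet B) (hB' : volume B ≠ ⊤) :
    ∀ᵐ x, (∀ y, g y ≠ 0 → 5 * size j ≤ ‖x - y‖) →
      T ((hg.memLp 2).toLp g) x = dyadicProj j ((hg.memLp_twist T hB hB').toLp _) x +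
        ((hg.memLp_tau hk hA hγ0 hγ1 (size_le_size hj)).toLp _ -
          dyadicProj j ((hg.memLp_tau hk hA hγ0 hγ1 (size_le_size hj)).toLp _) : L2 n) x := by
  have hR := size_pos j
  obtain ⟨C, hC⟩ := hg.supp
  have hrep := ae_eq_integral_trunc hk hA hγ0 hγ1 hT (hg.memLp 2) hC hR
  set τ := (hg.memLp_tau hk hA hγ0 hγ1 (size_le_size hj)).toLp _
  have h1 := dyadicProj_ae j ((hg.memLp_twist T hB hB').toLp _)
  have h2 := Lp.coeFn_sub τ (dyadicProj j τ)
  have h3 := dyadicProj_ae j τ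
  rw [dyadicExp_congr_ae j (MemLp.coeFn_toLp _)] at h1 h3
  have h4 : τ =ᵐ[volume] _ := MemLp.coeFn_toLp _
  filter_upwards [hrep, h1, h2, h3, h4] with x r1 r2 r3 r4 r5 hx
  rw [r2, r3, Pi.sub_apply, r4, r5, r1 fun y hy => by linarith [hx y hy]]
  -- The cube of `x` keeps distance 5 size j - size j = 4 size j from where g ≠ 0. On it `T g` is
  -- `tau` and `g` vanishes, so the correction b̄ g has no effect.
  have : dyadicExp j (twist T hB hB' (hg.memLp 2)) x = dyadicExp j (tau k (size j) g) x := by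
    rw [dyadicExp_eq_integral, dyadicExp_eq_integral]
    refine integral_congr_ae ?_
    filter_upwards [hrep] with z hz
    by_cases hzx : dyadicIndex j x = dyadicIndex j z
    · have hz4 : ∀ y, g y ≠ 0 → 4 * size j ≤ ‖z - y‖ := by
        intro y hy
        have a1 := hx y hy
        have a2 := norm_sub_le_size hzx
        have a3 := norm_sub_le_norm_sub_add_norm_sub x z y
        linarith
      have hgz : g z = 0 := by
        by_contra h
        have := hz4 z h
        simp only [sub_self, norm_zero] at this
        linarith
      rw [twist, hz hz4, hgz, mul_zero, sub_zero, tau]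
    · rw [avgKernel_eq, if_neg hzx]
      simp
  rw [this, tau]
  ring

/-- The constant in the localized estimate. -/
noncomputable def locConst (n : ℕ) (γ : ℝ) : ℝ :=
  (√(twistConst n γ).toReal + tauConst n γ) * √(2 / (1 - decay γ))

theorem locConst_nonneg (n : ℕ) (γ : ℝ) : 0 ≤ locConst n γ := by
  have := tauConst_nonneg n γ
  unfold locConst
  positivity

theorem norm_sum_le_of_inner_le {E : Type*} [NormedAddCommGroup E] [InnerProductSpace ℂ E]
    (s : Finset ℤ) (v : ℤ → E) (a : ℤ → ℝ) {D θ : ℝ} (hD : 0 ≤ D) (hθ0 : 0 ≤ θ) (hθ1 : θ < 1)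
    (h : ∀ k ∈ s, ∀ j ∈ s, j ≤ k →
      ‖inner ℂ (v k) (v j)‖ ≤ D ^ 2 * θ ^ (k - j).natAbs * (a k * a j)) :
    ‖∑ k ∈ s, v k‖ ≤ D * √(2 / (1 - θ)) * √(∑ k ∈ s, a k ^ 2) := by
  have h1 := sq_norm_sum_le s v a (sq_nonneg D) hθ0 hθ1 h
  have hS : 0 ≤ ∑ k ∈ s, a k ^ 2 := Finset.sum_nonneg fun _ _ => sq_nonneg _
  have hθ : 0 ≤ 2 / (1 - θ) := div_nonneg zero_le_two (by linarith)
  refine (pow_le_pow_iff_left₀ (norm_nonneg _) (by positivity) two_ne_zero).1 (h1.trans_eq ?_)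
  rw [mul_pow, mul_pow, Real.sq_sqrt hS, Real.sq_sqrt hθ]

theorem sq_enorm_l2 (u : L2 n) : ∫⁻ x, ‖u x‖ₑ ^ 2 = ENNReal.ofReal (‖u‖ ^ 2) := by
  rw [← sq_eLpNorm_two, ENNReal.ofReal_pow (norm_nonneg _), ofReal_norm, Lp.enorm_def]

/-- Localized estimate for finite sums of functions with cancellation at consecutive scales. -/
theorem setLIntegral_sq_sum_le (hn : 1 ≤ n) (hk : IsLipschitzKernel γ A k)
    (hγ0 : 0 < γ) (hγ1 : γ ≤ 1) {T : L2 n →L[ℂ] L2 n} (hT : IsAssociated T k) (hT1 : ‖T‖ ≤ 1)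
    (t : ℕ) {g : ℤ → Space n → ℂ} (hg : ∀ i : ℤ, IsAtom (i + t) (g i)) (s : Finset ℤ)
    {B : Set (Space n)} (hB : MeasurableSet B) (hB' : volume B ≠ ⊤)
    (hBs : ∀ i ∈ s, ∀ x y, dyadicIndex i x = dyadicIndex i y → x ∈ B → y ∈ B)
    (hgB : ∀ i y, g i y ≠ 0 → y ∈ B) {Ω : Set (Space n)} (hΩ : MeasurableSet Ω)
    (hfar : ∀ x ∈ Ω, ∀ i ∈ s, ∀ y, g i y ≠ 0 → 5 * size i ≤ ‖x - y‖) :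
    ∫⁻ x in Ω, ‖T (∑ i ∈ s, ((hg i).memLp 2).toLp (g i)) x‖ₑ ^ 2 ≤
      ENNReal.ofReal ((locConst n γ * max 1 A * decay γ ^ t *
        √(∑ i ∈ s, ‖((hg i).memLp 2).toLp (g i)‖ ^ 2)) ^ 2) := by
  have hA := hk.nonneg hn
  have hρ0 := (decay_pos γ).le
  have hρ1 := decay_lt_one hγ0
  have hM : 0 ≤ max 1 A := zero_le_one.trans (le_max_left _ _)
  have ht : ∀ i : ℤ, i ≤ i + t := fun i => by omega
  set G : ℤ → L2 n := fun i => ((hg i).memLp 2).toLp (g i)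
  set a : ℤ → L2 n := fun i => ((hg i).memLp_twist T hB hB').toLp _
  set b : ℤ → L2 n := fun i => ((hg i).memLp_tau hk hA hγ0 hγ1 (size_le_size (ht i))).toLp _
  set v : ℤ → L2 n := fun i => dyadicProj i (a i) with hv
  set w : ℤ → L2 n := fun i => b i - dyadicProj i (b i) with hw
  have hae : ∀ s' ⊆ s, ∀ᵐ x, x ∈ Ω → T (∑ i ∈ s', G i) x = (∑ i ∈ s', (v i + w i) : L2 n) x := by
    intro s'
    induction s' using Finset.induction_on with
    | empty =>
      intro _
      refine Filter.Eventually.of_forall fun x _ => ?_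
      rw [Finset.sum_empty, Finset.sum_empty, map_zero]
    | insert i s' hi ih =>
      intro hs'
      have his : i ∈ s := hs' (Finset.mem_insert_self i s')
      rw [Finset.sum_insert hi, Finset.sum_insert hi, map_add]
      filter_upwards [ih fun j hj => hs' (Finset.mem_insert_of_mem hj),
        (hg i).ae_apply_eq hk hA hγ0 hγ1 hT (ht i) hB hB',
        Lp.coeFn_add (T (G i)) (T (∑ i ∈ s', G i)),
        Lp.coeFn_add (v i + w i) (∑ i ∈ s', (v i + w i)),
        Lp.coeFn_add (v i) (w i)] with x h1 h2 h3 h4 h5 hx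
      rw [h3, h4, Pi.add_apply, Pi.add_apply, h5, Pi.add_apply, h1 hx]
      congr 1
      exact h2 (hfar x hx i his)
  -- For j ≤ i the atom of index i is t + (i - j) generations finer than j, the atom of index j only
  -- t; the product of the two bounds is ρ^(2t) ρ^(i-j) with ρ = `decay γ`.
  have hvn : ‖∑ i ∈ s, v i‖ ≤ √(twistConst n γ).toReal * max 1 A * decay γ ^ t *
      √(2 / (1 - decay γ)) * √(∑ i ∈ s, ‖G i‖ ^ 2) := by
    refine norm_sum_le_of_inner_le s v _ (by positivity) hρ0 hρ1 fun i hi j hj hji => ?_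
    rw [hv, inner_dyadicProj_dyadicProj hji]
    refine (norm_inner_le_norm _ _).trans ?_
    have e1 := (hg i).norm_dyadicProj_twist_le hn hk hγ0 hγ1 hT hT1 (hji.trans (ht i)) hB hB'
      (hBs j hj) (hgB i)
    have e2 := (hg j).norm_dyadicProj_twist_le hn hk hγ0 hγ1 hT hT1 (ht j) hB hB'
      (hBs j hj) (hgB j)
    rw [show (i + t - j).natAbs = t + (i - j).natAbs by omega, pow_add] at e1
    rw [show (j + t - j).natAbs = t by omega] at e2
    refine (mul_le_mul e1 e2 (norm_nonneg _) (by positivity)).trans_eq ?_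
    ring
  -- The first factor supplies ρ^(2t) by the cancellation of the atom, the second ρ^(i-j) by
  -- regularity in x. The gain in t is not available from the second factor, which is why the first
  -- is taken with exponent 2t.
  have hwn : ‖∑ i ∈ s, w i‖ ≤ tauConst n γ * max 1 A * decay γ ^ t *
      √(2 / (1 - decay γ)) * √(∑ i ∈ s, ‖G i‖ ^ 2) := by
    have h0 := tauConst_nonneg n γ
    refine norm_sum_le_of_inner_le s w _ (by positivity) hρ0 hρ1 fun i hi j hj hji => ?_
    rw [hw, inner_sub_sub_dyadicProj hji]
    refine (norm_inner_le_norm _ _).trans ?_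
    have e1 := (norm_sub_dyadicProj_le i (b i)).trans
      ((hg i).norm_tau_le hk hA hγ0 hγ1 (ht i))
    have e2 := (hg j).norm_tau_sub_le hk hA hγ0 hγ1 (ht j) hji
    rw [show (i + t - i).natAbs = t by omega] at e1
    refine (mul_le_mul e1 e2 (norm_nonneg _) (by positivity)).trans ?_
    have hAM : A ≤ max 1 A := le_max_right _ _
    calc _ = (tauConst n γ * A * decay γ ^ t) ^ 2 * decay γ ^ (i - j).natAbs *
          (‖G i‖ * ‖G j‖) := by ring
      _ ≤ _ := by gcongr
  have hsum : ‖∑ i ∈ s, (v i + w i)‖ ≤ locConst n γ * max 1 A * decay γ ^ t *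
        √(∑ i ∈ s, ‖G i‖ ^ 2) := by
    rw [Finset.sum_add_distrib]
    refine (norm_add_le _ _).trans ((add_le_add hvn hwn).trans_eq ?_)
    rw [locConst]
    ring
  calc ∫⁻ x in Ω, ‖T (∑ i ∈ s, G i) x‖ₑ ^ 2
      = ∫⁻ x in Ω, ‖(∑ i ∈ s, (v i + w i) : L2 n) x‖ₑ ^ 2 := by
        refine lintegral_congr_ae ((ae_restrict_iff' hΩ).2 ?_)
        filter_upwards [hae s subset_rfl] with x hx hxΩ
        rw [hx hxΩ]
    _ ≤ ∫⁻ x, ‖(∑ i ∈ s, (v i + w i) : L2 n) x‖ₑ ^ 2 := setLIntegral_le_lintegral _ _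
    _ ≤ _ := by
        rw [sq_enorm_l2]
        exact ENNReal.ofReal_le_ofReal (pow_le_pow_left₀ (norm_nonneg _) hsum 2)

end FiniteSum

/-! ### Convergence of the truncated martingale. -/

section Density

variable {n : ℕ}

theorem size_neg_natCast (p : ℕ) : size (-(p : ℤ)) = 2 ^ p := by
  rw [size, neg_neg, zpow_natCast]

theorem size_natCast (p : ℕ) : size (p : ℤ) = (1 / 2) ^ p := by
  rw [size, zpow_neg, zpow_natCast, one_div, inv_pow]

/-- The cube `[-2 ^ p, 2 ^ p) ^ n`, a union of dyadic cubes of generation `-p`. -/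
def bigBox (n : ℕ) (p : ℕ) : Set (Space n) :=
  {x | ∀ i, dyadicIndex (-(p : ℤ)) x i = -1 ∨ dyadicIndex (-(p : ℤ)) x i = 0}

theorem mem_bigBox_of_dyadicIndex {p : ℕ} {j : ℤ} (hj : -(p : ℤ) ≤ j) (x y : Space n)
    (h : dyadicIndex j x = dyadicIndex j y) (hx : x ∈ bigBox n p) : y ∈ bigBox n p := by
  intro i
  rw [← dyadicIndex_congr_of_le hj h]
  exact hx i

theorem measurableSet_bigBox (p : ℕ) : MeasurableSet (bigBox n p) :=
  measurableSet_of_dyadic fun x y => mem_bigBox_of_dyadicIndex le_rfl x y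

theorem norm_le_of_mem_bigBox {p : ℕ} {x : Space n} (hx : x ∈ bigBox n p) : ‖x‖ ≤ 2 ^ p := by
  refine (pi_norm_le_iff_of_nonneg (by positivity)).2 fun i => ?_
  have h1 := mem_dyadicCube_dyadicIndex (-(p : ℤ)) x i
  rw [size_neg_natCast, Set.mem_Ico] at h1
  have h2 : (0 : ℝ) < 2 ^ p := by positivity
  rw [Real.norm_eq_abs, abs_le]
  rcases hx i with h | h <;> rw [h] at h1 <;> push_cast at h1 <;> constructor <;> linarith

theorem mem_bigBox_of_norm_lt {p : ℕ} {x : Space n} (hx : ‖x‖ < 2 ^ p) : x ∈ bigBox n p := by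
  intro i
  have h1 : |x i| < 2 ^ p := (norm_le_pi_norm x i).trans_lt hx
  rw [abs_lt] at h1
  have h2 : (0 : ℝ) < 2 ^ p := by positivity
  have h3 : -1 ≤ dyadicIndex (-(p : ℤ)) x i := by
    rw [dyadicIndex, size_neg_natCast, Int.le_floor, le_div_iff₀ h2]
    push_cast
    linarith
  have h4 : dyadicIndex (-(p : ℤ)) x i < 1 := by
    rw [dyadicIndex, size_neg_natCast, Int.floor_lt, div_lt_iff₀ h2]
    push_cast
    linarith
  omega

theorem volume_bigBox_ne_top (p : ℕ) : volume (bigBox n p) ≠ ⊤ := by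
  refine ((measure_mono (t := Metric.closedBall 0 (2 ^ p)) fun x hx => ?_).trans_lt
    measure_closedBall_lt_top).ne
  simpa using norm_le_of_mem_bigBox hx

theorem tendsto_eLpNorm_dyadicExp_sub {φ : Space n → ℂ} (hφ : Continuous φ)
    (hc : HasCompactSupport φ) :
    Filter.Tendsto (fun M : ℕ => eLpNorm (dyadicExp (M : ℤ) φ - φ) 2 volume) Filter.atTop
      (nhds 0) := by
  obtain ⟨r, hr⟩ := isBounded_iff_forall_norm_le.1 hc.isCompact.isBounded
  set s : Set (Space n) := Metric.closedBall 0 (r + 1)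
  have hvol : volume s ^ (1 / (2 : ℝ≥0∞).toReal) ≠ ⊤ :=
    ENNReal.rpow_ne_top_of_nonneg (by positivity) measure_closedBall_lt_top.ne
  have huc := hc.uniformContinuous_of_continuous hφ
  have hsmall : ∀ ε > 0, ∀ᶠ M : ℕ in Filter.atTop, size (M : ℤ) < ε := by
    intro ε hε
    have h := tendsto_pow_atTop_nhds_zero_of_lt_one (r := (1 / 2 : ℝ)) (by norm_num) (by norm_num)
    filter_upwards [h.eventually (gt_mem_nhds hε)] with M hM
    rwa [size_natCast]
  have hmem : ∀ i : ℤ, ∀ j, IntegrableOn φ (dyadicCube i j) := fun i j =>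
    (hφ.integrable_of_hasCompactSupport hc).integrableOn
  have key : ∀ ε > 0, ∀ᶠ M : ℕ in Filter.atTop, eLpNorm (dyadicExp (M : ℤ) φ - φ) 2 volume ≤
      ENNReal.ofReal ε * volume s ^ (1 / (2 : ℝ≥0∞).toReal) := by
    intro ε hε
    obtain ⟨δ, hδ, hδ'⟩ := Metric.uniformContinuous_iff.1 huc ε hε
    filter_upwards [hsmall δ hδ, hsmall 1 one_pos] with M hM1 hM2
    refine eLpNorm_sub_le_of_dist_bdd volume ENNReal.ofNat_ne_top measurableSet_closedBall hε.le
      (fun x => ?_) (fun x hx => ?_) (fun x hx => ?_)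
    · rw [dist_comm, dist_eq_norm, ← ENNReal.ofReal_le_ofReal_iff hε.le, ofReal_norm]
      refine enorm_sub_dyadicExp_le _ (hmem _ _) fun y hy => enorm_le_ofReal ?_
      rw [← dist_eq_norm]
      refine (hδ' ?_).le
      rw [dist_eq_norm]
      exact (norm_sub_le_size hy.symm).trans_lt hM1
    · by_contra hxs
      refine hx ?_
      rw [dyadicExp_of_const]
      · by_contra h
        have := hr x (subset_tsupport _ h)
        simp only [Metric.mem_closedBall, dist_zero_right] at hxs
        linarith
      · intro y hy
        have h1 := norm_sub_le_size hy
        simp only [Metric.mem_closedBall, dist_zero_right, not_le] at hxs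
        have h0 : ∀ z : Space n, r < ‖z‖ → φ z = 0 := by
          intro z hz
          by_contra h
          exact absurd (hr z (subset_tsupport _ h)) (not_le.2 hz)
        rw [h0 x (by linarith), h0 y]
        have := norm_sub_norm_le x y
        rw [norm_sub_rev] at this
        linarith
    · have := hr x (subset_tsupport _ hx)
      simp only [Metric.mem_closedBall, dist_zero_right]
      linarith
  rw [ENNReal.tendsto_nhds_zero]
  intro η hη
  obtain ⟨ε, hε, hεη⟩ : ∃ ε : ℝ, 0 < ε ∧
      ENNReal.ofReal ε * volume s ^ (1 / (2 : ℝ≥0∞).toReal) ≤ η := by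
    have h1 : Filter.Tendsto (fun ε : ℝ => ENNReal.ofReal ε *
        volume s ^ (1 / (2 : ℝ≥0∞).toReal)) (nhdsWithin 0 (Set.Ioi 0)) (nhds 0) := by
      have h2 := ENNReal.Tendsto.mul_const (ENNReal.tendsto_ofReal
        (Filter.tendsto_id.mono_left nhdsWithin_le_nhds :
          Filter.Tendsto (id : ℝ → ℝ) (nhdsWithin 0 (Set.Ioi 0)) (nhds 0))) (Or.inr hvol)
      simpa using h2
    obtain ⟨ε, h3, h4⟩ := ((ENNReal.tendsto_nhds_zero.1 h1 η hη).and self_mem_nhdsWithin).exists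
    exact ⟨ε, h4, h3⟩
  filter_upwards [key ε hε] with M hM
  exact hM.trans hεη

/-- Interpolates between the sup bound by the L₁ norm over the cube volume and the L₁ contraction.
-/
theorem lintegral_sq_dyadicExp_le_mul (j : ℤ) {φ : Space n → ℂ} (hφ : Measurable φ) :
    ∫⁻ x, ‖dyadicExp j φ x‖ₑ ^ 2 ≤
      ENNReal.ofReal ((size j ^ n)⁻¹) * (∫⁻ x, ‖φ x‖ₑ) ^ 2 := by
  have hm : Measurable (Function.uncurry fun x y : Space n =>
      ENNReal.ofReal (avgKernel j x y) * ‖φ y‖ₑ) :=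
    (measurable_ofReal_avgKernel j).mul (hφ.enorm.comp measurable_snd)
  have h1 : ∀ x, ‖dyadicExp j φ x‖ₑ ≤ ENNReal.ofReal ((size j ^ n)⁻¹) * ∫⁻ x, ‖φ x‖ₑ := by
    intro x
    refine (enorm_dyadicExp_le j φ x).trans ?_
    rw [lintegral_avgKernel_mul]
    exact mul_le_mul' le_rfl (setLIntegral_le_lintegral _ _)
  calc ∫⁻ x, ‖dyadicExp j φ x‖ₑ ^ 2
      ≤ ∫⁻ x, (ENNReal.ofReal ((size j ^ n)⁻¹) * ∫⁻ x, ‖φ x‖ₑ) *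
          ∫⁻ y, ENNReal.ofReal (avgKernel j x y) * ‖φ y‖ₑ := by
        refine lintegral_mono fun x => ?_
        rw [sq]
        exact mul_le_mul' (h1 x) (enorm_dyadicExp_le j φ x)
    _ = (ENNReal.ofReal ((size j ^ n)⁻¹) * ∫⁻ x, ‖φ x‖ₑ) * ∫⁻ x, ‖φ x‖ₑ := by
        have hm' : Measurable fun x : Space n =>
            ∫⁻ y, ENNReal.ofReal (avgKernel j x y) * ‖φ y‖ₑ := hm.lintegral_prod_right'
        rw [lintegral_const_mul _ hm', lintegral_lintegral_swap hm.aemeasurable]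
        congr 1
        refine lintegral_congr fun y => ?_
        rw [lintegral_mul_const _ (measurable_ofReal_avgKernel j).of_uncurry_right]
        simp_rw [avgKernel_comm j _ y]
        rw [lintegral_avgKernel, one_mul]
    _ = _ := by ring

theorem tendsto_eLpNorm_dyadicExp_neg (hn : 1 ≤ n) {φ : Space n → ℂ} (hφ : Measurable φ)
    (hi : Integrable φ) :
    Filter.Tendsto (fun M : ℕ => eLpNorm (dyadicExp (-(M : ℤ)) φ) 2 volume) Filter.atTop
      (nhds 0) := by
  have h0 : Filter.Tendsto (fun M : ℕ => ENNReal.ofReal ((1 / 2 : ℝ) ^ M) *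
      (∫⁻ x, ‖φ x‖ₑ) ^ 2) Filter.atTop (nhds 0) := by
    have h := ENNReal.Tendsto.mul_const (ENNReal.tendsto_ofReal
      (tendsto_pow_atTop_nhds_zero_of_lt_one (r := (1 / 2 : ℝ)) (by norm_num) (by norm_num)))
      (Or.inr (ENNReal.pow_ne_top (n := 2) hi.2.ne))
    simpa using h
  have h1 : Filter.Tendsto (fun M : ℕ => eLpNorm (dyadicExp (-(M : ℤ)) φ) 2 volume ^ 2)
      Filter.atTop (nhds 0) := by
    refine tendsto_of_tendsto_of_tendsto_of_le_of_le tendsto_const_nhds h0 (fun _ => zero_le)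
      fun M => ?_
    dsimp only
    rw [sq_eLpNorm_two]
    refine (lintegral_sq_dyadicExp_le_mul _ hφ).trans (mul_le_mul' (ENNReal.ofReal_le_ofReal ?_)
      le_rfl)
    rw [size_neg_natCast, one_div, inv_pow]
    refine inv_anti₀ (by positivity) ?_
    exact le_self_pow₀ (one_le_pow₀ one_le_two) (by omega)
  have h2 := (ENNReal.continuous_rpow_const (y := 1 / 2)).tendsto 0 |>.comp h1
  simp only [one_div, Function.comp_def, ENNReal.zero_rpow_of_pos (by norm_num : (0 : ℝ) < 2⁻¹)]
    at h2
  refine h2.congr fun M => ?_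
  rw [← ENNReal.rpow_natCast, ← ENNReal.rpow_mul]
  norm_num

/-- The truncated martingale approximation of `f`. -/
noncomputable def truncMart (t M : ℕ) (f : Space n → ℂ) : Space n → ℂ :=
  (bigBox n (M + t + 1)).indicator fun x => dyadicExp (M : ℤ) f x - dyadicExp (-(M : ℤ)) f x

theorem measurable_truncMart (t M : ℕ) (f : Space n → ℂ) : Measurable (truncMart t M f) :=
  ((measurable_dyadicExp _ f).sub (measurable_dyadicExp _ f)).indicator (measurableSet_bigBox _)

theorem eLpNorm_dyadicExp_le (j : ℤ) {f : Space n → ℂ} (hf : MemLp f 2) :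
    eLpNorm (dyadicExp j f) 2 volume ≤ eLpNorm f 2 volume := by
  rw [← ENNReal.pow_le_pow_left_iff two_ne_zero, sq_eLpNorm_two, sq_eLpNorm_two]
  exact lintegral_sq_dyadicExp_le j hf.1

theorem eLpNorm_truncMart_le (t M : ℕ) {f : Space n → ℂ} (hf : MemLp f 2) :
    eLpNorm (truncMart t M f) 2 volume ≤ 2 * eLpNorm f 2 volume := by
  refine (eLpNorm_indicator_le _).trans ?_
  refine (eLpNorm_sub_le (memLp_dyadicExp _ hf).1 (memLp_dyadicExp _ hf).1 one_le_two).trans ?_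
  rw [two_mul]
  exact add_le_add (eLpNorm_dyadicExp_le _ hf) (eLpNorm_dyadicExp_le _ hf)

theorem memLp_truncMart (t M : ℕ) {f : Space n → ℂ} (hf : MemLp f 2) :
    MemLp (truncMart t M f) 2 :=
  ((memLp_dyadicExp _ hf).sub (memLp_dyadicExp _ hf)).indicator (measurableSet_bigBox _)

theorem truncMart_sub (t M : ℕ) {f g : Space n → ℂ} (hf : MemLp f 2) (hg : MemLp g 2) :
    truncMart t M (f - g) = truncMart t M f - truncMart t M g := by
  have h : ∀ j : ℤ, dyadicExp j (f - g) = fun x => dyadicExp j f x - dyadicExp j g x := fun j =>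
    dyadicExp_sub j (integrableOn_dyadicCube_of_memLp hf j) (integrableOn_dyadicCube_of_memLp hg j)
  funext x
  by_cases hx : x ∈ bigBox n (M + t + 1)
  · simp only [truncMart, h, Pi.sub_apply, Set.indicator_of_mem hx]
    ring
  · simp only [truncMart, Pi.sub_apply, Set.indicator_of_notMem hx, sub_zero]

theorem tendsto_eLpNorm_truncMart_of_continuous (hn : 1 ≤ n) (t : ℕ) {φ : Space n → ℂ}
    (hφ : Continuous φ) (hc : HasCompactSupport φ) :
    Filter.Tendsto (fun M : ℕ => eLpNorm (truncMart t M φ - φ) 2 volume) Filter.atTop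
      (nhds 0) := by
  obtain ⟨r, hr⟩ := isBounded_iff_forall_norm_le.1 hc.isCompact.isBounded
  have h1 := (tendsto_eLpNorm_dyadicExp_sub hφ hc).add (tendsto_eLpNorm_dyadicExp_neg hn
    hφ.measurable (hφ.integrable_of_hasCompactSupport hc))
  rw [add_zero] at h1
  refine tendsto_of_tendsto_of_tendsto_of_le_of_le' tendsto_const_nhds h1
    (Filter.Eventually.of_forall fun _ => zero_le) ?_
  have hbig : ∀ᶠ M : ℕ in Filter.atTop, r < (2 : ℝ) ^ M :=
    (tendsto_pow_atTop_atTop_of_one_lt one_lt_two).eventually_gt_atTop r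
  filter_upwards [hbig] with M hM
  have e : truncMart t M φ - φ = (bigBox n (M + t + 1)).indicator
      ((dyadicExp (M : ℤ) φ - φ) - dyadicExp (-(M : ℤ)) φ) := by
    funext x
    by_cases hx : x ∈ bigBox n (M + t + 1)
    · simp only [truncMart, Pi.sub_apply, Set.indicator_of_mem hx]
      ring
    · have : φ x = 0 := by
        by_contra h
        refine hx (mem_bigBox_of_norm_lt ((hr x (subset_tsupport _ h)).trans_lt (hM.trans_le ?_)))
        exact pow_le_pow_right₀ one_le_two (by omega)
      simp only [truncMart, Pi.sub_apply, Set.indicator_of_notMem hx, this, sub_zero]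
  rw [e]
  refine (eLpNorm_indicator_le _).trans (eLpNorm_sub_le ?_ ?_ one_le_two)
  · exact (measurable_dyadicExp _ φ).aestronglyMeasurable.sub hφ.aestronglyMeasurable
  · exact (measurable_dyadicExp _ φ).aestronglyMeasurable

/-- Density of continuous functions of compact support, with the uniform bound 2 for the
truncations; the errors add up to 2·η/4 + η/4 + η/4 = η. -/
theorem tendsto_eLpNorm_truncMart (hn : 1 ≤ n) (t : ℕ) {f : Space n → ℂ} (hf : MemLp f 2) :
    Filter.Tendsto (fun M : ℕ => eLpNorm (truncMart t M f - f) 2 volume) Filter.atTop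
      (nhds 0) := by
  rw [ENNReal.tendsto_nhds_zero]
  intro η hη
  have hη4 : η / 4 ≠ 0 := (ENNReal.div_pos hη.ne' (by simp)).ne'
  obtain ⟨φ, hc, hφs, hφ, hφL⟩ := hf.exists_hasCompactSupport_eLpNorm_sub_le ENNReal.ofNat_ne_top
    hη4
  filter_upwards [ENNReal.tendsto_nhds_zero.1
    (tendsto_eLpNorm_truncMart_of_continuous hn t hφ hc) (η / 4)
    (pos_iff_ne_zero.2 hη4)] with M hM
  have e : truncMart t M f - f = (truncMart t M (f - φ)) + ((truncMart t M φ - φ) + (φ - f)) := by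
    rw [truncMart_sub t M hf hφL]
    abel
  have m1 := measurable_truncMart t M (f - φ)
  have m2 := measurable_truncMart t M φ
  rw [e]
  calc _ ≤ eLpNorm (truncMart t M (f - φ)) 2 volume +
        (eLpNorm (truncMart t M φ - φ) 2 volume + eLpNorm (φ - f) 2 volume) := by
        refine (eLpNorm_add_le m1.aestronglyMeasurable ?_ one_le_two).trans
          (add_le_add le_rfl (eLpNorm_add_le ?_ (hφL.sub hf).1 one_le_two))
        · exact (m2.aestronglyMeasurable.sub hφL.1).add (hφL.sub hf).1
        · exact m2.aestronglyMeasurable.sub hφL.1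
    _ ≤ 2 * (η / 4) + (η / 4 + η / 4) := by
        rw [eLpNorm_sub_comm φ f]
        refine add_le_add ((eLpNorm_truncMart_le t M (hf.sub hφL)).trans (mul_le_mul' le_rfl hφs))
          (add_le_add hM hφs)
    _ = η := by
        rw [← two_mul, ← two_mul, ← mul_assoc]
        norm_num
        rw [ENNReal.mul_div_cancel (by norm_num) (by norm_num)]

end Density

/-! ### From finite sums to general f. -/

section Final

variable {n : ℕ} {γ A : ℝ} {k : Space n → Space n → ℂ}

/-- Cauchy–Schwarz on each cube; all cubes of a generation have the same volume, so the bound is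
uniform. -/
theorem exists_norm_dyadicExp_le (j : ℤ) {f : Space n → ℂ} (hf : MemLp f 2) :
    ∃ C, ∀ x, ‖dyadicExp j f x‖ ≤ C := by
  have hlt : ENNReal.ofReal ((size j ^ n)⁻¹) * ∫⁻ y, ‖f y‖ₑ ^ 2 < ⊤ :=
    ENNReal.mul_lt_top ENNReal.ofReal_lt_top ((memLp_two_iff hf.1).1 hf)
  refine ⟨√(ENNReal.ofReal ((size j ^ n)⁻¹) * ∫⁻ y, ‖f y‖ₑ ^ 2).toReal, fun x => ?_⟩
  have hf' := hf.1.enorm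
  set h := hf'.mk _ with hh
  have e : ∫⁻ y, ENNReal.ofReal (avgKernel j x y) * ‖f y‖ₑ
      = ∫⁻ y, ENNReal.ofReal (avgKernel j x y) * h y := by
    refine lintegral_congr_ae ?_
    filter_upwards [hf'.ae_eq_mk] with y hy
    rw [hy]
  have h1 := sq_lintegral_mul_le_weight volume
    ((measurable_ofReal_avgKernel j).of_uncurry_left (x := x)) hf'.measurable_mk
  rw [← hh, ← e, lintegral_avgKernel, one_mul,
    lintegral_avgKernel_mul j x (fun y => h y ^ 2)] at h1
  have h2 : ∫⁻ y in dyadicCube j (dyadicIndex j x), h y ^ 2 ≤ ∫⁻ y, ‖f y‖ₑ ^ 2 := by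
    refine (setLIntegral_le_lintegral _ _).trans_eq (lintegral_congr_ae ?_)
    filter_upwards [hf'.ae_eq_mk] with y hy
    rw [hy]
  have h3 := (pow_le_pow_left' (enorm_dyadicExp_le j f x) 2).trans
    (h1.trans (mul_le_mul' le_rfl h2))
  refine Real.le_sqrt_of_sq_le ?_
  have h4 := ENNReal.toReal_mono hlt.ne h3
  rwa [ENNReal.toReal_pow, toReal_enorm] at h4

theorem dyadicDiff_congr_index {i : ℤ} (f : Space n → ℂ) {x y : Space n}
    (h : dyadicIndex i x = dyadicIndex i y) : dyadicDiff i f x = dyadicDiff i f y := by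
  rw [dyadicDiff, dyadicDiff, dyadicExp_congr_index f h,
    dyadicExp_congr_index f (dyadicIndex_congr_of_le (by omega) h)]

theorem measurable_dyadicDiff (i : ℤ) (f : Space n → ℂ) : Measurable (dyadicDiff i f) :=
  (measurable_dyadicExp _ f).sub (measurable_dyadicExp _ f)

theorem dyadicExp_dyadicDiff (i : ℤ) {f : Space n → ℂ} (hf : MemLp f 2) (x : Space n) :
    dyadicExp (i - 1) (dyadicDiff i f) x = 0 := by
  have h1 : dyadicDiff i f = fun x => dyadicExp i f x - dyadicExp (i - 1) f x := rfl
  rw [h1, dyadicExp_sub _ (integrableOn_dyadicCube_of_memLp (memLp_dyadicExp _ hf) _)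
    (integrableOn_dyadicCube_of_memLp (memLp_dyadicExp _ hf) _),
    dyadicExp_dyadicExp_of_le (by omega) (integrableOn_dyadicCube_of_memLp hf _),
    dyadicExp_dyadicExp_of_ge le_rfl]
  exact sub_self _

theorem isAtom_zero (m : ℤ) : IsAtom m (0 : Space n → ℂ) where
  measurable := measurable_const
  bounded := ⟨0, fun x => by simp⟩
  supp := ⟨0, fun x hx => absurd rfl hx⟩
  dyadicExp_eq_zero x := by
    rw [dyadicExp_of_const _ fun _ _ => rfl]
    rfl

theorem isAtom_indicator_dyadicDiff {m : ℤ} {p : ℕ} (hp : -(p : ℤ) ≤ m) {f : Space n → ℂ}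
    (hf : MemLp f 2) : IsAtom m ((bigBox n p).indicator (dyadicDiff (m + 1) f)) where
  measurable := (measurable_dyadicDiff _ f).indicator (measurableSet_bigBox p)
  bounded := by
    obtain ⟨C, hC⟩ := exists_norm_dyadicExp_le (m + 1) hf
    obtain ⟨D, hD⟩ := exists_norm_dyadicExp_le (m + 1 - 1) hf
    refine ⟨C + D, fun x => (norm_indicator_le_norm_self _ x).trans ?_⟩
    exact (norm_sub_le _ _).trans (add_le_add (hC x) (hD x))
  supp := ⟨2 ^ p, fun x hx => norm_le_of_mem_bigBox (Set.indicator_apply_ne_zero.1 hx).1⟩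
  dyadicExp_eq_zero x := by
    have h : (bigBox n p).indicator (dyadicDiff (m + 1) f)
        = fun y => (bigBox n p).indicator (fun _ => (1 : ℂ)) y * dyadicDiff (m + 1) f y := by
      funext y
      by_cases hy : y ∈ bigBox n p <;> simp [hy]
    have h0 := dyadicExp_dyadicDiff (m + 1) hf x
    rw [add_sub_cancel_right] at h0
    rw [h, dyadicExp_mul_of_const, h0, mul_zero]
    intro y hy
    by_cases hx : x ∈ bigBox n p
    · rw [Set.indicator_of_mem hx,
        Set.indicator_of_mem (mem_bigBox_of_dyadicIndex hp x y hy.symm hx)]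
    · rw [Set.indicator_of_notMem hx,
        Set.indicator_of_notMem fun h => hx (mem_bigBox_of_dyadicIndex hp y x hy h)]

theorem sum_Ioc_sub {E : Type*} [AddCommGroup E] (F : ℤ → E) (a : ℤ) (N : ℕ) :
    ∑ i ∈ Finset.Ioc a (a + N), (F i - F (i - 1)) = F (a + N) - F a := by
  induction N with
  | zero => simp
  | succ N ih =>
    have e : Finset.Ioc a (a + (N + 1 : ℕ)) = insert (a + N + 1) (Finset.Ioc a (a + N)) := by
      ext i
      simp only [Finset.mem_Ioc, Finset.mem_insert]
      push_cast
      omega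
    rw [e, Finset.sum_insert (by simp), ih]
    push_cast
    rw [← add_assoc, add_sub_cancel_right]
    abel

theorem sq_norm_dyadicProj_sub (i : ℤ) (f : L2 n) :
    ‖dyadicProj i f - dyadicProj (i - 1) f‖ ^ 2
      = ‖dyadicProj i f‖ ^ 2 - ‖dyadicProj (i - 1) f‖ ^ 2 := by
  have h : RCLike.re (inner ℂ (dyadicProj i f) (dyadicProj (i - 1) f))
      = ‖dyadicProj (i - 1) f‖ ^ 2 := by
    rw [inner_dyadicProj_dyadicProj (by omega), inner_self_eq_norm_sq]
  rw [norm_sub_sq (𝕜 := ℂ), h]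
  ring

theorem norm_dyadicProj_le (j : ℤ) (f : L2 n) : ‖dyadicProj j f‖ ≤ ‖f‖ := by
  rw [dyadicProj, Lp.norm_toLp, Lp.norm_def]
  exact ENNReal.toReal_mono (Lp.eLpNorm_ne_top f) (eLpNorm_dyadicExp_le j (Lp.memLp f))

theorem sum_sq_norm_dyadicProj_sub_le (f : L2 n) (a : ℤ) (N : ℕ) :
    ∑ i ∈ Finset.Ioc a (a + N), ‖dyadicProj i f - dyadicProj (i - 1) f‖ ^ 2 ≤ ‖f‖ ^ 2 := by
  simp_rw [sq_norm_dyadicProj_sub]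
  rw [sum_Ioc_sub (fun i => ‖dyadicProj i f‖ ^ 2)]
  have h1 := pow_le_pow_left₀ (norm_nonneg _) (norm_dyadicProj_le (a + N) f) 2
  have h2 := sq_nonneg ‖dyadicProj a f‖
  linarith

theorem measurableSet_concentricFather (δ : ℝ) (i : ℤ) (j : Fin n → ℤ) :
    MeasurableSet (concentricFather δ i j) := by
  have : concentricFather δ i j = Set.pi Set.univ fun l =>
      Set.Ico (((j l : ℝ) + 1 / 2) * size i - δ * size i / 2)
        (((j l : ℝ) + 1 / 2) * size i + δ * size i / 2) := by
    ext x; simp [concentricFather]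
  rw [this]
  exact MeasurableSet.univ_pi fun _ => measurableSet_Ico

theorem measurableSet_dilatedSigma (ξ : ℝ) (f : Space n → ℂ) :
    MeasurableSet (dilatedSigma ξ f) :=
  MeasurableSet.iUnion fun _ => MeasurableSet.iUnion fun _ => MeasurableSet.iUnion fun _ =>
    measurableSet_concentricFather _ _ _

/-- In some coordinate `x` is at least 9ξ/2 edges from the centre of the cube of `y`, while `y` is
at most half an edge from it. -/
theorem le_norm_sub_of_notMem_dilatedSigma {ξ : ℝ} (f : Space n → ℂ) {x : Space n}
    (hx : x ∉ dilatedSigma ξ f) {i : ℤ} {y : Space n} (hy : dyadicDiff i f y ≠ 0) :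
    (ξ * 9 - 1) / 2 * size i ≤ ‖x - y‖ := by
  have hsub : dyadicCube i (dyadicIndex i y) ⊆ Function.support (dyadicDiff i f) := by
    intro z hz
    rw [Function.mem_support, dyadicDiff_congr_index f ((mem_dyadicCube_iff _ _ _).1 hz)]
    exact hy
  have hx2 : x ∉ concentricFather (ξ * 9) i (dyadicIndex i y) := fun h =>
    hx (Set.mem_iUnion.2 ⟨i, Set.mem_iUnion.2 ⟨_, Set.mem_iUnion.2 ⟨hsub, h⟩⟩⟩)
  have hyc := mem_dyadicCube_dyadicIndex i y
  obtain ⟨l, hl⟩ : ∃ l, x l < ((dyadicIndex i y l : ℝ) + 1 / 2) * size i - ξ * 9 * size i / 2 ∨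
      ((dyadicIndex i y l : ℝ) + 1 / 2) * size i + ξ * 9 * size i / 2 ≤ x l := by
    by_contra hcon
    push Not at hcon
    exact hx2 fun l => ⟨(hcon l).1, (hcon l).2⟩
  have hyl := hyc l
  rw [Set.mem_Ico] at hyl
  have h1 : |x l - y l| ≤ ‖x - y‖ := norm_le_pi_norm (x - y) l
  refine le_trans ?_ h1
  rcases hl with hl | hl
  · rw [abs_sub_comm]
    refine le_trans ?_ (le_abs_self _)
    linarith
  · refine le_trans ?_ (le_abs_self _)
    linarith

/-- The estimate for the truncated martingale approximations of `f`. -/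
theorem eLpNorm_apply_truncMart_le (hn : 1 ≤ n) (hk : IsLipschitzKernel γ A k)
    (hγ0 : 0 < γ) (hγ1 : γ ≤ 1) {T : L2 n →L[ℂ] L2 n} (hT : IsAssociated T k) (hT1 : ‖T‖ ≤ 1)
    {t : ℕ} {ξ : ℝ} (hξ : (2 : ℝ) ^ (t + 2) ≤ ξ) (f : L2 n) (M : ℕ) :
    eLpNorm (T ((memLp_truncMart t M (Lp.memLp f)).toLp _)) 2
      (volume.restrict (dilatedSigma ξ f)ᶜ) ≤
      ENNReal.ofReal (locConst n γ * max 1 A * decay γ ^ t * ‖f‖) := by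
  -- Chosen so that i + t + 1 runs over (-M, M] and every index i ≥ -(M + t + 1), which makes the
  -- box a union of cubes of each generation involved.
  set a : ℤ := -(M : ℤ) - t - 1 with ha
  set s := Finset.Ioc a (a + (2 * M : ℕ)) with hs
  set p := M + t + 1 with hp
  have hf := Lp.memLp f
  set g : ℤ → Space n → ℂ := fun i =>
    if i ∈ s then (bigBox n p).indicator (dyadicDiff (i + t + 1) f) else 0 with hg_def
  have hgs : ∀ i ∈ s, g i = (bigBox n p).indicator (dyadicDiff (i + t + 1) f) := fun i hi =>
    if_pos hi
  have hps : ∀ i ∈ s, -(p : ℤ) ≤ i := by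
    intro i hi
    have := (Finset.mem_Ioc.1 hi).1
    omega
  have hg : ∀ i : ℤ, IsAtom (i + t) (g i) := by
    intro i
    by_cases hi : i ∈ s
    · rw [hgs i hi]
      exact isAtom_indicator_dyadicDiff ((hps i hi).trans (by omega)) hf
    · have : g i = 0 := if_neg hi
      rw [this]
      exact isAtom_zero _
  have hgB : ∀ i y, g i y ≠ 0 → y ∈ bigBox n p := by
    intro i y hy
    by_cases hi : i ∈ s
    · rw [hgs i hi] at hy
      exact (Set.indicator_apply_ne_zero.1 hy).1
    · have : g i = 0 := if_neg hi
      rw [this] at hy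
      exact absurd rfl hy
  -- Since size i = 2^(t+1) size (i+t+1) and ξ ≥ 2·2^(t+1), one has (9ξ - 1)/2 ≥ 9·2^(t+1) - 1/2 ≥
  -- 5·2^(t+1).
  have hfar : ∀ x ∈ (dilatedSigma ξ f)ᶜ, ∀ i ∈ s, ∀ y, g i y ≠ 0 → 5 * size i ≤ ‖x - y‖ := by
    intro x hx i hi y hy
    rw [hgs i hi] at hy
    refine le_trans ?_ (le_norm_sub_of_notMem_dilatedSigma f hx (Set.indicator_apply_ne_zero.1 hy).2)
    have e : size i = 2 ^ (t + 1) * size (i + t + 1) := by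
      rw [add_assoc, size_add, show ((t : ℤ) + 1) = ((t + 1 : ℕ) : ℤ) by push_cast; rfl,
        size_natCast, one_div, inv_pow]
      field_simp
    rw [e, ← mul_assoc]
    refine mul_le_mul_of_nonneg_right ?_ (size_pos _).le
    have h1 : (1 : ℝ) ≤ 2 ^ (t + 1) := one_le_pow₀ one_le_two
    rw [pow_succ] at hξ
    linarith
  have hmain := setLIntegral_sq_sum_le hn hk hγ0 hγ1 hT hT1 t hg s (measurableSet_bigBox p)
    (volume_bigBox_ne_top p) (fun i hi => mem_bigBox_of_dyadicIndex (hps i hi)) hgB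
    (measurableSet_dilatedSigma ξ f).compl hfar
  have hsum : ∑ i ∈ s, ((hg i).memLp 2).toLp (g i)
      = (memLp_truncMart t M hf).toLp (truncMart t M f) := by
    refine Lp.ext ?_
    have h1 : ∀ᵐ x, ∀ i, ((hg i).memLp 2).toLp (g i) x = g i x :=
      ae_all_iff.2 fun i => MemLp.coeFn_toLp _
    filter_upwards [Lp.coeFn_finsetSum s fun i => ((hg i).memLp 2).toLp (g i), h1,
      (memLp_truncMart t M hf).coeFn_toLp] with x h2 h3 h4
    rw [h2, h4, Finset.sum_apply]
    simp_rw [h3]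
    rw [Finset.sum_congr rfl fun i hi => by rw [hgs i hi]]
    by_cases hx : x ∈ bigBox n p
    · simp only [truncMart, ← hp, Set.indicator_of_mem hx]
      have h5 := sum_Ioc_sub (fun i => dyadicExp (i + t + 1) f x) a (2 * M)
      have e1 : a + (2 * M : ℕ) + t + 1 = M := by push_cast; omega
      have e2 : a + t + 1 = -(M : ℤ) := by omega
      rw [e1, e2] at h5
      rw [← h5]
      refine Finset.sum_congr rfl fun i _ => ?_
      rw [dyadicDiff, show i - 1 + (t : ℤ) + 1 = i + t + 1 - 1 by ring]
    · simp only [truncMart, ← hp, Set.indicator_of_notMem hx, Finset.sum_const_zero]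
  have hnorm : ∑ i ∈ s, ‖((hg i).memLp 2).toLp (g i)‖ ^ 2 ≤ ‖f‖ ^ 2 := by
    have h1 : ∀ i ∈ s, ‖((hg i).memLp 2).toLp (g i)‖ ^ 2 ≤
        ‖dyadicProj (i + t + 1) f - dyadicProj (i + t + 1 - 1) f‖ ^ 2 := by
      intro i hi
      refine pow_le_pow_left₀ (norm_nonneg _) ?_ 2
      rw [dyadicProj, dyadicProj, ← MemLp.toLp_sub, Lp.norm_toLp, Lp.norm_toLp]
      refine ENNReal.toReal_mono ((memLp_dyadicExp _ hf).sub (memLp_dyadicExp _ hf)).2.ne ?_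
      rw [hgs i hi]
      exact eLpNorm_indicator_le _
    refine (Finset.sum_le_sum h1).trans ?_
    refine le_trans (le_of_eq ?_) (sum_sq_norm_dyadicProj_sub_le f (a + (t + 1 : ℕ)) (2 * M))
    refine Finset.sum_bij (fun i _ => i + t + 1) ?_ ?_ ?_ ?_
    · intro i hi
      have := Finset.mem_Ioc.1 hi
      rw [Finset.mem_Ioc]
      push_cast at this ⊢
      omega
    · intro i _ j _ hij
      omega
    · intro i hi
      refine ⟨i - t - 1, ?_, by ring⟩
      have := Finset.mem_Ioc.1 hi
      rw [hs, Finset.mem_Ioc]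
      push_cast at this ⊢
      omega
    · intro i _
      rfl
  rw [hsum] at hmain
  rw [← ENNReal.pow_le_pow_left_iff two_ne_zero]
  have hC : 0 ≤ locConst n γ * max 1 A * decay γ ^ t :=
    mul_nonneg (mul_nonneg (locConst_nonneg n γ) (zero_le_one.trans (le_max_left _ _)))
      (pow_nonneg (decay_pos γ).le t)
  rw [sq_eLpNorm_two, ← ENNReal.ofReal_pow (mul_nonneg hC (norm_nonneg _))]
  refine hmain.trans (ENNReal.ofReal_le_ofReal
    (pow_le_pow_left₀ (mul_nonneg hC (Real.sqrt_nonneg _)) ?_ 2))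
  exact mul_le_mul_of_nonneg_left (Real.sqrt_le_iff.2 ⟨norm_nonneg _, hnorm⟩) hC

/-- The bound for the truncations is uniform in `M` and holds off the same set `dilatedSigma ξ f`,
because truncating only shrinks the supports of the differences. The error is controlled by ‖T‖ ≤ 1.
-/
theorem eLpNorm_apply_le (hn : 1 ≤ n) (hk : IsLipschitzKernel γ A k)
    (hγ0 : 0 < γ) (hγ1 : γ ≤ 1) {T : L2 n →L[ℂ] L2 n} (hT : IsAssociated T k) (hT1 : ‖T‖ ≤ 1)
    {t : ℕ} {ξ : ℝ} (hξ : (2 : ℝ) ^ (t + 2) ≤ ξ) (f : L2 n) :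
    eLpNorm (T f) 2 (volume.restrict (dilatedSigma ξ f)ᶜ) ≤
      ENNReal.ofReal (locConst n γ * max 1 A * decay γ ^ t * ‖f‖) := by
  set K := ENNReal.ofReal (locConst n γ * max 1 A * decay γ ^ t * ‖f‖)
  have hf := Lp.memLp f
  have hbound : ∀ M : ℕ, eLpNorm (T f) 2 (volume.restrict (dilatedSigma ξ f)ᶜ) ≤
      K + eLpNorm (truncMart t M f - (f : Space n → ℂ)) 2 volume := by
    intro M
    set h := (memLp_truncMart t M hf).toLp (truncMart t M f)
    have e : (T f : Space n → ℂ) =ᵐ[volume.restrict (dilatedSigma ξ f)ᶜ] T h + T (f - h) := by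
      refine ae_restrict_of_ae ?_
      have : T f = T h + T (f - h) := by rw [← map_add]; congr 1; abel
      conv_lhs => rw [this]
      exact Lp.coeFn_add _ _
    rw [eLpNorm_congr_ae e]
    refine (eLpNorm_add_le (Lp.aestronglyMeasurable _).restrict
      (Lp.aestronglyMeasurable _).restrict one_le_two).trans (add_le_add
        (eLpNorm_apply_truncMart_le hn hk hγ0 hγ1 hT hT1 hξ f M) ?_)
    refine (eLpNorm_mono_measure _ Measure.restrict_le_self).trans ?_
    rw [← Lp.enorm_def, ← ofReal_norm]
    refine (ENNReal.ofReal_le_ofReal ((T.le_opNorm _).trans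
      (mul_le_of_le_one_left (norm_nonneg _) hT1))).trans_eq ?_
    rw [ofReal_norm, Lp.enorm_def, eLpNorm_sub_comm]
    refine eLpNorm_congr_ae ?_
    filter_upwards [Lp.coeFn_sub f h, (memLp_truncMart t M hf).coeFn_toLp] with x h1 h2
    rw [h1, Pi.sub_apply, Pi.sub_apply, h2]
  have hlim := (tendsto_eLpNorm_truncMart hn t hf).const_add K
  rw [add_zero] at hlim
  exact ge_of_tendsto' hlim hbound

end Final

end PseudoLoc

theorem mainTheorem9 (n : ℕ) (hn : 1 ≤ n) (γ : ℝ) (hγ0 : 0 < γ) (hγ1 : γ ≤ 1) :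
    ∃ c : ℝ, 0 < c ∧
      ∀ (f : PseudoLoc.L2 n) (ξ : ℝ), 4 < ξ →
        ∀ (A : ℝ) (T : PseudoLoc.L2 n →L[ℂ] PseudoLoc.L2 n),
          PseudoLoc.IsCZO γ A T → ‖T‖ ≤ 1 →
            Real.sqrt (∫ x in (PseudoLoc.dilatedSigma ξ f)ᶜ, ‖T f x‖ ^ 2) ≤
              c * max 1 A * ξ ^ (-γ / 4) * Real.log ξ * Real.sqrt (∫ x, ‖f x‖ ^ 2) := by
  have hl := PseudoLoc.locConst_nonneg n γ
  have hd := PseudoLoc.decay_pos γ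
  -- The summand 1 only secures positivity. The factor ρ^(-3), ρ = `decay γ`, pays for ξ < 2^(t+3):
  -- ρ^(t+3) = (2^(t+3))^(-γ/4) ≤ ξ^(-γ/4).
  refine ⟨(PseudoLoc.locConst n γ + 1) * (PseudoLoc.decay γ ^ 3)⁻¹, by positivity, ?_⟩
  rintro f ξ hξ A T ⟨k, hk, hT⟩ hT1
  have hξ0 : 0 < ξ := by linarith
  obtain ⟨m, hm1, hm2⟩ := exists_nat_pow_near (by linarith : 1 ≤ ξ) one_lt_two
  have hm : 2 ≤ m := by
    by_contra hlt
    have h1 : (2 : ℝ) ^ (m + 1) ≤ 2 ^ 2 := pow_le_pow_right₀ one_le_two (by omega)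
    linarith
  obtain ⟨t, rfl⟩ := Nat.exists_eq_add_of_le' hm
  have hmain := PseudoLoc.eLpNorm_apply_le hn hk hγ0 hγ1 hT hT1 hm1 f
  have hM : 0 ≤ max 1 A := zero_le_one.trans (le_max_left _ _)
  have hsq : ∀ (u : PseudoLoc.L2 n) (μ : MeasureTheory.Measure (PseudoLoc.Space n)),
      MeasureTheory.MemLp u 2 μ →
      Real.sqrt (∫ x, ‖u x‖ ^ 2 ∂μ) = (MeasureTheory.eLpNorm u 2 μ).toReal := by
    intro u μ hu
    rw [hu.eLpNorm_eq_integral_rpow_norm two_ne_zero ENNReal.ofNat_ne_top,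
      ENNReal.toReal_ofReal (by positivity), Real.sqrt_eq_rpow]
    norm_num
  have h1 : Real.sqrt (∫ x in (PseudoLoc.dilatedSigma ξ f)ᶜ, ‖T f x‖ ^ 2) ≤
      PseudoLoc.locConst n γ * max 1 A * PseudoLoc.decay γ ^ t * ‖f‖ := by
    rw [hsq _ _ ((MeasureTheory.Lp.memLp _).restrict _)]
    exact ENNReal.toReal_le_of_le_ofReal (by positivity) hmain
  have h2 : Real.sqrt (∫ x, ‖f x‖ ^ 2) = ‖f‖ := by
    rw [hsq _ _ (MeasureTheory.Lp.memLp _), MeasureTheory.Lp.norm_def]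
  have h3 : PseudoLoc.decay γ ^ t ≤ (PseudoLoc.decay γ ^ 3)⁻¹ * ξ ^ (-γ / 4) := by
    have e1 : PseudoLoc.decay γ ^ (t + 3) = ((2 : ℝ) ^ (t + 3)) ^ (-γ / 4) := by
      rw [PseudoLoc.decay, one_div, Real.inv_rpow (by norm_num), ← Real.rpow_neg (by norm_num),
        ← Real.rpow_natCast, ← Real.rpow_natCast, ← Real.rpow_mul (by norm_num),
        ← Real.rpow_mul (by norm_num)]
      congr 1
      ring
    have e2 : ((2 : ℝ) ^ (t + 3)) ^ (-γ / 4) ≤ ξ ^ (-γ / 4) :=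
      Real.rpow_le_rpow_of_nonpos hξ0 hm2.le (by linarith)
    rw [← e1, pow_add] at e2
    rw [inv_mul_eq_div, le_div_iff₀ (by positivity)]
    exact e2
  -- Here ξ > 4 > e.
  have h4 : 1 ≤ Real.log ξ := by
    rw [Real.le_log_iff_exp_le hξ0]
    linarith [Real.exp_one_lt_d9]
  rw [h2]
  refine h1.trans ?_
  calc PseudoLoc.locConst n γ * max 1 A * PseudoLoc.decay γ ^ t * ‖f‖
      ≤ (PseudoLoc.locConst n γ + 1) * max 1 A *
          ((PseudoLoc.decay γ ^ 3)⁻¹ * ξ ^ (-γ / 4)) * ‖f‖ := by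
        gcongr
        linarith
    _ = (PseudoLoc.locConst n γ + 1) * (PseudoLoc.decay γ ^ 3)⁻¹ * max 1 A * ξ ^ (-γ / 4) * 1 *
          ‖f‖ := by ring
    _ ≤ _ := by gcongr
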